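/- Let $A$ be a weak Kac algebra, i.e. a finite dimensional weak $C^*$-Hopf algebra (in the sense of Böhm–Nill–Szlachányi) with coproduct $\Delta$, counit $\varepsilon$ and antipode $S$ satisfying $S^2=\mathrm{id}$. Put $\sqcap^L(x)=\varepsilon(1_{(1)}x)1_{(2)}$, $\sqcap^R(x)=1_{(1)}\varepsilon(x1_{(2)})$, $A^L=\sqcap^L(A)$, $A^R=\sqcap^R(A)$, $Z^L=A^L\cap\mathrm{Center}\,A$ and $\mathrm{Hypercenter}\,A=A^L\cap A^R\cap\mathrm{Center}\,A$; let $z_H$, $H\in\mathrm{Hyp}\,A$, be the minimal projections of the hypercenter. A vacuum $\mu$ is an irreducible representation of $A$ that occurs in the trivial representation $V_\varepsilon$ (the GNS representation of $\varepsilon$); $z^L_\mu$ is the minimal projection of $Z^L$ that acts on $V_\varepsilon$ as the projection onto the component $\mu$, and $[\mu]\in\mathrm{Hyp}\,A$ is determined by $z_{[\mu]}z^L_\mu=z^L_\mu$. Let $\hat h\colon A\to\mathbb C$ be the Haar functional (the normalized two-sided integral of the dual of $A$), and let $E^L(x)=x_{(1)}\hat h(x_{(2)})$, $E^R(x)=\hat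 h(x_{(1)})x_{(2)}$ be the Haar conditional expectations onto $A^L$ and $A^R$. Let $\tau_M$ be the Markov trace: the faithful positive trace with $\tau_M(z_H)=1$ for all $H$ which is a Markov trace for both inclusions $A^L\subset A$ and $A^R\subset A$, i.e. for each of them, on every connected component, the trace vector of $\tau_M$ is a Perron–Frobenius eigenvector of $\Lambda\Lambda^t$, where $\Lambda$ is the inclusion matrix. Let $E^L_M$, $E^R_M$ be the $\tau_M$-preserving conditional expectations onto $A^L$, $A^R$. Then $\hat h$ and $\tau_M$ exist, and the following hold. 1. The (Watatani) indices of the Haar and of the Markov conditional expectations coincide and are hypercentral: $\mathrm{Index}\,E^L=\mathrm{Index}\,E^R=I_H=I_M=\mathrm{Index}\,E^L_M=\mathrm{Index}\,E^R_M\in\mathrm{Hypercenter}\,A$. On each hypercentral block $z_HA$ this index is a natural number multiple of $z_H$. 2. For each vacuum $\mu$, $\dim z^L_\mu A$ is divisible by $\dim z^L_\mu A^L\neq0$, and the ratio is the value of $I_H=I_M$ on the hypercentral block $[\mu]$; in particular the ratio is constant over the block. 3. If $A$ is pure, i.e. $V_\varepsilon$ is irreducible, then $\dim A^L$ divides $\dim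 A$. -/

import Mathlib

open TensorProduct Coalgebra
open scoped ComplexOrder

noncomputable section

namespace WeakKac

section WeakHopf

variable (A : Type*) [Ring A] [Algebra ℂ A] [Coalgebra ℂ A]

/-- The map `Π^L(x) = ε(1₍₁₎ x) 1₍₂₎`. -/
def piL : A →ₗ[ℂ] A where
  toFun x := TensorProduct.lid ℂ A
    (LinearMap.rTensor A (counit (R := ℂ) ∘ₗ LinearMap.mulRight ℂ x) (comul (R := ℂ) (1 : A)))
  map_add' x y := by
    have : LinearMap.mulRight ℂ (x + y) = LinearMap.mulRight ℂ x + LinearMap.mulRight ℂ y := by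
      ext; simp [mul_add]
    simp [this, LinearMap.comp_add, LinearMap.rTensor_add]
  map_smul' c x := by
    have : LinearMap.mulRight ℂ (c • x) = c • LinearMap.mulRight ℂ x := by ext; simp
    simp [this, LinearMap.comp_smul, LinearMap.rTensor_smul]

/-- The map `Π^R(x) = 1₍₁₎ ε(x 1₍₂₎)`. -/
def piR : A →ₗ[ℂ] A where
  toFun x := TensorProduct.rid ℂ A
    (LinearMap.lTensor A (counit (R := ℂ) ∘ₗ LinearMap.mulLeft ℂ x) (comul (R := ℂ) (1 : A)))
  map_add' x y := by
    have : LinearMap.mulLeft ℂ (x + y) = LinearMap.mulLeft ℂ x + LinearMap.mulLeft ℂ y := by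
      ext; simp [add_mul]
    simp [this, LinearMap.comp_add, LinearMap.lTensor_add]
  map_smul' c x := by
    have : LinearMap.mulLeft ℂ (c • x) = c • LinearMap.mulLeft ℂ x := by ext; simp
    simp [this, LinearMap.comp_smul, LinearMap.lTensor_smul]

/-- A weak Hopf algebra structure (Böhm–Nill–Szlachányi) on an algebra that is also a coalgebra:
the coproduct is multiplicative (but need not preserve the unit), the counit is weakly
multiplicative, the unit is weakly comultiplicative, and there is an antipode. -/
class WeakHopfAlgebra where
  /-- `Δ(xy) = Δ(x)Δ(y)` -/
  comul_mul : ∀ x y : A, comul (R := ℂ) (x * y) = comul (R := ℂ) x * comul (R := ℂ) y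
  /-- `ε(xyz) = ε(x y₍₁₎) ε(y₍₂₎ z)` -/
  counit_mul_mul : ∀ x y z : A, counit (R := ℂ) (x * y * z) =
    LinearMap.mul' ℂ ℂ (TensorProduct.map (counit (R := ℂ) ∘ₗ LinearMap.mulLeft ℂ x)
      (counit (R := ℂ) ∘ₗ LinearMap.mulRight ℂ z) (comul (R := ℂ) y))
  /-- `ε(xyz) = ε(x y₍₂₎) ε(y₍₁₎ z)` -/
  counit_mul_mul' : ∀ x y z : A, counit (R := ℂ) (x * y * z) =
    LinearMap.mul' ℂ ℂ (TensorProduct.map (counit (R := ℂ) ∘ₗ LinearMap.mulRight ℂ z)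
      (counit (R := ℂ) ∘ₗ LinearMap.mulLeft ℂ x) (comul (R := ℂ) y))
  /-- `(Δ ⊗ id)(Δ(1)) = (Δ(1) ⊗ 1)(1 ⊗ Δ(1))` -/
  comul_comul_one : LinearMap.rTensor A (comul (R := ℂ)) (comul (R := ℂ) (1 : A)) =
    (comul (R := ℂ) (1 : A) ⊗ₜ[ℂ] (1 : A)) *
      (TensorProduct.assoc ℂ A A A).symm ((1 : A) ⊗ₜ[ℂ] comul (R := ℂ) (1 : A))
  /-- `(Δ ⊗ id)(Δ(1)) = (1 ⊗ Δ(1))(Δ(1) ⊗ 1)` -/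
  comul_comul_one' : LinearMap.rTensor A (comul (R := ℂ)) (comul (R := ℂ) (1 : A)) =
    (TensorProduct.assoc ℂ A A A).symm ((1 : A) ⊗ₜ[ℂ] comul (R := ℂ) (1 : A)) *
      (comul (R := ℂ) (1 : A) ⊗ₜ[ℂ] (1 : A))
  /-- The antipode `S`. -/
  antipode : A →ₗ[ℂ] A
  /-- `x₍₁₎ S(x₍₂₎) = Π^L(x)` -/
  mul_antipode : ∀ x : A,
    LinearMap.mul' ℂ A (LinearMap.lTensor A antipode (comul (R := ℂ) x)) = piL A x
  /-- `S(x₍₁₎) x₍₂₎ = Π^R(x)` -/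
  antipode_mul : ∀ x : A,
    LinearMap.mul' ℂ A (LinearMap.rTensor A antipode (comul (R := ℂ) x)) = piR A x
  /-- `S(x₍₁₎) x₍₂₎ S(x₍₃₎) = S(x)` -/
  antipode_mul_antipode : ∀ x : A,
    LinearMap.mul' ℂ A (TensorProduct.map
      (LinearMap.mul' ℂ A ∘ₗ LinearMap.rTensor A antipode ∘ₗ comul (R := ℂ)) antipode
      (comul (R := ℂ) x)) = antipode x

/-- The left subalgebra `A^L = Π^L(A)`. -/
def leftSub : Submodule ℂ A := LinearMap.range (piL A)

/-- The right subalgebra `A^R = Π^R(A)`. -/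
def rightSub : Submodule ℂ A := LinearMap.range (piR A)

/-- The centre of `A`, as a subspace. -/
def centerSub : Submodule ℂ A := Subalgebra.toSubmodule (Subalgebra.center ℂ A)

/-- `Z^L = A^L ∩ Center A`. -/
def zL : Submodule ℂ A := leftSub A ⊓ centerSub A

/-- `Hypercenter A = A^L ∩ A^R ∩ Center A`. -/
def hypercenter : Submodule ℂ A := leftSub A ⊓ rightSub A ⊓ centerSub A

variable {A}

/-- The arrow `x ⇀ φ` of `A` on functionals: `(x ⇀ φ)(y) = φ(y x)`. -/
def arrow (x : A) (φ : Module.Dual ℂ A) : Module.Dual ℂ A := φ ∘ₗ LinearMap.mulRight ℂ x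

/-- The product of the dual algebra: `(φ ψ)(x) = φ(x₍₁₎) ψ(x₍₂₎)`. -/
def dualMul (φ ψ : Module.Dual ℂ A) : Module.Dual ℂ A :=
  LinearMap.mul' ℂ ℂ ∘ₗ TensorProduct.map φ ψ ∘ₗ comul (R := ℂ)

/-- `h` is the Haar integral of the dual weak Hopf algebra, i.e. the Haar functional on `A`:
a two-sided integral, `φ h = Π̂^L(φ) h` and `h φ = h Π̂^R(φ)`, which is normalized,
`Π̂^L(h) = 1̂ = Π̂^R(h)`. In the dual weak Hopf algebra `1̂ = ε`,
`Π̂^L(φ) = φ ∘ Π^L` and `Π̂^R(φ) = φ ∘ Π^R`. -/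
structure IsHaarFunctional (h : Module.Dual ℂ A) : Prop where
  left_integral : ∀ φ : Module.Dual ℂ A, dualMul φ h = dualMul (φ ∘ₗ piL A) h
  right_integral : ∀ φ : Module.Dual ℂ A, dualMul h φ = dualMul h (φ ∘ₗ piR A)
  left_normalized : h ∘ₗ piL A = counit (R := ℂ)
  right_normalized : h ∘ₗ piR A = counit (R := ℂ)

/-- `E^L(x) = h ⇀ x = x₍₁₎ h(x₍₂₎)`. -/
def haarEL (h : Module.Dual ℂ A) : A →ₗ[ℂ] A :=
  (TensorProduct.rid ℂ A).toLinearMap ∘ₗ LinearMap.lTensor A h ∘ₗ comul (R := ℂ)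

/-- `E^R(x) = x ↼ h = h(x₍₁₎) x₍₂₎`. -/
def haarER (h : Module.Dual ℂ A) : A →ₗ[ℂ] A :=
  (TensorProduct.lid ℂ A).toLinearMap ∘ₗ LinearMap.rTensor A h ∘ₗ comul (R := ℂ)

variable (A)

/-- The trivial left `A`-module `V_ε = {x ⇀ ε : x ∈ A}` (the module of the GNS representation of
the counit), with action `arrow`. -/
def trivialRep : Submodule ℂ (Module.Dual ℂ A) :=
  LinearMap.range ({ toFun := fun x => arrow x (counit (R := ℂ))
                     map_add' := by intros; ext; simp [arrow, mul_add]
                     map_smul' := by intros; ext; simp [arrow] } : A →ₗ[ℂ] Module.Dual ℂ A)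

/-- `A` is pure: the trivial representation `V_ε` is irreducible. -/
def IsPure : Prop :=
  trivialRep A ≠ ⊥ ∧ ∀ W : Submodule ℂ (Module.Dual ℂ A), W ≤ trivialRep A →
    (∀ (x : A), ∀ φ ∈ W, arrow x φ ∈ W) → W = ⊥ ∨ W = trivialRep A

end WeakHopf

section CStar

variable {A : Type*} [CStarAlgebra A]

/-- `p` is a minimal projection of (the *-subalgebra) `B`. -/
def IsMinProj (B : Submodule ℂ A) (p : A) : Prop :=
  p ∈ B ∧ IsStarProjection p ∧ p ≠ 0 ∧
    ∀ q ∈ B, IsStarProjection q → q * p = q → q = 0 ∨ q = p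

/-- `e` lists one minimal projection out of each simple block of the *-subalgebra `B`. -/
structure IsSectorSystem (B : Submodule ℂ A) {n : ℕ} (e : Fin n → A) : Prop where
  minimal : ∀ i, IsMinProj B (e i)
  inequivalent : ∀ i j, i ≠ j → ∀ x ∈ B, e i * x * e j = 0
  exhaustive : ∀ p, IsMinProj B p → ∃ i, ∃ x ∈ B, p * x * e i ≠ 0

/-- The entry of the inclusion matrix of `B ⊆ A` at the block of the minimal projection `e` of `A`
and the block of the minimal projection `f` of `B`: the multiplicity of the simple `B`-module `B f`
in the simple `A`-module `A e`, i.e. `dim Hom_B(B f, A e) = dim (f A e)`. -/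
def inclusionMult (e f : A) : ℕ :=
  Module.finrank ℂ (LinearMap.range (LinearMap.mulLeft ℂ f ∘ₗ LinearMap.mulRight ℂ e))

/-- `τ` is a faithful positive trace on `A`. -/
structure IsFaithfulTrace (τ : A →ₗ[ℂ] ℂ) : Prop where
  trace : ∀ x y, τ (x * y) = τ (y * x)
  faithful : ∀ x, x ≠ 0 → 0 < τ (star x * x)

/-- `τ` is a Markov trace for the inclusion `B ⊆ A`: a faithful trace such that on every
connected component (minimal projection `z` of `Center A ∩ Center B = B ∩ Center A`) its trace
vector `t_i = τ(e_i)`, which is positive, is a Perron–Frobenius eigenvector of `Λ Λᵗ`, where `Λ` is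
the inclusion matrix. -/
structure IsMarkovTraceFor (B : Submodule ℂ A) (τ : A →ₗ[ℂ] ℂ) : Prop where
  isFaithfulTrace : IsFaithfulTrace τ
  perron_frobenius : ∀ (n m : ℕ) (e : Fin n → A) (f : Fin m → A),
    IsSectorSystem (⊤ : Submodule ℂ A) e → IsSectorSystem B f →
    ∀ z, IsMinProj (B ⊓ Subalgebra.toSubmodule (Subalgebra.center ℂ A)) z →
      ∃ r : ℂ, ∀ i, z * e i = e i →
        ∑ i', (∑ j, (inclusionMult (e i) (f j) : ℂ) * (inclusionMult (e i') (f j) : ℂ)) * τ (e i')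
          = r * τ (e i)

/-- `E` is a conditional expectation of `A` onto the unital *-subalgebra `B`. -/
structure IsCondExp (B : Submodule ℂ A) (E : A →ₗ[ℂ] A) : Prop where
  mem : ∀ x, E x ∈ B
  apply_of_mem : ∀ b ∈ B, E b = b
  bimodule : ∀ b ∈ B, ∀ c ∈ B, ∀ x, E (b * x * c) = b * E x * c
  positive : ∀ x, ∃ y, E (star x * x) = star y * y

/-- `E` is a conditional expectation onto `B` with Watatani index `I`: there is a quasi-basis
`∑ aᵢ ⊗ bᵢ` of `E`, and `I = ∑ aᵢ bᵢ` (this sum is the same for every quasi-basis). -/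
def HasIndex (B : Submodule ℂ A) (E : A →ₗ[ℂ] A) (I : A) : Prop :=
  IsCondExp B E ∧ ∃ (n : ℕ) (a b : Fin n → A),
    (∀ x, ∑ i, a i * E (b i * x) = x) ∧ (∀ x, ∑ i, E (x * a i) * b i = x) ∧
    I = ∑ i, a i * b i

/-- `E` is a `τ`-preserving conditional expectation onto `B`. -/
def IsPreservingCondExp (B : Submodule ℂ A) (τ : A →ₗ[ℂ] ℂ) (E : A →ₗ[ℂ] A) : Prop :=
  IsCondExp B E ∧ ∀ b ∈ B, ∀ x, τ (b * E x) = τ (b * x)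

variable (A) [Coalgebra ℂ A]

/-- A weak Kac algebra: a finite dimensional weak C*-Hopf algebra (a weak Hopf algebra on a
finite dimensional C*-algebra whose coproduct is a *-map) with involutive antipode. -/
class WeakKacAlgebra extends WeakHopfAlgebra A where
  finiteDimensional : FiniteDimensional ℂ A
  comul_star : ∀ x : A, comul (R := ℂ) (star x) = star (comul (R := ℂ) x)
  antipode_antipode : ∀ x : A, antipode (antipode x) = x

variable {A}

/-- `e` is the minimal central projection `e_q` of a sector `q` of `A`. -/
def IsSector (e : A) : Prop := IsMinProj (centerSub A) e

/-- `e` is the minimal central projection of a vacuum: a sector that occurs in `V_ε`, i.e. `e`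
acts on `V_ε` by a nonzero operator. -/
def IsVacuum (e : A) : Prop := IsSector e ∧ ∃ φ ∈ trivialRep A, arrow e φ ≠ 0

/-- `z = z_μ^L` for the vacuum `μ` with minimal central projection `e`: the minimal projection of
`Z^L` that acts on `V_ε` as `e` does (it is unique, as `V_ε` is a faithful `A^L`-module), i.e. as the projection onto the component `μ` of `V_ε`. -/
def IsLeftVacuumProj (e z : A) : Prop :=
  IsMinProj (zL A) z ∧ ∀ φ ∈ trivialRep A, arrow z φ = arrow e φ

/-- `H` is the minimal hypercentral projection `z_H` of a hyperselection sector. -/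
def IsHyperSector (H : A) : Prop := IsMinProj (hypercenter A) H

/-- `τ` is the Markov trace of `A`: the common Markov trace of the inclusions `A^L ⊆ A` and
`A^R ⊆ A`, normalized by `τ(z_H) = 1` on every hyperselection sector. -/
structure IsMarkovTrace (τ : A →ₗ[ℂ] ℂ) : Prop where
  left : IsMarkovTraceFor (leftSub A) τ
  right : IsMarkovTraceFor (rightSub A) τ
  normalized : ∀ H, IsHyperSector H → τ H = 1

end CStar

end WeakKac

end

/-! Everything is governed by the regular trace χ of A. Cyclicity of the trace and S² = id give
x₁χ(x₂) = χ(x1₂)S(1₁) (`haarEL_regTrace`), so slicing Δ by χ lands in A^L. The element I = 1₁χ(1₂)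
(`haarIndex`) is therefore hypercentral. It is positive and invertible because Δ(1) is a projection
and χ is faithful, and the Haar functional is h = χ(I⁻¹ ·), that is, χ = h(I ·)
(`exists_isHaarFunctional`).

The rest concerns a single inclusion B ⊆ A with B = A^L or A^R. The Haar expectation has the form
E(x) = ∑ h(vᵢ x) uᵢ with ∑ uᵢvᵢ = ∑ vᵢuᵢ = 1 (`IsRegularExp`). Consequently dual bases of h are a
quasi-basis of E with index I, and h restricts to the regular trace of B. For a projection z in B
this gives dim zA = h(Iz) and dim zB = h(z), which is the source of the dimension ratios.

Counting dimensions also shows that ΛΛᵗ maps the trace vector of h(k ·) to that of h(Ik ·) for k ∈ B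
central in A (`IsRegularExp.sum_inclusionMult`). Thus h with a suitable hypercentral density is a
Markov trace for both inclusions. Conversely, Perron–Frobenius uniqueness puts the density of any
Markov trace in B (`IsRegularExp.density_mem`), so the Haar expectation also preserves that trace
and the indices agree. Where I is a scalar r, this r is an eigenvalue of an integer matrix and a
quotient of dimensions, hence a natural number (`IsRegularExp.exists_nat`).

For a vacuum with central projection e, the projection z^L is Π^L(e): Π^L preserves the centre, and
e and Π^L(e) act alike on V_ε. In the pure case the only minimal hypercentral projection is 1. -/

set_option linter.unusedSectionVars false

noncomputable section

namespace WeakKac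

local notation "Δ" => comul (R := ℂ)
local notation "ε" => counit (R := ℂ)

/-! ### Convolution of linear maps from a coalgebra to an algebra. -/

section Convolution

variable {C B : Type*} [AddCommGroup C] [Module ℂ C] [Coalgebra ℂ C] [Ring B] [Algebra ℂ B]

/-- The convolution product `(f * g)(x) = f(x₍₁₎) g(x₍₂₎)`. -/
def conv (f g : C →ₗ[ℂ] B) : C →ₗ[ℂ] B := LinearMap.mul' ℂ B ∘ₗ TensorProduct.map f g ∘ₗ Δ

lemma conv_apply (f g : C →ₗ[ℂ] B) (x : C) :
    conv f g x = ∑ i ∈ (ℛ ℂ x).index, f ((ℛ ℂ x).left i) * g ((ℛ ℂ x).right i) := by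
  conv_lhs => rw [conv, LinearMap.comp_apply, LinearMap.comp_apply, ← (ℛ ℂ x).eq]
  simp

lemma conv_assoc (f g h : C →ₗ[ℂ] B) : conv (conv f g) h = conv f (conv g h) :=
  congrArg WithConv.ofConv (mul_assoc (WithConv.toConv f) (WithConv.toConv g) (WithConv.toConv h))

lemma conv_mulLeft (a : B) (f g : C →ₗ[ℂ] B) :
    conv (LinearMap.mulLeft ℂ a ∘ₗ f) g = LinearMap.mulLeft ℂ a ∘ₗ conv f g := by
  ext x; simp [conv_apply, mul_assoc]

lemma conv_mulRight (a : B) (f g : C →ₗ[ℂ] B) :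
    conv f (LinearMap.mulRight ℂ a ∘ₗ g) = LinearMap.mulRight ℂ a ∘ₗ conv f g := by
  ext x; simp [conv_apply, mul_assoc]

lemma conv_mulRight_mulLeft (a : B) (f g : C →ₗ[ℂ] B) :
    conv (LinearMap.mulRight ℂ a ∘ₗ f) g = conv f (LinearMap.mulLeft ℂ a ∘ₗ g) := by
  ext x; simp [conv_apply, mul_assoc]

lemma algHom_comp_conv {B' : Type*} [Ring B'] [Algebra ℂ B'] (φ : B →ₐ[ℂ] B')
    (f g : C →ₗ[ℂ] B) :
    φ.toLinearMap ∘ₗ conv f g = conv (φ.toLinearMap ∘ₗ f) (φ.toLinearMap ∘ₗ g) := by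
  ext x; simp [conv_apply]

end Convolution

/-! ### The coproduct of the unit and the maps Π^L, Π^R. -/

section WeakHopf

variable {A : Type*} [Ring A] [Algebra ℂ A] [Coalgebra ℂ A]

lemma piL_apply (x : A) : piL A x =
    ∑ i ∈ (ℛ ℂ (1 : A)).index, ε ((ℛ ℂ (1 : A)).left i * x) • (ℛ ℂ (1 : A)).right i := by
  simp only [piL, LinearMap.coe_mk, AddHom.coe_mk]
  conv_lhs => rw [← (ℛ ℂ (1 : A)).eq]
  simp

lemma piR_apply (x : A) : piR A x =
    ∑ i ∈ (ℛ ℂ (1 : A)).index, ε (x * (ℛ ℂ (1 : A)).right i) • (ℛ ℂ (1 : A)).left i := by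
  simp only [piR, LinearMap.coe_mk, AddHom.coe_mk]
  conv_lhs => rw [← (ℛ ℂ (1 : A)).eq]
  simp

lemma lTensor_comul_one : LinearMap.lTensor A Δ (Δ (1 : A)) =
    TensorProduct.assoc ℂ A A A (LinearMap.rTensor A Δ (Δ (1 : A))) := by
  rw [Coalgebra.coassoc_apply]

lemma assoc_tmul_one_mul (a b : A) (s : A ⊗[ℂ] A) :
    TensorProduct.assoc ℂ A A A ((a ⊗ₜ b) ⊗ₜ 1 * (TensorProduct.assoc ℂ A A A).symm (1 ⊗ₜ s)) =
      a ⊗ₜ[ℂ] ((b ⊗ₜ 1) * s) := by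
  induction s with
  | zero => simp
  | tmul c d => simp
  | add s t hs ht => simp only [TensorProduct.tmul_add, map_add, mul_add, hs, ht]

lemma assoc_mul_tmul_one (a b : A) (s : A ⊗[ℂ] A) :
    TensorProduct.assoc ℂ A A A ((TensorProduct.assoc ℂ A A A).symm (1 ⊗ₜ s) * (a ⊗ₜ b) ⊗ₜ 1) =
      a ⊗ₜ[ℂ] (s * (b ⊗ₜ 1)) := by
  induction s with
  | zero => simp
  | tmul c d => simp
  | add s t hs ht => simp only [TensorProduct.tmul_add, map_add, add_mul, hs, ht]

variable [WeakHopfAlgebra A]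

/-- The antipode as a linear map. -/
abbrev antip : A →ₗ[ℂ] A := WeakHopfAlgebra.antipode

lemma comul_mul (x y : A) : Δ (x * y) = Δ x * Δ y := WeakHopfAlgebra.comul_mul x y

lemma comul_one_mul (x : A) : Δ (1 : A) * Δ x = Δ x := by rw [← comul_mul, one_mul]

lemma mul_comul_one (x : A) : Δ x * Δ (1 : A) = Δ x := by rw [← comul_mul, mul_one]

/-- This and the next three lemmas rewrite the unit axioms with one outer leg left free; applying a
functional to that leg produces identities in A ⊗ A. -/
lemma sum_comul_tmul_one : ∑ i ∈ (ℛ ℂ (1 : A)).index,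
      Δ ((ℛ ℂ (1 : A)).left i) ⊗ₜ[ℂ] (ℛ ℂ (1 : A)).right i =
    ∑ i ∈ (ℛ ℂ (1 : A)).index, (Δ (1 : A) * (1 ⊗ₜ (ℛ ℂ (1 : A)).left i)) ⊗ₜ[ℂ]
      (ℛ ℂ (1 : A)).right i := by
  have h := WeakHopfAlgebra.comul_comul_one (A := A)
  conv_lhs at h => rw [← (ℛ ℂ (1 : A)).eq]
  conv_rhs at h => enter [2]; rw [← (ℛ ℂ (1 : A)).eq]
  simpa [TensorProduct.tmul_sum, Finset.mul_sum] using h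

lemma sum_comul_tmul_one' : ∑ i ∈ (ℛ ℂ (1 : A)).index,
      Δ ((ℛ ℂ (1 : A)).left i) ⊗ₜ[ℂ] (ℛ ℂ (1 : A)).right i =
    ∑ i ∈ (ℛ ℂ (1 : A)).index, ((1 ⊗ₜ (ℛ ℂ (1 : A)).left i) * Δ (1 : A)) ⊗ₜ[ℂ]
      (ℛ ℂ (1 : A)).right i := by
  have h := WeakHopfAlgebra.comul_comul_one' (A := A)
  conv_lhs at h => rw [← (ℛ ℂ (1 : A)).eq]
  conv_rhs at h => enter [1]; rw [← (ℛ ℂ (1 : A)).eq]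
  simpa [TensorProduct.tmul_sum, Finset.sum_mul] using h

lemma sum_tmul_comul_one : ∑ i ∈ (ℛ ℂ (1 : A)).index,
      (ℛ ℂ (1 : A)).left i ⊗ₜ[ℂ] Δ ((ℛ ℂ (1 : A)).right i) =
    ∑ i ∈ (ℛ ℂ (1 : A)).index, (ℛ ℂ (1 : A)).left i ⊗ₜ[ℂ]
      (((ℛ ℂ (1 : A)).right i ⊗ₜ 1) * Δ (1 : A)) := by
  have h := lTensor_comul_one (A := A)
  rw [WeakHopfAlgebra.comul_comul_one] at h
  conv_lhs at h => rw [← (ℛ ℂ (1 : A)).eq]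
  conv_rhs at h => enter [2, 1]; rw [← (ℛ ℂ (1 : A)).eq]
  simpa [TensorProduct.sum_tmul, Finset.sum_mul, assoc_tmul_one_mul] using h

lemma sum_tmul_comul_one' : ∑ i ∈ (ℛ ℂ (1 : A)).index,
      (ℛ ℂ (1 : A)).left i ⊗ₜ[ℂ] Δ ((ℛ ℂ (1 : A)).right i) =
    ∑ i ∈ (ℛ ℂ (1 : A)).index, (ℛ ℂ (1 : A)).left i ⊗ₜ[ℂ]
      (Δ (1 : A) * ((ℛ ℂ (1 : A)).right i ⊗ₜ 1)) := by
  have h := lTensor_comul_one (A := A)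
  rw [WeakHopfAlgebra.comul_comul_one'] at h
  conv_lhs at h => rw [← (ℛ ℂ (1 : A)).eq]
  conv_rhs at h => enter [2, 2]; rw [← (ℛ ℂ (1 : A)).eq]
  simpa [TensorProduct.sum_tmul, Finset.mul_sum, assoc_mul_tmul_one] using h

/-- Slice the first leg of 1₁ ⊗ Δ(1₂) = 1₁ ⊗ (1₂ ⊗ 1)Δ(1) by ε(· x). The three companions use the
other slices. -/
lemma comul_piL (x : A) : Δ (piL A x) = (piL A x ⊗ₜ 1) * Δ (1 : A) := by
  have h := congrArg (TensorProduct.lid ℂ _ ∘ LinearMap.rTensor (A ⊗[ℂ] A)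
    (ε ∘ₗ LinearMap.mulRight ℂ x)) (sum_tmul_comul_one (A := A))
  simpa [piL_apply, TensorProduct.sum_tmul, Finset.sum_mul, ← TensorProduct.smul_tmul'] using h

lemma comul_piL' (x : A) : Δ (piL A x) = Δ (1 : A) * (piL A x ⊗ₜ 1) := by
  have h := congrArg (TensorProduct.lid ℂ _ ∘ LinearMap.rTensor (A ⊗[ℂ] A)
    (ε ∘ₗ LinearMap.mulRight ℂ x)) (sum_tmul_comul_one' (A := A))
  simpa [piL_apply, TensorProduct.sum_tmul, Finset.mul_sum, ← TensorProduct.smul_tmul'] using h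

lemma comul_piR (x : A) : Δ (piR A x) = Δ (1 : A) * (1 ⊗ₜ piR A x) := by
  have h := congrArg (TensorProduct.rid ℂ _ ∘ LinearMap.lTensor (A ⊗[ℂ] A)
    (ε ∘ₗ LinearMap.mulLeft ℂ x)) (sum_comul_tmul_one (A := A))
  simpa [piR_apply, TensorProduct.tmul_sum, Finset.mul_sum] using h

lemma comul_piR' (x : A) : Δ (piR A x) = (1 ⊗ₜ piR A x) * Δ (1 : A) := by
  have h := congrArg (TensorProduct.rid ℂ _ ∘ LinearMap.lTensor (A ⊗[ℂ] A)
    (ε ∘ₗ LinearMap.mulLeft ℂ x)) (sum_comul_tmul_one' (A := A))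
  simpa [piR_apply, TensorProduct.tmul_sum, Finset.sum_mul] using h

/-- The two unit axioms say that the middle factors of 1₁ ⊗ 1₂1'₁ ⊗ 1'₂ commute; slice the outer
legs by ε(· x) and ε(y ·). -/
lemma piL_mul_piR (x y : A) : piL A x * piR A y = piR A y * piL A x := by
  have h := (WeakHopfAlgebra.comul_comul_one (A := A)).symm.trans
    WeakHopfAlgebra.comul_comul_one'
  have h2 := congrArg (TensorProduct.rid ℂ _ ∘ TensorProduct.map
    ((TensorProduct.lid ℂ _).toLinearMap ∘ₗ LinearMap.rTensor A (ε ∘ₗ LinearMap.mulRight ℂ x))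
    (ε ∘ₗ LinearMap.mulLeft ℂ y)) h
  simp only [← (ℛ ℂ (1 : A)).eq] at h2
  simpa [piL_apply, piR_apply, TensorProduct.sum_tmul, TensorProduct.tmul_sum, Finset.mul_sum,
    Finset.sum_mul, Finset.smul_sum, smul_smul, mul_comm] using h2

end WeakHopf

/-! ### Counital identities for one leg of a coproduct. -/

section WeakHopf

variable {A : Type*} [Ring A] [Algebra ℂ A] [Coalgebra ℂ A] [WeakHopfAlgebra A]

lemma lTensor_counit_comul (x : A) :
    TensorProduct.rid ℂ A (LinearMap.lTensor A ε (Δ x)) = x := by simp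

lemma rTensor_counit_comul (x : A) :
    TensorProduct.lid ℂ A (LinearMap.rTensor A ε (Δ x)) = x := by simp

/-- `x₍₁₎ ⊗ Π^L(x₍₂₎) = 1₍₁₎ x ⊗ 1₍₂₎` -/
lemma lTensor_piL_comul (x : A) : LinearMap.lTensor A (piL A) (Δ x) = Δ (1 : A) * (x ⊗ₜ 1) := by
  have h := congrArg (LinearMap.rTensor A ((TensorProduct.rid ℂ A).toLinearMap ∘ₗ
    LinearMap.lTensor A ε ∘ₗ LinearMap.mulRight ℂ (Δ x))) (sum_comul_tmul_one' (A := A))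
  simp only [map_sum, LinearMap.rTensor_tmul, LinearMap.comp_apply, LinearMap.mulRight_apply,
    LinearEquiv.coe_coe, ← comul_mul, mul_assoc, one_mul, lTensor_counit_comul] at h
  have h1 : Δ (1 : A) * (x ⊗ₜ 1) = ∑ i ∈ (ℛ ℂ (1 : A)).index,
      ((ℛ ℂ (1 : A)).left i * x) ⊗ₜ[ℂ] (ℛ ℂ (1 : A)).right i := by
    conv_lhs => rw [← (ℛ ℂ (1 : A)).eq]
    simp [Finset.sum_mul]
  rw [h1, h]
  conv_lhs => rw [← (ℛ ℂ x).eq]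
  simp only [map_sum, LinearMap.lTensor_tmul, piL_apply, TensorProduct.tmul_sum]
  rw [Finset.sum_comm]
  refine Finset.sum_congr rfl fun i _ => ?_
  conv_rhs => rw [← (ℛ ℂ x).eq]
  simp [Finset.mul_sum, TensorProduct.sum_tmul, TensorProduct.smul_tmul]

/-- `Π^R(x₍₁₎) ⊗ x₍₂₎ = 1₍₁₎ ⊗ x 1₍₂₎` -/
lemma rTensor_piR_comul (x : A) : LinearMap.rTensor A (piR A) (Δ x) = (1 ⊗ₜ x) * Δ (1 : A) := by
  have h := congrArg (LinearMap.lTensor A ((TensorProduct.lid ℂ A).toLinearMap ∘ₗ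
    LinearMap.rTensor A ε ∘ₗ LinearMap.mulLeft ℂ (Δ x))) (sum_tmul_comul_one' (A := A))
  simp only [map_sum, LinearMap.lTensor_tmul, LinearMap.comp_apply, LinearMap.mulLeft_apply,
    LinearEquiv.coe_coe, ← comul_mul, ← mul_assoc, mul_one, rTensor_counit_comul] at h
  have h1 : (1 ⊗ₜ x) * Δ (1 : A) = ∑ i ∈ (ℛ ℂ (1 : A)).index,
      (ℛ ℂ (1 : A)).left i ⊗ₜ[ℂ] (x * (ℛ ℂ (1 : A)).right i) := by
    conv_lhs => rw [← (ℛ ℂ (1 : A)).eq]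
    simp [Finset.mul_sum]
  rw [h1, h]
  conv_lhs => rw [← (ℛ ℂ x).eq]
  simp only [map_sum, LinearMap.rTensor_tmul, piR_apply, TensorProduct.sum_tmul]
  rw [Finset.sum_comm]
  refine Finset.sum_congr rfl fun i _ => ?_
  conv_rhs => rw [← (ℛ ℂ x).eq]
  simp [Finset.sum_mul, TensorProduct.tmul_sum, TensorProduct.smul_tmul]

/-- The map `x ↦ 1₍₁₎ ε(1₍₂₎ x)`. -/
def piRbar : A →ₗ[ℂ] A :=
  ∑ i ∈ (ℛ ℂ (1 : A)).index, (ε ∘ₗ LinearMap.mulLeft ℂ ((ℛ ℂ (1 : A)).right i)).smulRight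
    ((ℛ ℂ (1 : A)).left i)

/-- The map `x ↦ ε(x 1₍₁₎) 1₍₂₎`. -/
def piLbar : A →ₗ[ℂ] A :=
  ∑ i ∈ (ℛ ℂ (1 : A)).index, (ε ∘ₗ LinearMap.mulRight ℂ ((ℛ ℂ (1 : A)).left i)).smulRight
    ((ℛ ℂ (1 : A)).right i)

lemma piRbar_apply (x : A) : piRbar x =
    ∑ i ∈ (ℛ ℂ (1 : A)).index, ε ((ℛ ℂ (1 : A)).right i * x) • (ℛ ℂ (1 : A)).left i := by
  simp [piRbar]

lemma piLbar_apply (x : A) : piLbar x =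
    ∑ i ∈ (ℛ ℂ (1 : A)).index, ε (x * (ℛ ℂ (1 : A)).left i) • (ℛ ℂ (1 : A)).right i := by
  simp [piLbar]

/-- `1₍₁₎ ε(1₍₂₎ x₍₁₎) ⊗ x₍₂₎ = 1₍₁₎ ⊗ 1₍₂₎ x` -/
lemma rTensor_piRbar_comul (x : A) :
    LinearMap.rTensor A piRbar (Δ x) = Δ (1 : A) * (1 ⊗ₜ x) := by
  have h := congrArg (LinearMap.lTensor A ((TensorProduct.lid ℂ A).toLinearMap ∘ₗ
    LinearMap.rTensor A ε ∘ₗ LinearMap.mulRight ℂ (Δ x))) (sum_tmul_comul_one (A := A))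
  simp only [map_sum, LinearMap.lTensor_tmul, LinearMap.comp_apply, LinearMap.mulRight_apply,
    LinearEquiv.coe_coe, ← comul_mul, mul_assoc, one_mul, rTensor_counit_comul] at h
  have h1 : Δ (1 : A) * (1 ⊗ₜ x) = ∑ i ∈ (ℛ ℂ (1 : A)).index,
      (ℛ ℂ (1 : A)).left i ⊗ₜ[ℂ] ((ℛ ℂ (1 : A)).right i * x) := by
    conv_lhs => rw [← (ℛ ℂ (1 : A)).eq]
    simp [Finset.sum_mul]
  rw [h1, h]
  conv_lhs => rw [← (ℛ ℂ x).eq]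
  simp only [map_sum, LinearMap.rTensor_tmul, piRbar_apply, TensorProduct.sum_tmul]
  rw [Finset.sum_comm]
  refine Finset.sum_congr rfl fun i _ => ?_
  conv_rhs => rw [← (ℛ ℂ x).eq]
  simp [Finset.mul_sum, TensorProduct.tmul_sum, TensorProduct.smul_tmul]

/-- `x₍₁₎ ⊗ ε(x₍₂₎ 1₍₁₎) 1₍₂₎ = x 1₍₁₎ ⊗ 1₍₂₎` -/
lemma lTensor_piLbar_comul (x : A) :
    LinearMap.lTensor A piLbar (Δ x) = (x ⊗ₜ 1) * Δ (1 : A) := by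
  have h := congrArg (LinearMap.rTensor A ((TensorProduct.rid ℂ A).toLinearMap ∘ₗ
    LinearMap.lTensor A ε ∘ₗ LinearMap.mulLeft ℂ (Δ x))) (sum_comul_tmul_one (A := A))
  simp only [map_sum, LinearMap.rTensor_tmul, LinearMap.comp_apply, LinearMap.mulLeft_apply,
    LinearEquiv.coe_coe, ← comul_mul, ← mul_assoc, mul_one, lTensor_counit_comul] at h
  have h1 : (x ⊗ₜ 1) * Δ (1 : A) = ∑ i ∈ (ℛ ℂ (1 : A)).index,
      (x * (ℛ ℂ (1 : A)).left i) ⊗ₜ[ℂ] (ℛ ℂ (1 : A)).right i := by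
    conv_lhs => rw [← (ℛ ℂ (1 : A)).eq]
    simp [Finset.mul_sum]
  rw [h1, h]
  conv_lhs => rw [← (ℛ ℂ x).eq]
  simp only [map_sum, LinearMap.lTensor_tmul, piLbar_apply, TensorProduct.tmul_sum]
  rw [Finset.sum_comm]
  refine Finset.sum_congr rfl fun i _ => ?_
  conv_rhs => rw [← (ℛ ℂ x).eq]
  simp [Finset.sum_mul, TensorProduct.sum_tmul, TensorProduct.smul_tmul]

/-- Weak multiplicativity with 1 in the middle: ε(xy) = ε(x1₂)ε(1₁y). -/
lemma counit_mul_piL (x y : A) : ε (x * piL A y) = ε (x * y) := by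
  have h := WeakHopfAlgebra.counit_mul_mul' x 1 y
  rw [mul_one, ← (ℛ ℂ (1 : A)).eq] at h
  rw [h, piL_apply]
  simp [Finset.mul_sum]

lemma counit_piR_mul (x y : A) : ε (piR A x * y) = ε (x * y) := by
  have h := WeakHopfAlgebra.counit_mul_mul' x 1 y
  rw [mul_one, ← (ℛ ℂ (1 : A)).eq] at h
  rw [h, piR_apply]
  simp [Finset.sum_mul, mul_comm]

lemma counit_piL (x : A) : ε (piL A x) = ε x := by simpa using counit_mul_piL 1 x

lemma counit_piR (x : A) : ε (piR A x) = ε x := by simpa using counit_piR_mul x 1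

lemma piL_mul_piL (x y : A) : piL A (x * piL A y) = piL A (x * y) := by
  simp only [piL_apply (x * _), ← mul_assoc, counit_mul_piL]

lemma piR_piR_mul (x y : A) : piR A (piR A x * y) = piR A (x * y) := by
  simp only [piR_apply (_ * y), mul_assoc, counit_piR_mul]

lemma piL_piL (x : A) : piL A (piL A x) = piL A x := by simpa using piL_mul_piL 1 x

lemma piR_piR (x : A) : piR A (piR A x) = piR A x := by simpa using piR_piR_mul x 1

lemma piL_one : piL A (1 : A) = 1 := by
  rw [piL_apply]
  simpa only [mul_one] using Coalgebra.sum_counit_smul (ℛ ℂ (1 : A))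

lemma piR_one : piR A (1 : A) = 1 := by
  have h := congrArg (TensorProduct.rid ℂ A) (Coalgebra.sum_tmul_counit_eq (ℛ ℂ (1 : A)))
  simp only [map_sum, TensorProduct.rid_tmul, one_smul] at h
  simpa only [piR_apply, one_mul] using h

/-! ### The antipode is an antihomomorphism -/

/-- Under convolution S is a generalized inverse of the identity: the one-sided products are Π^L and
Π^R, and S * id * S = S. -/
lemma conv_id_antip : conv LinearMap.id (antip (A := A)) = piL A :=
  LinearMap.ext fun x => WeakHopfAlgebra.mul_antipode x

lemma conv_antip_id : conv (antip (A := A)) LinearMap.id = piR A :=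
  LinearMap.ext fun x => WeakHopfAlgebra.antipode_mul x

lemma conv_piR_antip : conv (piR A) antip = antip (A := A) := by
  rw [← conv_antip_id]
  exact LinearMap.ext fun x => WeakHopfAlgebra.antipode_mul_antipode x

lemma conv_antip_piL : conv antip (piL A) = antip (A := A) := by
  rw [← conv_id_antip, ← conv_assoc, conv_antip_id, conv_piR_antip]

lemma conv_apply_of_comul {f g : A →ₗ[ℂ] A} {x : A} {t : A ⊗[ℂ] A} (h : Δ x = t) :
    conv f g x = LinearMap.mul' ℂ A (TensorProduct.map f g t) := by rw [← h]; rfl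

/-- `x₍₁₎ l S(x₍₂₎) = Π^L(x l)` for `l ∈ A^L`. -/
lemma conv_mul_piL_antip (x y : A) :
    conv (LinearMap.mulRight ℂ (piL A y)) antip x = piL A (x * y) := by
  have h : Δ (x * piL A y) = Δ x * (piL A y ⊗ₜ 1) := by
    rw [comul_mul, comul_piL', ← mul_assoc, mul_comul_one]
  have h2 := conv_apply_of_comul (f := LinearMap.id) (g := antip) h
  rw [conv_id_antip, piL_mul_piL] at h2
  rw [h2, conv_apply]
  conv_rhs => rw [← (ℛ ℂ x).eq]
  simp [Finset.sum_mul]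

/-- `S(x₍₁₎) r x₍₂₎ = Π^R(r x)` for `r ∈ A^R`. -/
lemma conv_antip_piR_mul (x y : A) :
    conv antip (LinearMap.mulLeft ℂ (piR A y)) x = piR A (y * x) := by
  have h : Δ (piR A y * x) = (1 ⊗ₜ piR A y) * Δ x := by
    rw [comul_mul, comul_piR', mul_assoc, comul_one_mul]
  have h2 := conv_apply_of_comul (f := antip) (g := LinearMap.id) h
  rw [conv_antip_id, piR_piR_mul] at h2
  rw [h2, conv_apply]
  conv_rhs => rw [← (ℛ ℂ x).eq]
  simp [Finset.mul_sum]

lemma conv_tmul (f g : A ⊗[ℂ] A →ₗ[ℂ] A) (x y : A) :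
    conv f g (x ⊗ₜ y) = ∑ i ∈ (ℛ ℂ x).index, ∑ j ∈ (ℛ ℂ y).index,
      f ((ℛ ℂ x).left i ⊗ₜ (ℛ ℂ y).left j) * g ((ℛ ℂ x).right i ⊗ₜ (ℛ ℂ y).right j) := by
  rw [conv, LinearMap.comp_apply, LinearMap.comp_apply, TensorProduct.comul_tmul]
  conv_lhs => rw [← (ℛ ℂ x).eq, ← (ℛ ℂ y).eq]
  simp [TensorProduct.sum_tmul, TensorProduct.tmul_sum]
  rw [Finset.sum_comm]

lemma conv_comp_mul' (f g : A →ₗ[ℂ] A) :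
    conv (f ∘ₗ LinearMap.mul' ℂ A) (g ∘ₗ LinearMap.mul' ℂ A) = conv f g ∘ₗ LinearMap.mul' ℂ A := by
  ext x y
  simp only [TensorProduct.AlgebraTensorModule.curry_apply, LinearMap.restrictScalars_self,
    TensorProduct.curry_apply, conv_tmul, LinearMap.comp_apply, LinearMap.mul'_apply]
  rw [conv_apply_of_comul (comul_mul x y)]
  conv_rhs => rw [← (ℛ ℂ x).eq, ← (ℛ ℂ y).eq]
  simp [Finset.sum_mul_sum]

/-- Uniqueness of generalized inverses. With M the multiplication, the two sides F, G satisfy M * F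
= M * G, F * M = G * M, F * M * F = F and G * M * G = G; hence F = F * M * F = F * M * G = G * M * G
= G. -/
theorem antip_mul (x y : A) : antip (x * y) = antip y * antip x := by
  set M : A ⊗[ℂ] A →ₗ[ℂ] A := LinearMap.mul' ℂ A
  set F : A ⊗[ℂ] A →ₗ[ℂ] A := antip ∘ₗ M
  set G : A ⊗[ℂ] A →ₗ[ℂ] A := M ∘ₗ TensorProduct.map antip antip ∘ₗ
    (TensorProduct.comm ℂ A A).toLinearMap
  have hF : conv (conv F M) F = F := by
    have h1 : conv F M = piR A ∘ₗ M := by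
      rw [← conv_antip_id, ← conv_comp_mul', LinearMap.id_comp]
    rw [h1, conv_comp_mul', conv_piR_antip]
  have hMF : conv M F = piL A ∘ₗ M := by
    rw [← conv_id_antip, ← conv_comp_mul', LinearMap.id_comp]
  have hFM : conv F M = piR A ∘ₗ M := by
    rw [← conv_antip_id, ← conv_comp_mul', LinearMap.id_comp]
  have hMGa (x y : A) : conv M G (x ⊗ₜ y) = conv (LinearMap.mulRight ℂ (piL A y)) antip x := by
    rw [← conv_id_antip, conv_apply _ antip x, conv_tmul]
    simp [M, G, conv_apply, Finset.mul_sum, Finset.sum_mul, mul_assoc]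
  have hMG : conv M G = piL A ∘ₗ M := by
    ext x y; simpa [M] using (hMGa x y).trans (conv_mul_piL_antip x y)
  have hGM : conv G M = piR A ∘ₗ M := by
    ext x y
    have : conv G M (x ⊗ₜ y) = conv antip (LinearMap.mulLeft ℂ (piR A x)) y := by
      rw [← conv_antip_id, conv_apply antip _ y, conv_tmul, Finset.sum_comm]
      simp [M, G, conv_apply, Finset.mul_sum, Finset.sum_mul, mul_assoc]
    simpa [M] using this.trans (conv_antip_piR_mul y x)
  -- As A^L commutes with A^R, S(x₁) x₂ l S(x₃) = l S(x) for l ∈ A^L. This is used with l = Π^L(y₂),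
  -- which S(y₁) then absorbs.
  have hG : conv G (conv M G) = G := by
    ext x y
    have h2 (l : A) : conv antip (conv (LinearMap.mulRight ℂ (piL A l)) antip) x =
        piL A l * antip x := by
      have : conv antip (LinearMap.mulRight ℂ (piL A l)) =
          LinearMap.mulLeft ℂ (piL A l) ∘ₗ piR A := by
        have h3 := conv_mulRight (piL A l) (antip (A := A)) LinearMap.id
        rw [LinearMap.comp_id, conv_antip_id] at h3
        rw [h3]
        ext z; simp [piL_mul_piR]
      rw [← conv_assoc, this, conv_mulLeft, conv_piR_antip]; rfl
    have h4 : conv G (conv M G) (x ⊗ₜ y) = ∑ j ∈ (ℛ ℂ y).index, antip ((ℛ ℂ y).left j) *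
        conv antip (conv (LinearMap.mulRight ℂ (piL A ((ℛ ℂ y).right j))) antip) x := by
      rw [conv_tmul, Finset.sum_comm]
      simp only [hMGa, conv_apply antip (conv _ _) x, G, M]
      simp [Finset.mul_sum, mul_assoc]
    have h5 : conv antip (piL A) y * antip x = antip y * antip x := by rw [conv_antip_piL]
    simp only [TensorProduct.AlgebraTensorModule.curry_apply, LinearMap.restrictScalars_self,
      TensorProduct.curry_apply]
    rw [h4]
    simp only [h2]
    rw [conv_apply, Finset.sum_mul] at h5
    simpa [G, M, mul_assoc] using h5
  have hFG : F = G := by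
    rw [← hF, conv_assoc, hMF, ← hMG, ← conv_assoc, hFM, ← hGM, conv_assoc, hG]
  simpa [F, G, M] using congrArg (fun f => f (x ⊗ₜ y)) hFG

end WeakHopf

/-! ### The antipode on A^L and A^R, and its compatibility with the coproduct. -/

section WeakHopf

variable {A : Type*} [Ring A] [Algebra ℂ A] [Coalgebra ℂ A] [WeakHopfAlgebra A]

/-- For r ∈ A^R, Δ(r) = (1 ⊗ r)Δ(1) gives Π^L(r) = 1₁S(r1₂) = 1₁S(1₂)S(r) = S(r). -/
lemma antip_piR (x : A) : antip (piR A x) = piL A (piR A x) := by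
  rw [← conv_id_antip, conv_apply_of_comul (comul_piR' x)]
  have h : conv LinearMap.id antip (1 : A) * antip (piR A x) = antip (piR A x) := by
    rw [conv_id_antip, piL_one, one_mul]
  conv_lhs => rw [← h]
  rw [conv_apply]
  conv_rhs => rw [← (ℛ ℂ (1 : A)).eq]
  simp [Finset.mul_sum, Finset.sum_mul, antip_mul, mul_assoc]

lemma antip_piL (x : A) : antip (piL A x) = piR A (piL A x) := by
  rw [← conv_antip_id, conv_apply_of_comul (comul_piL' x)]
  have h : antip (piL A x) * conv antip LinearMap.id (1 : A) = antip (piL A x) := by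
    rw [conv_antip_id, piR_one, mul_one]
  conv_lhs => rw [← h]
  rw [conv_apply]
  conv_rhs => rw [← (ℛ ℂ (1 : A)).eq]
  simp [Finset.mul_sum, Finset.sum_mul, antip_mul, mul_assoc]

lemma antip_one : antip (1 : A) = 1 := by
  have h := antip_piR (1 : A)
  rwa [piR_one, piL_one] at h

lemma rTensor_piR_one : LinearMap.rTensor A (piR A) (Δ (1 : A)) = Δ 1 := by
  rw [rTensor_piR_comul, ← Algebra.TensorProduct.one_def, one_mul]

lemma lTensor_piL_one : LinearMap.lTensor A (piL A) (Δ (1 : A)) = Δ 1 := by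
  rw [lTensor_piL_comul, ← Algebra.TensorProduct.one_def, mul_one]

lemma rTensor_antip_one :
    LinearMap.rTensor A antip (Δ (1 : A)) = LinearMap.rTensor A (piL A) (Δ 1) := by
  rw [← rTensor_piR_one, ← LinearMap.rTensor_comp_apply, ← LinearMap.rTensor_comp_apply]
  congr 2
  ext x; exact antip_piR x

lemma lTensor_antip_one :
    LinearMap.lTensor A antip (Δ (1 : A)) = LinearMap.lTensor A (piR A) (Δ 1) := by
  rw [← lTensor_piL_one, ← LinearMap.lTensor_comp_apply, ← LinearMap.lTensor_comp_apply]
  congr 2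
  ext x; exact antip_piL x

lemma sum_counit_mul_counit (x y : A) :
    ∑ i ∈ (ℛ ℂ (1 : A)).index, ε (x * (ℛ ℂ (1 : A)).left i) * ε ((ℛ ℂ (1 : A)).right i * y) =
      ε (x * y) := by
  have h := WeakHopfAlgebra.counit_mul_mul x 1 y
  rw [mul_one, ← (ℛ ℂ (1 : A)).eq] at h
  simpa using h.symm

/-- On the first leg of Δ(1) the antipode agrees with Π^L; the two counits that appear merge by weak
multiplicativity. -/
lemma antip_piRbar (x : A) : antip (piRbar x) = piL A x := by
  have h := congrArg (TensorProduct.rid ℂ A ∘ LinearMap.lTensor A (ε ∘ₗ LinearMap.mulRight ℂ x))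
    (rTensor_antip_one (A := A))
  rw [← (ℛ ℂ (1 : A)).eq] at h
  simp only [Function.comp_apply, map_sum, LinearMap.rTensor_tmul, LinearMap.lTensor_tmul,
    TensorProduct.rid_tmul, LinearMap.comp_apply, LinearMap.mulRight_apply] at h
  rw [piRbar_apply, map_sum]
  simp only [map_smul, h]
  simp only [piL_apply, Finset.smul_sum, smul_smul]
  rw [Finset.sum_comm]
  refine Finset.sum_congr rfl fun i _ => ?_
  rw [← sum_counit_mul_counit, Finset.sum_smul]
  simp only [mul_comm]

lemma antip_piLbar (x : A) : antip (piLbar x) = piR A x := by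
  have h := congrArg (TensorProduct.lid ℂ A ∘ LinearMap.rTensor A (ε ∘ₗ LinearMap.mulLeft ℂ x))
    (lTensor_antip_one (A := A))
  rw [← (ℛ ℂ (1 : A)).eq] at h
  simp only [Function.comp_apply, map_sum, LinearMap.rTensor_tmul, LinearMap.lTensor_tmul,
    TensorProduct.lid_tmul, LinearMap.comp_apply, LinearMap.mulLeft_apply] at h
  rw [piLbar_apply, map_sum]
  simp only [map_smul, h]
  simp only [piR_apply, Finset.smul_sum, smul_smul]
  rw [Finset.sum_comm]
  refine Finset.sum_congr rfl fun i _ => ?_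
  rw [← sum_counit_mul_counit, Finset.sum_smul]

/-- `Π^L(x₍₁₎) ⊗ x₍₂₎ = S(1₍₁₎) ⊗ 1₍₂₎ x` -/
lemma rTensor_piL_comul (x : A) : LinearMap.rTensor A (piL A) (Δ x) =
    LinearMap.rTensor A antip (Δ (1 : A) * (1 ⊗ₜ x)) := by
  rw [← rTensor_piRbar_comul, ← LinearMap.rTensor_comp_apply]
  congr 2
  ext x; exact (antip_piRbar x).symm

/-- On Δ(1), S ⊗ S equals Π^L ⊗ Π^R. Expanding both maps leaves an inner pair of counits that
collapses, and then Π^L fixes the second leg of Δ(1). -/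
lemma map_antip_one : TensorProduct.map antip antip (Δ (1 : A)) =
    TensorProduct.comm ℂ A A (Δ 1) := by
  have h1 : TensorProduct.map antip antip (Δ (1 : A)) =
      TensorProduct.map (piL A) (piR A) (Δ 1) := by
    have e (f g : A →ₗ[ℂ] A) (t : A ⊗[ℂ] A) :=
      LinearMap.congr_fun (LinearMap.rTensor_comp_lTensor (f := f) (g := g)) t
    have e' (f g : A →ₗ[ℂ] A) (t : A ⊗[ℂ] A) :=
      LinearMap.congr_fun (LinearMap.lTensor_comp_rTensor (f := f) (g := g)) t
    simp only [LinearMap.comp_apply] at e e'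
    rw [← e, lTensor_antip_one, e, ← e', rTensor_antip_one, e']
  rw [h1]
  conv_rhs => rw [← lTensor_piL_one]
  rw [← (ℛ ℂ (1 : A)).eq]
  simp only [map_sum, TensorProduct.map_tmul, LinearMap.lTensor_tmul, TensorProduct.comm_tmul]
  have h2 : ∀ i, piL A ((ℛ ℂ (1 : A)).left i) ⊗ₜ[ℂ] piR A ((ℛ ℂ (1 : A)).right i) =
      ∑ k ∈ (ℛ ℂ (1 : A)).index, ∑ j ∈ (ℛ ℂ (1 : A)).index,
      (ε ((ℛ ℂ (1 : A)).left j * (ℛ ℂ (1 : A)).left i) *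
        ε ((ℛ ℂ (1 : A)).right i * (ℛ ℂ (1 : A)).right k)) •
        ((ℛ ℂ (1 : A)).right j ⊗ₜ[ℂ] (ℛ ℂ (1 : A)).left k) := fun i => by
    simp only [piL_apply, piR_apply, TensorProduct.sum_tmul, TensorProduct.tmul_sum,
      TensorProduct.smul_tmul_smul]
  simp only [h2]
  rw [Finset.sum_comm]
  refine Finset.sum_congr rfl fun k _ => ?_
  rw [Finset.sum_comm, piL_apply, TensorProduct.sum_tmul]
  refine Finset.sum_congr rfl fun j _ => ?_
  rw [← Finset.sum_smul, sum_counit_mul_counit, TensorProduct.smul_tmul']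

lemma map_antip_mul (s t : A ⊗[ℂ] A) : TensorProduct.map antip antip (s * t) =
    TensorProduct.map antip antip t * TensorProduct.map antip antip s := by
  induction s with
  | zero => simp
  | add a b ha hb => simp only [add_mul, mul_add, map_add, ha, hb]
  | tmul a b =>
    induction t with
    | zero => simp
    | add c d hc hd => simp only [add_mul, mul_add, map_add, hc, hd]
    | tmul c d => simp [antip_mul]

lemma conv_comul_comp (f g : A →ₗ[ℂ] A) : conv (Δ ∘ₗ f) (Δ ∘ₗ g) = Δ ∘ₗ conv f g := by
  ext x; simp [conv_apply, comul_mul]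

/-- The first embedding `x ↦ x ⊗ 1`. -/
abbrev inl : A →ₗ[ℂ] A ⊗[ℂ] A :=
  (Algebra.TensorProduct.includeLeft : A →ₐ[ℂ] A ⊗[ℂ] A).toLinearMap

/-- The second embedding `x ↦ 1 ⊗ x`. -/
abbrev inr : A →ₗ[ℂ] A ⊗[ℂ] A :=
  (Algebra.TensorProduct.includeRight : A →ₐ[ℂ] A ⊗[ℂ] A).toLinearMap

lemma conv_inl_inr (f g : A →ₗ[ℂ] A) (x : A) :
    conv (inl ∘ₗ f) (inr ∘ₗ g) x = TensorProduct.map f g (Δ x) := by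
  conv_rhs => rw [← (ℛ ℂ x).eq]
  simp [conv_apply]

lemma conv_inr_inl (f g : A →ₗ[ℂ] A) (x : A) :
    conv (inr ∘ₗ f) (inl ∘ₗ g) x = TensorProduct.comm ℂ A A (TensorProduct.map f g (Δ x)) := by
  conv_rhs => rw [← (ℛ ℂ x).eq]
  simp [conv_apply]

/-- The antipode reverses the coproduct. -/
theorem comul_antip (x : A) : Δ (antip x) =
    TensorProduct.comm ℂ A A (TensorProduct.map antip antip (Δ x)) := by
  -- Both sides are generalized convolution inverses of Δ with the same one-sided products, so the
  -- uniqueness argument of `antip_mul` applies. G is written as a convolution so that it can be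
  -- cancelled against Δ = `inl` * `inr` one leg at a time.
  set F : A →ₗ[ℂ] A ⊗[ℂ] A := Δ ∘ₗ antip
  set G : A →ₗ[ℂ] A ⊗[ℂ] A := conv (inr ∘ₗ antip) (inl ∘ₗ antip)
  have hD : conv inl (inr (A := A)) = Δ := by
    ext x; simpa using conv_inl_inr (A := A) LinearMap.id LinearMap.id x
  have hDF : conv Δ F = Δ ∘ₗ piL A := by
    have := conv_comul_comp (A := A) LinearMap.id antip
    rwa [LinearMap.comp_id, conv_id_antip] at this
  have hFD : conv F Δ = Δ ∘ₗ piR A := by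
    have := conv_comul_comp (A := A) antip LinearMap.id
    rwa [LinearMap.comp_id, conv_antip_id] at this
  have hF : conv (conv F Δ) F = F := by
    rw [hFD, conv_comul_comp, conv_piR_antip]
  have hDG : conv Δ G = Δ ∘ₗ piL A := by
    have h1 : conv inr (inr ∘ₗ antip) = inr ∘ₗ piL A := by
      rw [← conv_id_antip, algHom_comp_conv, LinearMap.comp_id]
    have h2 : conv inl (inr ∘ₗ piL A) = LinearMap.mulLeft ℂ (Δ (1 : A)) ∘ₗ inl := by
      ext x
      have := conv_inl_inr (A := A) LinearMap.id (piL A) x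
      rw [LinearMap.comp_id] at this
      rw [this]
      simpa [LinearMap.lTensor] using lTensor_piL_comul x
    have h3 : conv inl (inl ∘ₗ antip) = inl ∘ₗ piL A := by
      rw [← conv_id_antip, algHom_comp_conv, LinearMap.comp_id]
    conv_lhs => rw [← hD]
    simp only [G]
    rw [conv_assoc, ← conv_assoc (inr : A →ₗ[ℂ] A ⊗[ℂ] A) (inr ∘ₗ antip), h1, ← conv_assoc, h2,
      conv_mulLeft, h3]
    ext x; simp [comul_piL']
  have hGD : conv G Δ = LinearMap.mulRight ℂ (Δ (1 : A)) ∘ₗ inr ∘ₗ piR A := by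
    have h1 : conv (inl ∘ₗ antip) inl = inl ∘ₗ piR A := by
      rw [← conv_antip_id, algHom_comp_conv, LinearMap.comp_id]
    have h2 : conv (inl ∘ₗ piR A) inr = LinearMap.mulRight ℂ (Δ (1 : A)) ∘ₗ inr := by
      ext x
      have := conv_inl_inr (A := A) (piR A) LinearMap.id x
      rw [LinearMap.comp_id] at this
      rw [this]
      simpa [LinearMap.rTensor] using rTensor_piR_comul x
    have h3 : conv (inr ∘ₗ antip) inr = inr ∘ₗ piR A := by
      rw [← conv_antip_id, algHom_comp_conv, LinearMap.comp_id]
    conv_lhs => rw [← hD]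
    simp only [G]
    rw [conv_assoc, ← conv_assoc (inl ∘ₗ antip : A →ₗ[ℂ] A ⊗[ℂ] A) inl, h1, h2, conv_mulRight, h3]
  have hGD' : conv G Δ = Δ ∘ₗ piR A := by
    rw [hGD]; ext x; simp [comul_piR']
  -- The flip of S ⊗ S fixes Δ(1) and reverses products, so it turns Δ(x)Δ(1) = Δ(x) into this.
  have hDG1 : LinearMap.mulLeft ℂ (Δ (1 : A)) ∘ₗ G = G := by
    ext x
    have h : Δ (1 : A) = TensorProduct.comm ℂ A A (TensorProduct.map antip antip (Δ (1 : A))) := by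
      rw [map_antip_one]; simp
    have hc (s t : A ⊗[ℂ] A) : TensorProduct.comm ℂ A A (s * t) =
        TensorProduct.comm ℂ A A s * TensorProduct.comm ℂ A A t :=
      map_mul (Algebra.TensorProduct.comm ℂ A A) s t
    simp only [G, LinearMap.comp_apply, LinearMap.mulLeft_apply, conv_inr_inl]
    rw [h, ← hc, ← map_antip_mul, mul_comul_one]
  have hG : conv (conv G Δ) G = G := by
    have h3 : conv (inr ∘ₗ piR A) (inr ∘ₗ antip) = inr ∘ₗ antip := by
      conv_rhs => rw [← conv_piR_antip, algHom_comp_conv]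
    rw [hGD, conv_mulRight_mulLeft, hDG1]
    simp only [G]
    rw [← conv_assoc, h3]
  have hFG : F = G := by
    rw [← hF, hFD, ← hGD', conv_assoc, hDF, ← hDG, ← conv_assoc, hG]
  rw [← conv_inr_inl]
  exact congrArg (fun f => f x) hFG

end WeakHopf

section WeakHopf

variable {A : Type*} [Ring A] [Algebra ℂ A] [Coalgebra ℂ A] [WeakHopfAlgebra A]

/-! ### The subalgebras `A^L` and `A^R` -/

lemma piL_mem (x : A) : piL A x ∈ leftSub A := ⟨x, rfl⟩

lemma piR_mem (x : A) : piR A x ∈ rightSub A := ⟨x, rfl⟩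

lemma piL_of_mem {x : A} (h : x ∈ leftSub A) : piL A x = x := by
  obtain ⟨y, rfl⟩ := h; exact piL_piL y

lemma piR_of_mem {x : A} (h : x ∈ rightSub A) : piR A x = x := by
  obtain ⟨y, rfl⟩ := h; exact piR_piR y

lemma comul_of_mem_left {x : A} (h : x ∈ leftSub A) : Δ x = (x ⊗ₜ 1) * Δ 1 := by
  obtain ⟨y, rfl⟩ := h; exact comul_piL y

lemma comul_of_mem_left' {x : A} (h : x ∈ leftSub A) : Δ x = Δ 1 * (x ⊗ₜ 1) := by
  obtain ⟨y, rfl⟩ := h; exact comul_piL' y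

lemma comul_of_mem_right {x : A} (h : x ∈ rightSub A) : Δ x = Δ 1 * (1 ⊗ₜ x) := by
  obtain ⟨y, rfl⟩ := h; exact comul_piR y

lemma comul_of_mem_right' {x : A} (h : x ∈ rightSub A) : Δ x = (1 ⊗ₜ x) * Δ 1 := by
  obtain ⟨y, rfl⟩ := h; exact comul_piR' y

/-- Applying ε ⊗ id yields x = Π^L(x). Closure of A^L under products and star is proved through this
criterion. -/
lemma mem_left_of_comul {x : A} (h : Δ x = Δ 1 * (x ⊗ₜ 1)) : x ∈ leftSub A := by
  refine ⟨x, ?_⟩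
  have h2 := rTensor_counit_comul x
  rw [h, ← (ℛ ℂ (1 : A)).eq, Finset.sum_mul] at h2
  simpa [piL_apply] using h2

lemma mem_right_of_comul {x : A} (h : Δ x = (1 ⊗ₜ x) * Δ 1) : x ∈ rightSub A := by
  refine ⟨x, ?_⟩
  have h2 := lTensor_counit_comul x
  rw [h, ← (ℛ ℂ (1 : A)).eq, Finset.mul_sum] at h2
  simpa [piR_apply] using h2

lemma one_mem_left : (1 : A) ∈ leftSub A := ⟨1, piL_one⟩

lemma one_mem_right : (1 : A) ∈ rightSub A := ⟨1, piR_one⟩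

lemma mul_mem_left {x y : A} (hx : x ∈ leftSub A) (hy : y ∈ leftSub A) : x * y ∈ leftSub A := by
  apply mem_left_of_comul
  rw [comul_mul, comul_of_mem_left' hx, comul_of_mem_left' hy, mul_assoc, ← mul_assoc _ (Δ 1),
    ← comul_of_mem_left hx, comul_of_mem_left' hx, ← mul_assoc, ← mul_assoc, ← comul_mul, one_mul,
    mul_assoc, Algebra.TensorProduct.tmul_mul_tmul, one_mul]

lemma mul_mem_right {x y : A} (hx : x ∈ rightSub A) (hy : y ∈ rightSub A) :
    x * y ∈ rightSub A := by
  apply mem_right_of_comul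
  rw [comul_mul, comul_of_mem_right' hx, comul_of_mem_right' hy, mul_assoc, ← mul_assoc (Δ 1),
    ← comul_of_mem_right hy, comul_of_mem_right' hy, mul_assoc, ← comul_mul, one_mul,
    ← mul_assoc, Algebra.TensorProduct.tmul_mul_tmul, one_mul]

lemma antip_of_mem_left {x : A} (hx : x ∈ leftSub A) : antip x = piR A x := by
  rw [← piL_of_mem hx, antip_piL]

lemma antip_of_mem_right {x : A} (hx : x ∈ rightSub A) : antip x = piL A x := by
  rw [← piR_of_mem hx, antip_piR]

lemma antip_mem_right {x : A} (hx : x ∈ leftSub A) : antip x ∈ rightSub A := by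
  rw [antip_of_mem_left hx]; exact piR_mem x

lemma antip_mem_left {x : A} (hx : x ∈ rightSub A) : antip x ∈ leftSub A := by
  rw [antip_of_mem_right hx]; exact piL_mem x

lemma antip_of_mem {x : A} (hx : x ∈ leftSub A) (hx' : x ∈ rightSub A) : antip x = x := by
  rw [antip_of_mem_left hx, piR_of_mem hx']

/-- If `x ↦ x₍₁₎ h(x₍₂₎)` takes values in `A^L`, then `h` is a left integral of the dual. -/
lemma dualMul_eq_of_haarEL_mem {h : Module.Dual ℂ A} (H : ∀ x, haarEL h x ∈ leftSub A)
    (φ : Module.Dual ℂ A) : dualMul φ h = dualMul (φ ∘ₗ piL A) h := by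
  have key (ψ : Module.Dual ℂ A) (x : A) : dualMul ψ h x = ψ (haarEL h x) := by
    simp only [dualMul, haarEL, LinearMap.comp_apply, LinearEquiv.coe_coe]
    rw [← (ℛ ℂ x).eq]
    simp [mul_comm]
  ext x
  rw [key, key, LinearMap.comp_apply, piL_of_mem (H x)]

lemma dualMul_eq_of_haarER_mem {h : Module.Dual ℂ A} (H : ∀ x, haarER h x ∈ rightSub A)
    (φ : Module.Dual ℂ A) : dualMul h φ = dualMul h (φ ∘ₗ piR A) := by
  have key (ψ : Module.Dual ℂ A) (x : A) : dualMul h ψ x = ψ (haarER h x) := by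
    simp only [dualMul, haarER, LinearMap.comp_apply, LinearEquiv.coe_coe]
    rw [← (ℛ ℂ x).eq]
    simp
  ext x
  rw [key, key, LinearMap.comp_apply, piR_of_mem (H x)]

/-- In the dual algebra h = ε h = (h' ∘ Π^L) h = h' h = h' (h ∘ Π^R) = h' ε = h'. -/
lemma IsHaarFunctional.eq {h h' : Module.Dual ℂ A} (H : IsHaarFunctional h)
    (H' : IsHaarFunctional h') : h = h' := by
  have h1 : dualMul (ε : Module.Dual ℂ A) h = h := by
    ext x; simp only [dualMul, LinearMap.comp_apply]
    conv_rhs => rw [← rTensor_counit_comul x]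
    rw [← (ℛ ℂ x).eq]; simp
  have h2 : dualMul h' (ε : Module.Dual ℂ A) = h' := by
    ext x; simp only [dualMul, LinearMap.comp_apply]
    conv_rhs => rw [← lTensor_counit_comul x]
    rw [← (ℛ ℂ x).eq]; simp
  rw [← h1, ← H'.left_normalized, ← H.left_integral, H'.right_integral, H.right_normalized, h2]

lemma haarEL_left_mul (φ : Module.Dual ℂ A) {b : A} (hb : b ∈ leftSub A) (x : A) :
    haarEL φ (b * x) = b * haarEL φ x := by
  simp only [haarEL, LinearMap.comp_apply, LinearEquiv.coe_coe]
  rw [comul_mul, comul_of_mem_left hb, mul_assoc, comul_one_mul, ← (ℛ ℂ x).eq]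
  simp [Finset.mul_sum]

lemma haarEL_mul_left (φ : Module.Dual ℂ A) {b : A} (hb : b ∈ leftSub A) (x : A) :
    haarEL φ (x * b) = haarEL φ x * b := by
  simp only [haarEL, LinearMap.comp_apply, LinearEquiv.coe_coe]
  rw [comul_mul, comul_of_mem_left' hb, ← mul_assoc, mul_comul_one, ← (ℛ ℂ x).eq]
  simp [Finset.sum_mul]

lemma counit_haarEL (φ : Module.Dual ℂ A) (x : A) : ε (haarEL φ x) = φ x := by
  simp only [haarEL, LinearMap.comp_apply, LinearEquiv.coe_coe]
  conv_rhs => rw [← rTensor_counit_comul x]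
  rw [← (ℛ ℂ x).eq]
  simp only [map_sum, LinearMap.lTensor_tmul, LinearMap.rTensor_tmul, TensorProduct.rid_tmul,
    TensorProduct.lid_tmul, map_smul, smul_eq_mul, mul_comm]

/-! ### The regular trace -/

/-- The trace of the left regular representation. -/
def regTrace : A →ₗ[ℂ] ℂ := LinearMap.trace ℂ A ∘ₗ LinearMap.mul ℂ A

omit [Coalgebra ℂ A] [WeakHopfAlgebra A] in
lemma regTrace_apply (x : A) : regTrace x = LinearMap.trace ℂ A (LinearMap.mulLeft ℂ x) := rfl

lemma regTrace_mul_comm (x y : A) : regTrace (x * y) = regTrace (y * x) := by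
  rw [regTrace_apply, regTrace_apply, LinearMap.mulLeft_mul, LinearMap.mulLeft_mul]
  exact LinearMap.trace_mul_comm ℂ _ _

/-- `x₍₂₎ S(x₍₁₎) = 1₍₁₎ ε(1₍₂₎ x)` if `S² = 1`. -/
lemma mul'_comm_rTensor_antip (hS : ∀ x : A, antip (antip x) = x) :
    LinearMap.mul' ℂ A ∘ₗ (TensorProduct.comm ℂ A A).toLinearMap ∘ₗ
      LinearMap.rTensor A antip ∘ₗ Δ = piRbar (A := A) := by
  ext x
  rw [← hS (piRbar x), antip_piRbar, ← conv_id_antip, conv_apply, map_sum]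
  simp only [LinearMap.comp_apply]
  conv_lhs => rw [← (ℛ ℂ x).eq]
  simp [antip_mul, hS]

/-- `S(x₍₂₎) x₍₁₎ = ε(x 1₍₁₎) 1₍₂₎` if `S² = 1`. -/
lemma mul'_comm_lTensor_antip (hS : ∀ x : A, antip (antip x) = x) :
    LinearMap.mul' ℂ A ∘ₗ (TensorProduct.comm ℂ A A).toLinearMap ∘ₗ
      LinearMap.lTensor A antip ∘ₗ Δ = piLbar (A := A) := by
  ext x
  rw [← hS (piLbar x), antip_piLbar, ← conv_antip_id, conv_apply, map_sum]
  simp only [LinearMap.comp_apply]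
  conv_lhs => rw [← (ℛ ℂ x).eq]
  simp [antip_mul, hS]

/-- `x₍₂₎ S(x₍₁₎) ⊗ x₍₃₎ = Δ(1) (1 ⊗ x)` if `S² = 1`. -/
lemma lift_mul_antip_comul (hS : ∀ x : A, antip (antip x) = x) (y : A) :
    TensorProduct.lift ((LinearMap.mul ℂ (A ⊗[ℂ] A)).flip ∘ₗ inl ∘ₗ antip)
      (LinearMap.lTensor A Δ (Δ y)) = Δ 1 * (1 ⊗ₜ y) := by
  rw [← rTensor_piRbar_comul, ← mul'_comm_rTensor_antip hS, ← Coalgebra.coassoc_apply]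
  have h (s : (A ⊗[ℂ] A) ⊗[ℂ] A) :
      TensorProduct.lift ((LinearMap.mul ℂ (A ⊗[ℂ] A)).flip ∘ₗ inl ∘ₗ antip)
        (TensorProduct.assoc ℂ A A A s) =
      LinearMap.rTensor A (LinearMap.mul' ℂ A ∘ₗ (TensorProduct.comm ℂ A A).toLinearMap ∘ₗ
        LinearMap.rTensor A antip) s := by
    induction s with
    | zero => simp
    | add s t hs ht => simp only [map_add, hs, ht]
    | tmul s c =>
      induction s with
      | zero => simp
      | add s t hs ht => simp only [TensorProduct.add_tmul, map_add, hs, ht]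
      | tmul a b => simp
  rw [h, ← LinearMap.rTensor_comp_apply]
  rfl

/-- `φ(x₍₁₎ S(x₍₂₎)) x₍₃₎ = φ(S(1₍₁₎)) 1₍₂₎ x`. -/
lemma lift_antip_smul_comul (φ : Module.Dual ℂ A) (y : A) :
    TensorProduct.lid ℂ A (LinearMap.rTensor A (φ ∘ₗ LinearMap.mul' ℂ A ∘ₗ
      LinearMap.lTensor A antip) ((TensorProduct.assoc ℂ A A A).symm (LinearMap.lTensor A Δ (Δ y))))
    = ∑ i ∈ (ℛ ℂ (1 : A)).index, φ (antip ((ℛ ℂ (1 : A)).left i)) •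
        ((ℛ ℂ (1 : A)).right i * y) := by
  have h : (φ ∘ₗ LinearMap.mul' ℂ A ∘ₗ LinearMap.lTensor A antip) ∘ₗ Δ = φ ∘ₗ piL A := by
    rw [← conv_id_antip]; rfl
  rw [Coalgebra.coassoc_symm_apply, ← LinearMap.rTensor_comp_apply, h,
    LinearMap.rTensor_comp_apply, rTensor_piL_comul]
  conv_lhs => rw [← (ℛ ℂ (1 : A)).eq]
  simp [Finset.sum_mul]

variable [FiniteDimensional ℂ A]

/-- After pairing with φ, the left side is the trace of y ↦ φ(x₁)x₂y. This operator factors as ∑ G_a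
L_x R_a; cycling the trace gives tr(L_x ∑ R_a G_a), and ∑ R_a G_a is y ↦ φ(S(1₁)) 1₂y. -/
theorem haarEL_regTrace (hS : ∀ x : A, antip (antip x) = x) (x : A) :
    haarEL regTrace x = ∑ i ∈ (ℛ ℂ (1 : A)).index,
      regTrace (x * (ℛ ℂ (1 : A)).right i) • antip ((ℛ ℂ (1 : A)).left i) := by
  rw [← sub_eq_zero, ← Module.forall_dual_apply_eq_zero_iff ℂ]
  intro φ
  rw [map_sub, sub_eq_zero]
  let b := Module.finBasis ℂ A
  -- R_a reads off the second leg of Δ against the basis vector b_a, and G_a(y) = φ(y₁S(b_a))y₂.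
  let R (a : Fin (Module.finrank ℂ A)) : A →ₗ[ℂ] A :=
    (TensorProduct.lid ℂ A).toLinearMap ∘ₗ LinearMap.rTensor A (b.coord a) ∘ₗ Δ
  let G (a : Fin (Module.finrank ℂ A)) : A →ₗ[ℂ] A :=
    (TensorProduct.lid ℂ A).toLinearMap ∘ₗ
      LinearMap.rTensor A (φ ∘ₗ LinearMap.mulRight ℂ (antip (b a))) ∘ₗ Δ
  have hR (y : A) : Δ y = ∑ a, b a ⊗ₜ[ℂ] R a y := by
    have h (t : A ⊗[ℂ] A) :
        t = ∑ a, b a ⊗ₜ[ℂ] (TensorProduct.lid ℂ A (LinearMap.rTensor A (b.coord a) t)) := by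
      induction t with
      | zero => simp
      | add s t hs ht =>
        conv_lhs => rw [hs, ht]
        simp only [map_add, TensorProduct.tmul_add, Finset.sum_add_distrib]
      | tmul u v =>
        conv_lhs => rw [← b.sum_repr u, TensorProduct.sum_tmul]
        simp [TensorProduct.smul_tmul]
    exact h (Δ y)
  -- ∑ G_a(x R_a(y)) = φ(x₁y₂S(y₁)) x₂y₃, and y₂S(y₁) ⊗ y₃ = Δ(1)(1 ⊗ y) is absorbed by Δ(x). This
  -- is where S² = id enters.
  have h1 : φ (haarEL regTrace x) =
      LinearMap.trace ℂ A (∑ a, G a ∘ₗ LinearMap.mulLeft ℂ x ∘ₗ R a) := by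
    have h2 : ∑ a, G a ∘ₗ LinearMap.mulLeft ℂ x ∘ₗ R a = ∑ i ∈ (ℛ ℂ x).index,
        φ ((ℛ ℂ x).left i) • LinearMap.mulLeft ℂ ((ℛ ℂ x).right i) := by
      ext y
      have h3 := lift_mul_antip_comul hS y
      rw [hR y] at h3
      have h4 := congrArg (fun t => TensorProduct.lid ℂ A (LinearMap.rTensor A φ (Δ x * t))) h3
      simp only [← mul_assoc, mul_comul_one] at h4
      have h5 : TensorProduct.lid ℂ A (LinearMap.rTensor A φ (Δ x * (1 ⊗ₜ y))) =
          ∑ i ∈ (ℛ ℂ x).index, φ ((ℛ ℂ x).left i) • ((ℛ ℂ x).right i * y) := by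
        conv_lhs => rw [← (ℛ ℂ x).eq]
        simp [Finset.sum_mul]
      rw [h5] at h4
      have h6 (a) (s : A ⊗[ℂ] A) : LinearMap.rTensor A (φ ∘ₗ LinearMap.mulRight ℂ (antip (b a))) s =
          LinearMap.rTensor A φ (s * (antip (b a) ⊗ₜ 1)) := by
        induction s with
        | zero => simp
        | add s t hs ht => simp only [map_add, add_mul, hs, ht]
        | tmul u v => simp
      simp only [LinearMap.sum_apply, LinearMap.smul_apply, LinearMap.mulLeft_apply, ← h4]
      simp [G, h6, Finset.mul_sum, comul_mul, mul_assoc]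
    rw [h2]
    simp only [map_sum, map_smul, ← regTrace_apply, haarEL, LinearMap.comp_apply,
      LinearEquiv.coe_coe]
    conv_lhs => rw [← (ℛ ℂ x).eq]
    simp [mul_comm]
  have h2 : LinearMap.trace ℂ A (∑ a, G a ∘ₗ LinearMap.mulLeft ℂ x ∘ₗ R a) =
      LinearMap.trace ℂ A (LinearMap.mulLeft ℂ x * ∑ a, R a ∘ₗ G a) := by
    rw [Finset.mul_sum, map_sum, map_sum]
    refine Finset.sum_congr rfl fun a _ => ?_
    rw [LinearMap.trace_comp_comm', LinearMap.comp_assoc]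
    rfl
  -- In the other order the sum is φ(y₁S(y₂))y₃ = φ(Π^L(y₁))y₂.
  have h3 : ∑ a, R a ∘ₗ G a = ∑ i ∈ (ℛ ℂ (1 : A)).index, φ (antip ((ℛ ℂ (1 : A)).left i)) •
        LinearMap.mulLeft ℂ ((ℛ ℂ (1 : A)).right i) := by
    ext y
    have h4 := lift_antip_smul_comul φ y
    simp only [LinearMap.sum_apply, LinearMap.smul_apply, LinearMap.mulLeft_apply, ← h4]
    conv_rhs => rw [← (ℛ ℂ y).eq]
    conv_lhs =>
      enter [2, a]; rw [LinearMap.comp_apply]; simp only [G, LinearMap.comp_apply]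
      rw [← (ℛ ℂ y).eq]
    simp only [map_sum, LinearMap.lTensor_tmul, hR]
    rw [Finset.sum_comm]
    simp [TensorProduct.tmul_sum]
  rw [h1, h2, h3]
  simp only [Finset.mul_sum, map_sum, mul_smul_comm, map_smul, smul_eq_mul, regTrace_apply,
    LinearMap.mulLeft_mul, mul_comm]
  rfl

end WeakHopf

/-! ### Dual bases and traces of multiplication operators. -/

section NondegenerateTrace

variable {A : Type*} [Ring A] [Algebra ℂ A] [FiniteDimensional ℂ A]

/-- Dual bases of a nondegenerate functional. -/
lemma exists_dual_bases {t : A →ₗ[ℂ] ℂ} (ht : ∀ x, (∀ y, t (x * y) = 0) → x = 0) :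
    ∃ (n : ℕ) (a b : Fin n → A), (∀ x, ∑ i, t (b i * x) • a i = x) ∧
      (∀ x, ∑ i, t (x * a i) • b i = x) ∧
      ∀ f : A →ₗ[ℂ] A, LinearMap.trace ℂ A f = ∑ i, t (b i * f (a i)) := by
  let B : A →ₗ[ℂ] Module.Dual ℂ A := LinearMap.compr₂ (LinearMap.mul ℂ A) t
  have hB (x y : A) : B x y = t (x * y) := rfl
  have hinj : Function.Injective B := by
    rw [← LinearMap.ker_eq_bot, LinearMap.ker_eq_bot']
    intro x hx
    exact ht x fun y => by rw [← hB, hx]; rfl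
  have hsurj : Function.Surjective B :=
    (LinearMap.injective_iff_surjective_of_finrank_eq_finrank
      (Subspace.dual_finrank_eq (K := ℂ) (V := A)).symm).1 hinj
  let e := Module.finBasis ℂ A
  choose b hb using fun i => hsurj (e.coord i)
  have hb' (i) (x : A) : t (b i * x) = e.repr x i := by rw [← hB, hb]; rfl
  have h1 (x : A) : ∑ i, t (b i * x) • e i = x := by simp only [hb', e.sum_repr]
  refine ⟨_, e, b, h1, fun x => ?_, fun f => ?_⟩
  · rw [← sub_eq_zero]
    refine ht _ fun y => ?_
    rw [sub_mul, map_sub, sub_eq_zero]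
    conv_rhs => rw [← h1 y]
    simp only [Finset.sum_mul, Finset.mul_sum, smul_mul_assoc, mul_smul_comm, map_sum, map_smul,
      smul_eq_mul, mul_comm]
  · rw [LinearMap.trace_eq_matrix_trace ℂ e, Matrix.trace]
    simp [LinearMap.toMatrix_apply, hb']

/-- In dual bases the two traces are ∑ t(bᵢaᵢx) and ∑ t(aᵢbᵢx), and ∑ bᵢaᵢ = ∑ aᵢbᵢ because t is a
trace. -/
lemma trace_mulRight_eq_regTrace {t : A →ₗ[ℂ] ℂ} (ht : ∀ x, (∀ y, t (x * y) = 0) → x = 0)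
    (htr : ∀ x y, t (x * y) = t (y * x)) (x : A) :
    LinearMap.trace ℂ A (LinearMap.mulRight ℂ x) = LinearMap.trace ℂ A (LinearMap.mulLeft ℂ x) := by
  obtain ⟨n, a, b, h1, h2, h3⟩ := exists_dual_bases ht
  have h4 : ∑ i, b i * a i = ∑ i, a i * b i := by
    calc ∑ i, b i * a i = ∑ i, (∑ j, t (b j * b i) • a j) * a i := by simp only [h1]
      _ = ∑ j, a j * ∑ i, t (b i * b j) • a i := by
        simp only [Finset.sum_mul, Finset.mul_sum]
        rw [Finset.sum_comm]
        refine Finset.sum_congr rfl fun i _ => Finset.sum_congr rfl fun j _ => ?_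
        rw [htr]; simp
      _ = ∑ i, a i * b i := by simp only [h1]
  rw [h3, h3]
  calc ∑ i, t (b i * LinearMap.mulRight ℂ x (a i)) = t ((∑ i, b i * a i) * x) := by
        simp [Finset.sum_mul, mul_assoc]
    _ = ∑ i, t (b i * LinearMap.mulLeft ℂ x (a i)) := by
        rw [h4, Finset.sum_mul, map_sum]
        refine Finset.sum_congr rfl fun i _ => ?_
        rw [LinearMap.mulLeft_apply, mul_assoc, htr, mul_assoc]

end NondegenerateTrace

/-! ### The Haar index is hypercentral. -/

section WeakHopf

variable {A : Type*} [Ring A] [Algebra ℂ A] [Coalgebra ℂ A] [WeakHopfAlgebra A]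

/-- The element `1₍₁₎ χ(1₍₂₎)`, where `χ` is the regular trace. -/
def haarIndex : A := haarEL regTrace 1

lemma haarIndex_eq : (haarIndex : A) = ∑ i ∈ (ℛ ℂ (1 : A)).index,
    regTrace ((ℛ ℂ (1 : A)).right i) • (ℛ ℂ (1 : A)).left i := by
  simp only [haarIndex, haarEL, LinearMap.comp_apply, LinearEquiv.coe_coe]
  conv_lhs => rw [← (ℛ ℂ (1 : A)).eq]
  simp

lemma haarIndex_mem_right : (haarIndex : A) ∈ rightSub A := by
  simp only [haarIndex, haarEL, LinearMap.comp_apply, LinearEquiv.coe_coe]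
  rw [← rTensor_piR_one, ← (ℛ ℂ (1 : A)).eq]
  simp only [map_sum, LinearMap.rTensor_tmul, LinearMap.lTensor_tmul, TensorProduct.rid_tmul]
  exact Submodule.sum_mem _ fun i _ => Submodule.smul_mem _ _ (piR_mem _)

lemma sum_smul_antip (f : A →ₗ[ℂ] ℂ) :
    ∑ i ∈ (ℛ ℂ (1 : A)).index, f ((ℛ ℂ (1 : A)).right i) • antip ((ℛ ℂ (1 : A)).left i) =
    ∑ i ∈ (ℛ ℂ (1 : A)).index, f ((ℛ ℂ (1 : A)).right i) • piL A ((ℛ ℂ (1 : A)).left i) := by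
  have h := congrArg (TensorProduct.rid ℂ A ∘ LinearMap.lTensor A f) (rTensor_antip_one (A := A))
  rw [← (ℛ ℂ (1 : A)).eq] at h
  simpa using h

lemma sum_antip_mul : ∑ i ∈ (ℛ ℂ (1 : A)).index,
    antip ((ℛ ℂ (1 : A)).left i) * (ℛ ℂ (1 : A)).right i = 1 := by
  have h := conv_apply (antip (A := A)) LinearMap.id 1
  rw [conv_antip_id, piR_one] at h
  exact h.symm

lemma sum_mul_antip (hS : ∀ x : A, antip (antip x) = x) : ∑ i ∈ (ℛ ℂ (1 : A)).index,
    (ℛ ℂ (1 : A)).right i * antip ((ℛ ℂ (1 : A)).left i) = 1 := by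
  have h := conv_apply LinearMap.id (antip (A := A)) 1
  rw [conv_id_antip, piL_one] at h
  have h2 := congrArg antip h
  rw [antip_one, map_sum] at h2
  simpa [antip_mul, hS] using h2.symm

variable [FiniteDimensional ℂ A]

lemma haarEL_regTrace_mem (hS : ∀ x : A, antip (antip x) = x) (x : A) :
    haarEL regTrace x ∈ leftSub A := by
  rw [haarEL_regTrace hS]
  have h := sum_smul_antip (regTrace ∘ₗ LinearMap.mulLeft ℂ x)
  simp only [LinearMap.comp_apply, LinearMap.mulLeft_apply] at h
  rw [h]
  exact Submodule.sum_mem _ fun i _ => Submodule.smul_mem _ _ (piL_mem _)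

lemma haarIndex_mem_left (hS : ∀ x : A, antip (antip x) = x) : (haarIndex : A) ∈ leftSub A :=
  haarEL_regTrace_mem hS 1

/-- The two sides are x₁χ(Π^L(x₂)) and x₁χ(`piLbar` x₂). Here Π^L(y) = y₁S(y₂) and, as S² = id,
`piLbar` y = S(y₂)y₁; the trace χ does not distinguish them. -/
lemma haarIndex_comm (hS : ∀ x : A, antip (antip x) = x) (x : A) :
    haarIndex * x = x * haarIndex := by
  have h1 : haarIndex * x =
      TensorProduct.rid ℂ A (LinearMap.lTensor A regTrace (Δ (1 : A) * (x ⊗ₜ 1))) := by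
    rw [haarIndex_eq]
    conv_rhs => rw [← (ℛ ℂ (1 : A)).eq]
    simp [Finset.sum_mul]
  have h2 : x * haarIndex =
      TensorProduct.rid ℂ A (LinearMap.lTensor A regTrace ((x ⊗ₜ 1) * Δ (1 : A))) := by
    rw [haarIndex_eq]
    conv_rhs => rw [← (ℛ ℂ (1 : A)).eq]
    simp [Finset.mul_sum]
  rw [h1, h2, ← lTensor_piL_comul, ← lTensor_piLbar_comul, ← LinearMap.lTensor_comp_apply,
    ← LinearMap.lTensor_comp_apply]
  congr 3
  rw [← mul'_comm_lTensor_antip hS, ← conv_id_antip]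
  ext y
  simp only [LinearMap.comp_apply, conv_apply]
  conv_rhs => rw [← (ℛ ℂ y).eq]
  simp only [map_sum, LinearMap.lTensor_tmul, LinearEquiv.coe_coe, TensorProduct.comm_tmul,
    LinearMap.mul'_apply, LinearMap.id_apply]
  exact Finset.sum_congr rfl fun i _ => regTrace_mul_comm _ _

lemma haarIndex_mem (hS : ∀ x : A, antip (antip x) = x) : (haarIndex : A) ∈ hypercenter A :=
  ⟨⟨haarIndex_mem_left hS, haarIndex_mem_right⟩,
    (Subalgebra.mem_center_iff (R := ℂ)).2 fun x => (haarIndex_comm hS x).symm⟩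

/-- Conjugation by the involution S turns left multiplication by S(x) into right multiplication by
x. -/
lemma regTrace_antip (hS : ∀ x : A, antip (antip x) = x)
    (ht : ∀ x : A, (∀ y, regTrace (x * y) = 0) → x = 0) (x : A) :
    regTrace (antip x) = regTrace x := by
  rw [regTrace_apply, regTrace_apply, ← trace_mulRight_eq_regTrace ht regTrace_mul_comm x]
  have h : LinearMap.mulLeft ℂ (antip x) = antip ∘ₗ (LinearMap.mulRight ℂ x ∘ₗ antip) := by
    ext y; simp [antip_mul, hS]
  have h2 : antip ∘ₗ antip = (LinearMap.id : A →ₗ[ℂ] A) := LinearMap.ext hS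
  rw [h, LinearMap.trace_comp_comm', LinearMap.comp_assoc, h2, LinearMap.comp_id]

end WeakHopf

/-! ### Spectral theory in a finite dimensional C*-algebra; faithfulness of the regular trace. -/

section CStar

variable {A : Type*} [CStarAlgebra A]

/-- `B` is a unital *-subalgebra of `A`. -/
structure IsUnitalStarSub (B : Submodule ℂ A) : Prop where
  one_mem : 1 ∈ B
  mul_mem : ∀ x ∈ B, ∀ y ∈ B, x * y ∈ B
  star_mem : ∀ x ∈ B, star x ∈ B

lemma isUnitalStarSub_top : IsUnitalStarSub (⊤ : Submodule ℂ A) := ⟨trivial, by simp, by simp⟩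

lemma isUnitalStarSub_center :
    IsUnitalStarSub (Subalgebra.toSubmodule (Subalgebra.center ℂ A)) where
  one_mem := Subalgebra.one_mem _
  mul_mem _ hx _ hy := Subalgebra.mul_mem _ hx hy
  star_mem x hx := by
    rw [Subalgebra.mem_toSubmodule, Subalgebra.mem_center_iff] at hx ⊢
    intro y
    simpa using (congrArg star (hx (star y))).symm

lemma IsUnitalStarSub.inf {B C : Submodule ℂ A} (hB : IsUnitalStarSub B) (hC : IsUnitalStarSub C) :
    IsUnitalStarSub (B ⊓ C) where
  one_mem := ⟨hB.one_mem, hC.one_mem⟩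
  mul_mem x hx y hy := ⟨hB.mul_mem x hx.1 y hy.1, hC.mul_mem x hx.2 y hy.2⟩
  star_mem x hx := ⟨hB.star_mem x hx.1, hC.star_mem x hx.2⟩

lemma mem_center_iff {x : A} :
    x ∈ Subalgebra.toSubmodule (Subalgebra.center ℂ A) ↔ ∀ y, x * y = y * x := by
  rw [Subalgebra.mem_toSubmodule, Subalgebra.mem_center_iff]
  exact forall_congr' fun y => eq_comm

lemma IsUnitalStarSub.aeval_mem {B : Submodule ℂ A} (hB : IsUnitalStarSub B) {a : A} (ha : a ∈ B)
    (P : Polynomial ℂ) : Polynomial.aeval a P ∈ B := by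
  induction P using Polynomial.induction_on' with
  | add p q hp hq => rw [map_add]; exact B.add_mem hp hq
  | monomial n c =>
    rw [Polynomial.aeval_monomial, ← Algebra.smul_def]
    refine B.smul_mem _ ?_
    induction n with
    | zero => simpa using hB.one_mem
    | succ n ih => rw [pow_succ]; exact hB.mul_mem _ ih _ ha

lemma aeval_mul_of_mul_eq_smul {a x : A} {c : ℂ} (h : a * x = c • x) (P : Polynomial ℂ) :
    Polynomial.aeval a P * x = P.eval c • x := by
  induction P using Polynomial.induction_on' with
  | add p q hp hq => simp only [map_add, add_mul, hp, hq, Polynomial.eval_add, add_smul]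
  | monomial n d =>
    rw [Polynomial.aeval_monomial, ← Algebra.smul_def, Polynomial.eval_monomial, smul_mul_assoc,
      mul_smul]
    congr 1
    induction n with
    | zero => simp
    | succ n ih => rw [pow_succ, mul_assoc, h, mul_smul_comm, ih, smul_smul, pow_succ, mul_comm]

variable [FiniteDimensional ℂ A]

lemma mem_spectrum_iff_exists {a : A} {c : ℂ} : c ∈ spectrum ℂ a ↔ ∃ x ≠ 0, a * x = c • x := by
  rw [spectrum.mem_iff, IsUnit.isUnit_iff_mulLeft_bijective]
  have h : Function.Bijective ((algebraMap ℂ A c - a) * ·) ↔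
      Function.Injective (LinearMap.mulLeft ℂ (algebraMap ℂ A c - a)) :=
    ⟨fun h => h.1, fun h => ⟨h, LinearMap.surjective_of_injective h⟩⟩
  rw [h, ← LinearMap.ker_eq_bot, LinearMap.ker_eq_bot']
  push Not
  refine exists_congr fun x => ?_
  rw [and_comm, LinearMap.mulLeft_apply, sub_mul, sub_eq_zero, ← Algebra.smul_def, eq_comm]

lemma finite_spectrum (a : A) : (spectrum ℂ a).Finite := by
  refine (Module.End.finite_spectrum (LinearMap.mulLeft ℂ a)).subset fun c hc => ?_
  obtain ⟨x, hx, h⟩ := mem_spectrum_iff_exists.1 hc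
  rw [← Module.End.hasEigenvalue_iff_mem_spectrum]
  exact Module.End.hasEigenvalue_of_hasEigenvector (x := x)
    ⟨Module.End.mem_eigenspace_iff.2 h, hx⟩

/-- Spectral projections of a selfadjoint element of a finite dimensional *-subalgebra. -/
lemma exists_spectral_projection {B : Submodule ℂ A} (hB : IsUnitalStarSub B) {a : A} (ha : a ∈ B)
    (hsa : IsSelfAdjoint a) (c : ℂ) :
    ∃ q ∈ B, IsStarProjection q ∧ ∀ x, q * x = x ↔ a * x = c • x := by
  classical
  set s := (finite_spectrum a).toFinset with hs
  -- P is 1 at c and 0 on the rest of the spectrum. Inserting c covers c outside the spectrum, where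
  -- the projection is 0.
  set P := Lagrange.basis (insert c s) id c
  have h1 : P.eval c = 1 := Lagrange.eval_basis_self (v := id) (Function.injective_id.injOn)
    (Finset.mem_insert_self c s)
  have h0 (d : ℂ) (hd : d ∈ spectrum ℂ a) (hdc : d ≠ c) : P.eval d = 0 :=
    Lagrange.eval_basis_of_ne (v := id) (Ne.symm hdc) (Finset.mem_insert_of_mem (by simpa [hs]))
  have hn : IsStarNormal a := hsa.isStarNormal
  have hq : cfc P.eval a = Polynomial.aeval a P := cfc_polynomial P a
  have hid : (Polynomial.aeval a P) * (Polynomial.aeval a P) = Polynomial.aeval a P := by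
    rw [← hq, ← cfc_mul P.eval P.eval a]
    refine cfc_congr fun d hd => ?_
    by_cases hdc : d = c
    · subst hdc; simp [h1]
    · simp [h0 d hd hdc]
  have hst : star (Polynomial.aeval a P) = Polynomial.aeval a P := by
    rw [← hq, ← cfc_star]
    refine cfc_congr fun d hd => ?_
    by_cases hdc : d = c
    · subst hdc; simp [h1]
    · simp [h0 d hd hdc]
  have haq : a * Polynomial.aeval a P = c • Polynomial.aeval a P := by
    have : a * Polynomial.aeval a P = cfc (fun x => x * P.eval x) a := by
      rw [cfc_mul (fun x => x) P.eval a, cfc_id' ℂ a, hq]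
    rw [this, ← hq, ← cfc_smul c P.eval a]
    refine cfc_congr fun d hd => ?_
    by_cases hdc : d = c
    · subst hdc; simp
    · simp [h0 d hd hdc]
  refine ⟨Polynomial.aeval a P, hB.aeval_mem ha P, ⟨hid, hst⟩, fun x => ⟨fun h => ?_, fun h => ?_⟩⟩
  · rw [← h, ← mul_assoc, haq, smul_mul_assoc]
  · rw [aeval_mul_of_mul_eq_smul h, h1, one_smul]

/-- χ(a) is the sum of the eigenvalues of left multiplication by a = x*x, all in the nonnegative
spectrum of a. If the sum vanished, so would the spectrum, hence a and x. -/
lemma regTrace_star_mul_self_pos {x : A} (hx : x ≠ 0) : 0 < regTrace (star x * x) := by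
  set a := star x * x with ha
  have hsa : IsSelfAdjoint a := IsSelfAdjoint.star_mul_self x
  have hsp (c : ℂ) (hc : c ∈ spectrum ℂ a) : 0 ≤ c := by
    let _ := CStarAlgebra.spectralOrder A
    have _ := CStarAlgebra.spectralOrderedRing A
    exact spectrum_nonneg_of_nonneg (star_mul_self_nonneg x) hc
  have hroot (c : ℂ) : c ∈ (LinearMap.charpoly (LinearMap.mulLeft ℂ a)).roots ↔
      c ∈ spectrum ℂ a := by
    rw [mem_spectrum_iff_exists, Polynomial.mem_roots (LinearMap.charpoly_monic _).ne_zero,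
      ← Module.End.hasEigenvalue_iff_isRoot_charpoly]
    constructor
    · intro h
      obtain ⟨y, hy⟩ := h.exists_hasEigenvector
      exact ⟨y, hy.2, hy.apply_eq_smul⟩
    · rintro ⟨y, hy, h⟩
      exact Module.End.hasEigenvalue_of_hasEigenvector (x := y)
        ⟨Module.End.mem_eigenspace_iff.2 h, hy⟩
  have htr : regTrace a = (LinearMap.charpoly (LinearMap.mulLeft ℂ a)).roots.sum :=
    Module.End.trace_eq_sum_roots_charpoly_of_splits (IsAlgClosed.splits _)
  have h0 : 0 ≤ regTrace a := by
    rw [htr]; exact Multiset.sum_nonneg fun c hc => hsp c ((hroot c).1 hc)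
  refine lt_of_le_of_ne h0 fun h => hx ?_
  rw [htr, eq_comm] at h
  have h2 : ∀ c ∈ (LinearMap.charpoly (LinearMap.mulLeft ℂ a)).roots, c = 0 :=
    Multiset.all_zero_of_le_zero_le_of_sum_eq_zero
      (fun c hc => hsp c ((hroot c).1 hc)) h
  have h3 : a = 0 := CFC.eq_zero_of_spectrum_subset_zero (R := ℂ) a
    (fun c hc => h2 c ((hroot c).2 hc)) hsa.isStarNormal
  exact CStarRing.star_mul_self_eq_zero_iff x |>.1 h3

lemma isFaithfulTrace_regTrace : IsFaithfulTrace (regTrace : A →ₗ[ℂ] ℂ) where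
  trace := fun x y => by
    rw [regTrace_apply, regTrace_apply, LinearMap.mulLeft_mul, LinearMap.mulLeft_mul]
    exact LinearMap.trace_mul_comm ℂ _ _
  faithful := fun x hx => regTrace_star_mul_self_pos hx

omit [FiniteDimensional ℂ A] in
lemma IsFaithfulTrace.nondegenerate {t : A →ₗ[ℂ] ℂ} (ht : IsFaithfulTrace t) (x : A)
    (h : ∀ y, t (x * y) = 0) : x = 0 := by
  by_contra hx
  have := ht.faithful x hx
  rw [ht.trace, h] at this
  exact lt_irrefl _ this

omit [FiniteDimensional ℂ A] in
lemma IsFaithfulTrace.proj_pos {t : A →ₗ[ℂ] ℂ} (ht : IsFaithfulTrace t) {p : A}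
    (hp : IsStarProjection p) (h0 : p ≠ 0) : 0 < t p := by
  have := ht.faithful p h0
  rwa [hp.isSelfAdjoint.star_eq, hp.isIdempotentElem.eq] at this

omit [FiniteDimensional ℂ A] in
-- Polarization: t(y*y) is real for y = 1 + x and y = 1 + ix.
lemma IsFaithfulTrace.map_star {t : A →ₗ[ℂ] ℂ} (ht : IsFaithfulTrace t) (x : A) :
    t (star x) = star (t x) := by
  have hpos (y : A) : 0 ≤ t (star y * y) := by
    rcases eq_or_ne y 0 with rfl | hy
    · simp
    · exact (ht.faithful y hy).le
  have hr (y : A) : (t (star y * y)).im = 0 := (Complex.le_def.1 (hpos y)).2.symm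
  have h1 : (t (star (1 + x) * (1 + x))).im = 0 := hr _
  have h2 : (t (star (1 + Complex.I • x) * (1 + Complex.I • x))).im = 0 := hr _
  have h3 := hr x
  have h4 : (t 1).im = 0 := by simpa using hr 1
  simp only [star_add, star_one, star_smul, add_mul, mul_add, one_mul, mul_one, map_add,
    Complex.add_im, h3, h4, smul_mul_assoc, mul_smul_comm, map_smul, smul_eq_mul] at h1 h2
  apply Complex.ext
  · simp at h2 ⊢
    linarith
  · simp at h1 ⊢
    linarith

end CStar

/-! ### Minimal projections, sector systems and multiplicities. -/

section CStar

variable {A : Type*} [CStarAlgebra A]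

lemma _root_.IsStarProjection.mul_eq_of_mul_eq {p q : A} (hp : IsStarProjection p)
    (hq : IsStarProjection q) (h : q * p = q) : p * q = q := by
  have := congrArg star h
  rwa [star_mul, hp.isSelfAdjoint.star_eq, hq.isSelfAdjoint.star_eq] at this

lemma _root_.IsStarProjection.sub_of_mul_eq {p q : A} (hp : IsStarProjection p)
    (hq : IsStarProjection q) (h : q * p = q) : IsStarProjection (p - q) := by
  have h2 := hp.mul_eq_of_mul_eq hq h
  refine ⟨?_, hp.isSelfAdjoint.sub hq.isSelfAdjoint⟩
  have e1 : p * p = p := hp.isIdempotentElem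
  have e2 : q * q = q := hq.isIdempotentElem
  rw [IsIdempotentElem, sub_mul, mul_sub, mul_sub, e1, e2, h, h2]
  abel

lemma _root_.IsStarProjection.mul_of_comm {p q : A} (hp : IsStarProjection p)
    (hq : IsStarProjection q) (h : p * q = q * p) : IsStarProjection (p * q) := by
  have e1 : p * p = p := hp.isIdempotentElem
  have e2 : q * q = q := hq.isIdempotentElem
  refine ⟨?_, ?_⟩
  · rw [IsIdempotentElem, mul_assoc, ← mul_assoc q, ← h, mul_assoc p q q, e2, ← mul_assoc, e1]
  · rw [IsSelfAdjoint, star_mul, hp.isSelfAdjoint.star_eq, hq.isSelfAdjoint.star_eq, h]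

variable [FiniteDimensional ℂ A]

/-- A minimal projection compresses the algebra to scalars. -/
lemma IsMinProj.exists_smul {B : Submodule ℂ A} (hB : IsUnitalStarSub B) {p : A}
    (hp : IsMinProj B p) {b : A} (hb : b ∈ B) : ∃ c : ℂ, p * b * p = c • p := by
  obtain ⟨hpB, hpp, hp0, hmin⟩ := hp
  have e : p * p = p := hpp.isIdempotentElem
  -- The spectral projection of a at a nonzero eigenvalue lies below p, so minimality makes it p.
  -- The general case splits pbp into real and imaginary parts.
  have key (a : A) (ha : a ∈ B) (hsa : IsSelfAdjoint a) (h1 : p * a = a) (h2 : a * p = a) :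
      ∃ c : ℂ, a = c • p := by
    by_cases ha0 : a = 0
    · exact ⟨0, by rw [ha0, zero_smul]⟩
    obtain ⟨c, hc, hc0⟩ : ∃ c ∈ spectrum ℂ a, c ≠ 0 := by
      by_contra! h
      exact ha0 (CFC.eq_zero_of_spectrum_subset_zero (R := ℂ) a (fun c hc => h c hc)
        hsa.isStarNormal)
    obtain ⟨x, hx, hax⟩ := mem_spectrum_iff_exists.1 hc
    obtain ⟨q, hqB, hq, hq'⟩ := exists_spectral_projection hB ha hsa c
    have haq : a * q = c • q := (hq' q).1 hq.isIdempotentElem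
    have hpq : p * q = q := by
      have : p * (c • q) = c • q := by rw [← haq, ← mul_assoc, h1]
      rw [mul_smul_comm] at this
      exact smul_right_injective A hc0 this
    have hqp : q * p = q := by
      have := congrArg star hpq
      rwa [star_mul, hpp.isSelfAdjoint.star_eq, hq.isSelfAdjoint.star_eq] at this
    rcases hmin q hqB hq hqp with h | h
    · exact absurd ((hq' x).2 hax) (by rw [h, zero_mul]; exact hx.symm)
    · exact ⟨c, by rw [← h, ← haq, h, h2]⟩
  set u := p * b * p with hu
  have huB : u ∈ B := hB.mul_mem _ (hB.mul_mem _ hpB _ hb) _ hpB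
  have hpu : p * u = u := by rw [hu, ← mul_assoc, ← mul_assoc, e]
  have hup : u * p = u := by rw [hu, mul_assoc, e]
  have hps : p * star u = star u := by
    have := congrArg star hup; rwa [star_mul, hpp.isSelfAdjoint.star_eq] at this
  have hsp : star u * p = star u := by
    have := congrArg star hpu; rwa [star_mul, hpp.isSelfAdjoint.star_eq] at this
  obtain ⟨c, hc⟩ := key (u + star u) (B.add_mem huB (hB.star_mem _ huB))
    (IsSelfAdjoint.add_star_self u) (by rw [mul_add, hpu, hps]) (by rw [add_mul, hup, hsp])
  obtain ⟨d, hd⟩ := key (Complex.I • (u - star u))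
    (B.smul_mem _ (B.sub_mem huB (hB.star_mem _ huB)))
    (by rw [IsSelfAdjoint, star_smul, star_sub, star_star, Complex.star_def, Complex.conj_I,
      neg_smul, ← smul_neg, neg_sub])
    (by rw [mul_smul_comm, mul_sub, hpu, hps]) (by rw [smul_mul_assoc, sub_mul, hup, hsp])
  refine ⟨(c - Complex.I * d) / 2, ?_⟩
  have h3 : u - star u = -(Complex.I * d) • p := by
    rw [neg_smul, mul_smul, ← hd, smul_smul, Complex.I_mul_I, neg_smul, one_smul, neg_neg]
  have h4 : (2 : ℂ) • u = (c - Complex.I * d) • p := by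
    rw [sub_smul, ← hc, sub_eq_add_neg, ← neg_smul, ← h3, two_smul]; abel
  rw [div_eq_inv_mul, mul_smul, ← h4, smul_smul, inv_mul_cancel₀ two_ne_zero, one_smul]

lemma finrank_range_lt {p q : A} (hp : IsStarProjection p) (hq : IsStarProjection q)
    (h : q * p = q) (hne : q ≠ p) :
    Module.finrank ℂ (LinearMap.range (LinearMap.mulLeft ℂ q)) <
      Module.finrank ℂ (LinearMap.range (LinearMap.mulLeft ℂ p)) := by
  have h2 := hp.mul_eq_of_mul_eq hq h
  refine Submodule.finrank_lt_finrank_of_lt (lt_of_le_of_ne ?_ fun heq => hne ?_)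
  · rintro _ ⟨x, rfl⟩
    exact ⟨q * x, by simp only [LinearMap.mulLeft_apply, ← mul_assoc, h2]⟩
  · have : p ∈ LinearMap.range (LinearMap.mulLeft ℂ q) := by
      rw [heq]; exact ⟨1, mul_one p⟩
    obtain ⟨y, hy⟩ := this
    have e2 : q * q = q := hq.isIdempotentElem
    rw [← h, ← hy, LinearMap.mulLeft_apply, ← mul_assoc, e2]

lemma exists_isMinProj_le {B : Submodule ℂ A} {g : A} (hg : g ∈ B) (hgp : IsStarProjection g)
    (h0 : g ≠ 0) : ∃ p, IsMinProj B p ∧ p * g = p := by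
  induction hn : Module.finrank ℂ (LinearMap.range (LinearMap.mulLeft ℂ g))
    using Nat.strong_induction_on generalizing g with
  | _ n ih =>
    by_cases hmin : IsMinProj B g
    · exact ⟨g, hmin, hgp.isIdempotentElem⟩
    · simp only [IsMinProj, hg, hgp, ne_eq, h0, not_false_eq_true, true_and, not_forall] at hmin
      obtain ⟨q, hq, hqp, hqg, hne⟩ := hmin
      push Not at hne
      obtain ⟨p, hp, hpq⟩ := ih _ (hn ▸ finrank_range_lt hgp hqp hqg hne.2) hq hqp hne.1 rfl
      exact ⟨p, hp, by rw [← hpq, mul_assoc, hqg]⟩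

/-- Induction over the projections of a finite dimensional *-algebra. -/
lemma proj_induction {B : Submodule ℂ A} {P : A → Prop} (h0 : P 0)
    (hadd : ∀ a ∈ B, ∀ p, IsStarProjection a → IsMinProj B p → a * p = 0 → P a → P p → P (a + p))
    (hmin : ∀ p, IsMinProj B p → P p) {g : A} (hg : g ∈ B) (hgp : IsStarProjection g) : P g := by
  induction hn : Module.finrank ℂ (LinearMap.range (LinearMap.mulLeft ℂ g))
    using Nat.strong_induction_on generalizing g with
  | _ n ih =>
    by_cases hg0 : g = 0
    · rwa [hg0]
    obtain ⟨p, hp, hpg⟩ := exists_isMinProj_le hg hgp hg0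
    have hgp2 := hgp.mul_eq_of_mul_eq hp.2.1 hpg
    have e1 : g * g = g := hgp.isIdempotentElem
    have e2 : p * p = p := hp.2.1.isIdempotentElem
    have hsub := hgp.sub_of_mul_eq hp.2.1 hpg
    have hne : g - p ≠ g := fun h => hp.2.2.1 (by simpa using h)
    have := hadd (g - p) (B.sub_mem hg hp.1) p hsub hp (by rw [sub_mul, hgp2, e2, sub_self])
      (ih _ (hn ▸ finrank_range_lt hgp hsub (by rw [sub_mul, e1, hpg]) hne)
        (B.sub_mem hg hp.1) hsub rfl) (hmin p hp)
    rwa [sub_add_cancel] at this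

lemma linearIndependent_of_orthogonal {n : ℕ} {e : Fin n → A} (h0 : ∀ i, e i ≠ 0)
    (hi : ∀ i, e i * e i = e i) (ho : ∀ i j, i ≠ j → e i * e j = 0) : LinearIndependent ℂ e := by
  rw [Fintype.linearIndependent_iff]
  intro c hc i
  have h := congrArg (e i * ·) hc
  simp only [Finset.mul_sum, mul_smul_comm, mul_zero] at h
  rw [Finset.sum_eq_single i (fun j _ hj => by rw [ho i j hj.symm, smul_zero]) (by simp), hi] at h
  exact (smul_eq_zero.1 h).resolve_right (h0 i)

/-- Otherwise every inequivalent family could be extended, giving orthogonal, hence independent,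
families longer than dim A. -/
lemma exists_isSectorSystem {B : Submodule ℂ A} (hB : IsUnitalStarSub B) :
    ∃ (n : ℕ) (e : Fin n → A), IsSectorSystem B e := by
  by_contra! hcon
  have key (n : ℕ) : ∃ e : Fin n → A, (∀ i, IsMinProj B (e i)) ∧
      ∀ i j, i ≠ j → ∀ x ∈ B, e i * x * e j = 0 := by
    induction n with
    | zero => exact ⟨Fin.elim0, fun i => i.elim0, fun i => i.elim0⟩
    | succ n ih =>
      obtain ⟨e, he, hne⟩ := ih
      have : ∃ p, IsMinProj B p ∧ ∀ i, ∀ x ∈ B, p * x * e i = 0 := by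
        by_contra! h
        exact hcon n e ⟨he, hne, fun p hp => h p hp⟩
      obtain ⟨p, hp, hpe⟩ := this
      refine ⟨Fin.cons p e, fun i => ?_, fun i j => ?_⟩
      · refine Fin.cases ?_ (fun i => ?_) i
        · exact hp
        · exact he i
      · refine Fin.cases ?_ (fun i => ?_) i <;> refine Fin.cases ?_ (fun j => ?_) j
        · intro h; exact absurd rfl h
        · intro _ x hx; exact hpe j x hx
        · intro _ x hx
          have := congrArg star (hpe i (star x) (hB.star_mem x hx))
          simpa [hp.2.1.isSelfAdjoint.star_eq, (he i).2.1.isSelfAdjoint.star_eq, mul_assoc]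
            using this
        · intro h x hx
          exact hne i j (fun hij => h (by rw [hij])) x hx
  obtain ⟨e, he, hne⟩ := key (Module.finrank ℂ A + 1)
  have := (linearIndependent_of_orthogonal (fun i => (he i).2.2.1)
    (fun i => (he i).2.1.isIdempotentElem)
    (fun i j hij => by simpa using hne i j hij 1 hB.one_mem)).fintype_card_le_finrank
  simp at this

/-- The dimension of `g B e`. -/
def blockMult (B : Submodule ℂ A) (g e : A) : ℕ :=
  Module.finrank ℂ (B.map (LinearMap.mulLeft ℂ g ∘ₗ LinearMap.mulRight ℂ e))

omit [FiniteDimensional ℂ A] in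
lemma inclusionMult_eq (e f : A) : inclusionMult e f = blockMult ⊤ f e := by
  rw [inclusionMult, blockMult, LinearMap.range_eq_map]

/-- x ↦ g E(x) e is a linear projection of A onto gBe. Unlike the dimension, its trace is visibly
additive in g, as `proj_induction` requires. -/
lemma blockMult_eq_trace {B : Submodule ℂ A} (hB : IsUnitalStarSub B) {E : A →ₗ[ℂ] A}
    (hE : ∀ x, E x ∈ B) (hE' : ∀ b ∈ B, E b = b) {g e : A} (hg : g ∈ B) (he : e ∈ B)
    (hgg : g * g = g) (hee : e * e = e) : (blockMult B g e : ℂ) =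
      LinearMap.trace ℂ A (LinearMap.mulLeft ℂ g ∘ₗ LinearMap.mulRight ℂ e ∘ₗ E) := by
  have h : LinearMap.IsProj (B.map (LinearMap.mulLeft ℂ g ∘ₗ LinearMap.mulRight ℂ e))
      (LinearMap.mulLeft ℂ g ∘ₗ LinearMap.mulRight ℂ e ∘ₗ E) := by
    refine ⟨fun x => ⟨E x, hE x, rfl⟩, ?_⟩
    rintro _ ⟨x, hx, rfl⟩
    have hm : g * (x * e) ∈ B := hB.mul_mem _ hg _ (hB.mul_mem _ hx _ he)
    simp only [LinearMap.comp_apply, LinearMap.mulLeft_apply, LinearMap.mulRight_apply, hE' _ hm]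
    rw [mul_assoc g, mul_assoc x, hee, ← mul_assoc g g, hgg]
  exact h.trace.symm

/-- Two equivalent minimal projections. -/
lemma IsMinProj.equiv {B : Submodule ℂ A} (hB : IsUnitalStarSub B) {p e x : A}
    (hp : IsMinProj B p) (he : IsMinProj B e) (hx : x ∈ B) (h : p * x * e ≠ 0) :
    ∃ v ∈ B, ∃ c : ℂ, c ≠ 0 ∧ v * star v = c • p ∧ star v * v = c • e ∧ p * v = v ∧ v * e = v ∧
      ∃ y ∈ B, v = p * y * e := by
  set v := p * x * e with hv
  have epp : p * p = p := hp.2.1.isIdempotentElem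
  have eee : e * e = e := he.2.1.isIdempotentElem
  have hvB : v ∈ B := hB.mul_mem _ (hB.mul_mem _ hp.1 _ hx) _ he.1
  have hpv : p * v = v := by rw [hv, ← mul_assoc, ← mul_assoc, epp]
  have hve : v * e = v := by rw [hv, mul_assoc, eee]
  have hsp : star v * p = star v := by
    have := congrArg star hpv; rwa [star_mul, hp.2.1.isSelfAdjoint.star_eq] at this
  have hes : e * star v = star v := by
    have := congrArg star hve; rwa [star_mul, he.2.1.isSelfAdjoint.star_eq] at this
  obtain ⟨c, hc⟩ := hp.exists_smul hB (hB.mul_mem _ hvB _ (hB.star_mem _ hvB))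
  obtain ⟨d, hd⟩ := he.exists_smul hB (hB.mul_mem _ (hB.star_mem _ hvB) _ hvB)
  rw [← mul_assoc, hpv, mul_assoc, hsp] at hc
  rw [← mul_assoc, hes, mul_assoc, hve] at hd
  have hcd : c • v = d • v := by
    calc c • v = (c • p) * v := by rw [smul_mul_assoc, hpv]
      _ = v * (d • e) := by rw [← hc, ← hd, mul_assoc]
      _ = d • v := by rw [mul_smul_comm, hve]
  have hcd' : c = d := smul_left_injective ℂ h hcd
  refine ⟨v, hvB, c, ?_, hc, hcd' ▸ hd, hpv, hve, x, hx, rfl⟩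
  rintro rfl
  rw [zero_smul, CStarRing.mul_star_self_eq_zero_iff] at hc
  exact h hc

/-- The value of a trace on a projection in terms of a system of minimal projections. -/
theorem sum_blockMult_mul {B : Submodule ℂ A} (hB : IsUnitalStarSub B) {E : A →ₗ[ℂ] A}
    (hE : ∀ x, E x ∈ B) (hE' : ∀ b ∈ B, E b = b) {n : ℕ} {e : Fin n → A}
    (he : IsSectorSystem B e) {σ : A →ₗ[ℂ] ℂ} (hσ : ∀ a ∈ B, ∀ b ∈ B, σ (a * b) = σ (b * a))
    {g : A} (hg : g ∈ B) (hgp : IsStarProjection g) :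
    ∑ i, (blockMult B g (e i) : ℂ) * σ (e i) = σ g := by
  have h1 : ∑ i, (blockMult B g (e i) : ℂ) * σ (e i) = ∑ i, LinearMap.trace ℂ A
      (LinearMap.mulLeft ℂ g ∘ₗ LinearMap.mulRight ℂ (e i) ∘ₗ E) * σ (e i) :=
    Finset.sum_congr rfl fun i _ => by
      rw [blockMult_eq_trace hB hE hE' hg (he.minimal i).1 hgp.isIdempotentElem
        (he.minimal i).2.1.isIdempotentElem]
  rw [h1]
  clear h1
  refine proj_induction (B := B) (P := fun g => ∑ i, LinearMap.trace ℂ A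
      (LinearMap.mulLeft ℂ g ∘ₗ LinearMap.mulRight ℂ (e i) ∘ₗ E) * σ (e i) = σ g) ?_ ?_ ?_ hg hgp
  · simp
  · intro a _ p _ _ _ ha hp
    have hadd : LinearMap.mulLeft ℂ (a + p) = LinearMap.mulLeft ℂ a + LinearMap.mulLeft ℂ p :=
      map_add (LinearMap.mul ℂ A) a p
    simp only [hadd, LinearMap.add_comp, map_add, add_mul, Finset.sum_add_distrib, ha, hp]
  · intro p hp
    obtain ⟨i, x, hx, hne⟩ := he.exhaustive p hp
    obtain ⟨v, hvB, c, hc, hvv, hvv', hpv, hve, y, hy, hvy⟩ := hp.equiv hB (he.minimal i) hx hne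
    have epp : p * p = p := hp.2.1.isIdempotentElem
    have hw (j) (y : A) : c • (p * y * e j) = v * (star v * (p * y * e j)) := by
      rw [← mul_assoc, hvv, smul_mul_assoc, ← mul_assoc, ← mul_assoc, epp]
    have hes : star v = e i * star v := by
      have := congrArg star hve
      rw [star_mul, (he.minimal i).2.1.isSelfAdjoint.star_eq] at this
      exact this.symm
    have h0 (j) (hj : i ≠ j) (y : A) (hy : y ∈ B) : p * y * e j = 0 := by
      refine (smul_eq_zero.1 ((hw j y).trans ?_)).resolve_left hc
      rw [hes, mul_assoc (e i), ← mul_assoc (star v), ← mul_assoc (e i),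
        he.inequivalent i j hj _ (hB.mul_mem _ (hB.star_mem _ hvB) _ (hB.mul_mem _ hp.1 _ hy)),
        mul_zero]
    rw [Finset.sum_eq_single i]
    · rw [← blockMult_eq_trace hB hE hE' hp.1 (he.minimal i).1 epp
        (he.minimal i).2.1.isIdempotentElem]
      -- A minimal p meets exactly one sector, with multiplicity one: v*y is a scalar multiple of e
      -- i for y in pB(e i), so y is a multiple of v.
      have h1 : B.map (LinearMap.mulLeft ℂ p ∘ₗ LinearMap.mulRight ℂ (e i)) = ℂ ∙ v := by
        apply le_antisymm
        · rintro _ ⟨y, hy, rfl⟩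
          have hmem : star v * (p * y) ∈ B :=
            hB.mul_mem _ (hB.star_mem _ hvB) _ (hB.mul_mem _ hp.1 _ hy)
          obtain ⟨d, hd⟩ := (he.minimal i).exists_smul hB hmem
          have h2 := hw i y
          rw [hes, mul_assoc (e i), ← mul_assoc (star v), ← mul_assoc (e i), hd, mul_smul_comm,
            hve] at h2
          rw [Submodule.mem_span_singleton]
          refine ⟨c⁻¹ * d, ?_⟩
          rw [mul_smul, ← h2, smul_smul, inv_mul_cancel₀ hc, one_smul]
          simp [mul_assoc]
        · rw [Submodule.span_singleton_le_iff_mem]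
          exact ⟨y, hy, by rw [hvy]; simp [mul_assoc]⟩
      have hv0 : v ≠ 0 := by
        rintro rfl
        rw [zero_mul, eq_comm, smul_eq_zero] at hvv
        exact hvv.elim hc hp.2.2.1
      have h2 : blockMult B p (e i) = 1 := by rw [blockMult, h1, finrank_span_singleton hv0]
      have h3 : c * σ (e i) = c * σ p := by
        rw [← smul_eq_mul, ← smul_eq_mul, ← map_smul, ← map_smul, ← hvv, ← hvv',
          hσ _ (hB.star_mem _ hvB) _ hvB]
      rw [h2, Nat.cast_one, one_mul, mul_left_cancel₀ hc h3]
    · intro j _ hj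
      have : LinearMap.mulLeft ℂ p ∘ₗ LinearMap.mulRight ℂ (e j) ∘ₗ E = 0 := by
        ext x
        simpa [mul_assoc] using h0 j hj.symm (E x) (hE x)
      rw [this, map_zero, zero_mul]
    · simp

end CStar

/-! ### Regular conditional expectations: index, dimensions and inclusion matrix. -/

section CStar

variable {A : Type*} [CStarAlgebra A]

/-- `E` is an `h`-preserving conditional expectation onto `B` for a faithful trace `h` whose
restriction to `B` is the regular trace of `B`, while the regular trace of `A` is `h(K ·)` for a
central element `K` of `B`. -/
structure IsRegularExp (B : Submodule ℂ A) (h : A →ₗ[ℂ] ℂ) (E : A →ₗ[ℂ] A) (K : A) : Prop where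
  sub : IsUnitalStarSub B
  faithful : IsFaithfulTrace h
  condExp : IsCondExp B E
  map_exp : ∀ x, h (E x) = h x
  exists_casimir : ∃ (n : ℕ) (u v : Fin n → A), (∀ x, E x = ∑ i, h (v i * x) • u i) ∧
    ∑ i, v i * u i = 1 ∧ ∑ i, u i * v i = 1
  index_mem : K ∈ B
  index_comm : ∀ x, K * x = x * K
  regTrace_eq : ∀ x, regTrace x = h (K * x)

variable [FiniteDimensional ℂ A]

lemma finrank_range_mulLeft {g : A} (hg : g * g = g) :
    (Module.finrank ℂ (LinearMap.range (LinearMap.mulLeft ℂ g)) : ℂ) = regTrace g := by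
  have h : LinearMap.IsProj (LinearMap.range (LinearMap.mulLeft ℂ g)) (LinearMap.mulLeft ℂ g) := by
    refine ⟨fun x => ⟨x, rfl⟩, ?_⟩
    rintro _ ⟨x, rfl⟩
    simp only [LinearMap.mulLeft_apply, ← mul_assoc, hg]
  exact h.trace.symm

omit [FiniteDimensional ℂ A] in
lemma isCompl_mem {B : Submodule ℂ A} {p z : A} (hp : IsMinProj B p) (hz : IsStarProjection z)
    (hzp : z * p ∈ B) (hc : ∀ x, z * x = x * z) : z * p = 0 ∨ z * p = p :=
  hp.2.2.2 (z * p) hzp (hz.mul_of_comm hp.2.1 (hc p))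
    (by rw [mul_assoc, hp.2.1.isIdempotentElem.eq])

lemma blockMult_top_ne_zero {g e : A} : blockMult ⊤ g e ≠ 0 ↔ ∃ x, g * x * e ≠ 0 := by
  rw [blockMult, ← LinearMap.range_eq_map, Ne, Submodule.finrank_eq_zero, LinearMap.range_eq_bot,
    LinearMap.ext_iff]
  simp [mul_assoc]

lemma IsSectorSystem.exists_mul_ne_zero {n : ℕ} {e : Fin n → A}
    (he : IsSectorSystem (⊤ : Submodule ℂ A) e) {g : A} (hg : IsStarProjection g) (h0 : g ≠ 0) :
    ∃ i x, g * x * e i ≠ 0 := by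
  obtain ⟨p, hp, hpg⟩ := exists_isMinProj_le (B := ⊤) trivial hg h0
  obtain ⟨i, x, _, hx⟩ := he.exhaustive p hp
  refine ⟨i, x, fun h => hx ?_⟩
  rw [← hpg, mul_assoc, mul_assoc, ← mul_assoc g, h, mul_zero]

variable {B : Submodule ℂ A} {h : A →ₗ[ℂ] ℂ} {E : A →ₗ[ℂ] A} {K : A}

/-- Dual bases aᵢ, bᵢ of h are a quasi-basis: ∑ aᵢE(bᵢx) = x ∑ vₖuₖ = x. Moreover h(∑ aᵢbᵢ x) is the
trace of left multiplication by x, that is h(Kx), so nondegeneracy identifies the index. -/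
lemma IsRegularExp.hasIndex (H : IsRegularExp B h E K) : HasIndex B E K := by
  obtain ⟨n, a, b, h1, h2, h3⟩ := exists_dual_bases H.faithful.nondegenerate
  obtain ⟨m, u, v, hE, hvu, huv⟩ := H.exists_casimir
  have ht := H.faithful.trace
  refine ⟨H.condExp, n, a, b, fun x => ?_, fun x => ?_, ?_⟩
  · simp only [hE, Finset.mul_sum]
    rw [Finset.sum_comm]
    have key (k) : ∑ i, a i * h (v k * (b i * x)) • u k = x * v k * u k := by
      conv_rhs => rw [← h1 (x * v k)]
      rw [Finset.sum_mul]
      refine Finset.sum_congr rfl fun i _ => ?_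
      rw [ht, mul_smul_comm, smul_mul_assoc, mul_assoc]
    simp only [key, mul_assoc, ← Finset.mul_sum, hvu, mul_one]
  · simp only [hE, Finset.sum_mul]
    rw [Finset.sum_comm]
    have key (k) : ∑ i, h (v k * (x * a i)) • u k * b i = u k * v k * x := by
      conv_rhs => rw [mul_assoc, ← h2 (v k * x)]
      rw [Finset.mul_sum]
      refine Finset.sum_congr rfl fun i _ => ?_
      rw [mul_smul_comm, smul_mul_assoc, mul_assoc]
    simp only [key, ← Finset.sum_mul, huv, one_mul]
  · rw [← sub_eq_zero]
    refine H.faithful.nondegenerate _ fun x => ?_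
    rw [sub_mul, map_sub, sub_eq_zero, ← H.regTrace_eq, regTrace_apply, h3, Finset.sum_mul, map_sum]
    refine Finset.sum_congr rfl fun i _ => ?_
    rw [ht, LinearMap.mulLeft_apply, mul_assoc x, ht, mul_assoc]

omit [FiniteDimensional ℂ A] in
lemma IsRegularExp.preserving (H : IsRegularExp B h E K) {k : A} (hk : k ∈ B) {τ : A →ₗ[ℂ] ℂ}
    (hτ : ∀ x, τ x = h (k * x)) : IsPreservingCondExp B τ E := by
  refine ⟨H.condExp, fun b hb x => ?_⟩
  have h1 := H.condExp.bimodule (k * b) (H.sub.mul_mem _ hk _ hb) 1 H.sub.one_mem x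
  rw [mul_one, mul_one] at h1
  rw [hτ, hτ, ← mul_assoc, ← h1, H.map_exp, mul_assoc]

/-- dim Bg is the trace of x ↦ E(x)g = ∑ h(vᵢx)uᵢg, which is h(∑ vᵢuᵢ g) = h(g). -/
lemma IsRegularExp.blockMult_one (H : IsRegularExp B h E K) {g : A} (hg : g ∈ B)
    (hgg : g * g = g) : (blockMult B 1 g : ℂ) = h g := by
  obtain ⟨m, u, v, hE, hvu, huv⟩ := H.exists_casimir
  rw [blockMult_eq_trace H.sub H.condExp.mem H.condExp.apply_of_mem H.sub.one_mem hg (one_mul 1)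
    hgg]
  have : LinearMap.mulLeft ℂ 1 ∘ₗ LinearMap.mulRight ℂ g ∘ₗ E =
      ∑ i, (h ∘ₗ LinearMap.mulLeft ℂ (v i)).smulRight (u i * g) := by
    ext x; simp [hE]
  rw [this, map_sum]
  simp only [LinearMap.trace_smulRight, LinearMap.comp_apply, LinearMap.mulLeft_apply, ← mul_assoc]
  rw [← map_sum, ← Finset.sum_mul, hvu, one_mul]

lemma IsRegularExp.finrank_map (H : IsRegularExp B h E K) {g : A} (hg : g ∈ B)
    (hgg : g * g = g) : (Module.finrank ℂ (B.map (LinearMap.mulLeft ℂ g)) : ℂ) = h g := by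
  obtain ⟨m, u, v, hE, hvu, huv⟩ := H.exists_casimir
  have h1 := blockMult_eq_trace H.sub H.condExp.mem H.condExp.apply_of_mem hg H.sub.one_mem
    hgg (one_mul 1)
  rw [blockMult, LinearMap.mulRight_one, LinearMap.comp_id, LinearMap.id_comp] at h1
  rw [h1]
  have : LinearMap.mulLeft ℂ g ∘ₗ E =
      ∑ i, (h ∘ₗ LinearMap.mulLeft ℂ (v i)).smulRight (g * u i) := by
    ext x; simp [hE]
  rw [this, map_sum]
  simp only [LinearMap.trace_smulRight, LinearMap.comp_apply, LinearMap.mulLeft_apply, ← mul_assoc]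
  simp only [fun i => H.faithful.trace (v i * g) (u i), ← mul_assoc]
  rw [← map_sum, ← Finset.sum_mul, huv, one_mul]

/-- The inclusion matrix `Λ` of `B ⊆ A` satisfies `Λ Λᵗ t = t(K ·)` on the vector of a trace
`t = h(k ·)`, where `k` is a central element of `A` in `B`. -/
theorem IsRegularExp.sum_inclusionMult (H : IsRegularExp B h E K) {n m : ℕ} {e : Fin n → A}
    {f : Fin m → A} (he : IsSectorSystem (⊤ : Submodule ℂ A) e) (hf : IsSectorSystem B f) {k : A}
    (hk : k ∈ B) (hkc : ∀ x, k * x = x * k) (i : Fin n) :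
    ∑ i', (∑ j, (inclusionMult (e i) (f j) : ℂ) * (inclusionMult (e i') (f j) : ℂ)) * h (k * e i') =
      h (K * (k * e i)) := by
  have hee : e i * e i = e i := (he.minimal i).2.1.isIdempotentElem
  -- The value of the trace h(k ·) on f j, decomposed along the sectors of A; this computes Λᵗ.
  have h1 (j) : ∑ i', (inclusionMult (e i') (f j) : ℂ) * h (k * e i') = h (k * f j) := by
    have := sum_blockMult_mul isUnitalStarSub_top (E := LinearMap.id) (fun _ => trivial)
      (fun _ _ => rfl) he (σ := h ∘ₗ LinearMap.mulLeft ℂ k) (fun a _ b _ => by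
        simp only [LinearMap.comp_apply, LinearMap.mulLeft_apply]
        rw [← mul_assoc, hkc a, mul_assoc, H.faithful.trace, mul_assoc]) (g := f j) trivial
      (hf.minimal j).2.1
    simpa only [inclusionMult_eq, LinearMap.comp_apply, LinearMap.mulLeft_apply] using this
  have h2 : ∑ i', (∑ j, (inclusionMult (e i) (f j) : ℂ) * (inclusionMult (e i') (f j) : ℂ)) *
      h (k * e i') = ∑ j, (inclusionMult (e i) (f j) : ℂ) * h (k * f j) := by
    simp only [← h1, Finset.mul_sum, Finset.sum_mul, mul_assoc]
    exact Finset.sum_comm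
  rw [h2]
  -- σ(x) is the trace of y ↦ k x y (e i). It is tracial, and on f j it is Λᵢⱼ times the scalar of k
  -- there. Weighting by dim B(f j) = h(f j) sums to σ(1) = χ(k (e i)) = h(Kk (e i)).
  let σ : A →ₗ[ℂ] ℂ := LinearMap.trace ℂ A ∘ₗ LinearMap.lcomp ℂ A (LinearMap.mulRight ℂ (e i)) ∘ₗ
    LinearMap.mul ℂ A ∘ₗ LinearMap.mulLeft ℂ k
  have hσ (x : A) : σ x = LinearMap.trace ℂ A
      (LinearMap.mulLeft ℂ (k * x) ∘ₗ LinearMap.mulRight ℂ (e i)) := rfl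
  have hσt (a b : A) : σ (a * b) = σ (b * a) := by
    rw [hσ, hσ]
    have e1 : LinearMap.mulLeft ℂ (k * (a * b)) ∘ₗ LinearMap.mulRight ℂ (e i) =
        LinearMap.mulLeft ℂ a ∘ₗ (LinearMap.mulLeft ℂ (k * b) ∘ₗ LinearMap.mulRight ℂ (e i)) := by
      ext x; simp [← mul_assoc, hkc]
    have e2 : LinearMap.mulLeft ℂ (k * (b * a)) ∘ₗ LinearMap.mulRight ℂ (e i) =
        (LinearMap.mulLeft ℂ (k * b) ∘ₗ LinearMap.mulRight ℂ (e i)) ∘ₗ LinearMap.mulLeft ℂ a := by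
      ext x; simp [← mul_assoc]
    rw [e1, e2, LinearMap.trace_comp_comm']
  have h3 (j) : (inclusionMult (e i) (f j) : ℂ) * h (k * f j) =
      (blockMult B 1 (f j) : ℂ) * σ (f j) := by
    have hff : f j * f j = f j := (hf.minimal j).2.1.isIdempotentElem
    obtain ⟨c, hc⟩ := (hf.minimal j).exists_smul H.sub hk
    rw [mul_assoc, hkc, ← mul_assoc, hff, ← hkc] at hc
    rw [H.blockMult_one (hf.minimal j).1 hff, hσ, hc, inclusionMult_eq,
      blockMult_eq_trace isUnitalStarSub_top (E := LinearMap.id) (fun _ => trivial)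
      (fun _ _ => rfl) trivial trivial hff hee, LinearMap.comp_id]
    have : LinearMap.mulLeft ℂ (c • f j) = c • LinearMap.mulLeft ℂ (f j) :=
      map_smul (LinearMap.mul ℂ A) c (f j)
    rw [this, LinearMap.smul_comp, map_smul, map_smul, smul_eq_mul, smul_eq_mul]
    ring
  simp only [h3]
  rw [sum_blockMult_mul H.sub H.condExp.mem H.condExp.apply_of_mem hf
    (fun a _ b _ => hσt a b) H.sub.one_mem (IsStarProjection.one A), hσ, mul_one, ← H.regTrace_eq,
    regTrace_apply, ← trace_mulRight_eq_regTrace H.faithful.nondegenerate H.faithful.trace]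
  congr 1
  ext x
  simp only [LinearMap.comp_apply, LinearMap.mulLeft_apply, LinearMap.mulRight_apply]
  rw [← mul_assoc, hkc, mul_assoc]

lemma IsRegularExp.exists_index_smul (H : IsRegularExp B h E K) {z : A}
    (hz : IsMinProj (B ⊓ Subalgebra.toSubmodule (Subalgebra.center ℂ A)) z) :
    ∃ c : ℂ, K * z = c • z := by
  obtain ⟨c, hc⟩ := hz.exists_smul (H.sub.inf isUnitalStarSub_center)
    ⟨H.index_mem, mem_center_iff.2 H.index_comm⟩
  refine ⟨c, ?_⟩
  rw [← hc, ← H.index_comm, mul_assoc, hz.2.1.isIdempotentElem.eq]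

/-- The eigenvalue of ΛΛᵗ on a component is the value of K there. -/
lemma IsRegularExp.isMarkovTraceFor (H : IsRegularExp B h E K) {k : A} (hk : k ∈ B)
    (hkc : ∀ x, k * x = x * k) {τ : A →ₗ[ℂ] ℂ} (hτ : IsFaithfulTrace τ)
    (hτk : ∀ x, τ x = h (k * x)) : IsMarkovTraceFor B τ := by
  refine ⟨hτ, fun n m e f he hf z hz => ?_⟩
  obtain ⟨c, hc⟩ := H.exists_index_smul hz
  refine ⟨c, fun i hi => ?_⟩
  simp only [hτk]
  rw [H.sum_inclusionMult he hf hk hkc, ← hi, ← mul_assoc, ← mul_assoc, H.index_comm,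
    mul_assoc k, hc, mul_smul_comm, smul_mul_assoc, map_smul, smul_eq_mul, mul_assoc]

/-- The index is a natural number on every projection of `B ∩ Center A` on which it is scalar. -/
theorem IsRegularExp.exists_nat (H : IsRegularExp B h E K) {z : A} {r : ℂ} (hz : z ∈ B)
    (hzc : ∀ x, z * x = x * z) (hzp : IsStarProjection z) (hz0 : z ≠ 0) (hr : K * z = r • z) :
    ∃ k : ℕ, r = k := by
  obtain ⟨n, e, he⟩ := exists_isSectorSystem (A := A) isUnitalStarSub_top
  obtain ⟨m, f, hf⟩ := exists_isSectorSystem H.sub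
  have hzz : z * z = z := hzp.isIdempotentElem
  -- The integer matrix ΛΛᵗ acts on the vector h(z e i) as multiplication by r, so r preserves this
  -- nonzero finitely generated group and is an algebraic integer.
  set N : Submodule ℤ ℂ := Submodule.span ℤ (Set.range fun i => h (z * e i)) with hN
  have hint : IsIntegral ℤ r := by
    refine isIntegral_of_smul_mem_submodule N ?_ ⟨(Set.finite_range fun i => h (z * e i)).toFinset,
      by rw [Set.Finite.coe_toFinset]⟩ r ?_
    · obtain ⟨i, x, hx⟩ := he.exists_mul_ne_zero hzp hz0
      have h1 : z * e i ≠ 0 := fun h => hx (by rw [hzc, mul_assoc, h, mul_zero])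
      have h2 : 0 < h (z * e i) := H.faithful.proj_pos
        (hzp.mul_of_comm (he.minimal i).2.1 (hzc _)) h1
      rw [Submodule.ne_bot_iff]
      exact ⟨_, Submodule.subset_span ⟨i, rfl⟩, h2.ne'⟩
    · intro y hy
      induction hy using Submodule.span_induction with
      | mem y hy =>
        obtain ⟨i, rfl⟩ := hy
        have h1 := H.sum_inclusionMult he hf hz hzc i
        rw [← mul_assoc, hr, smul_mul_assoc, map_smul] at h1
        rw [← h1]
        refine Submodule.sum_mem _ fun i' _ => ?_
        have := N.smul_mem (∑ j, (inclusionMult (e i) (f j) : ℤ) * (inclusionMult (e i') (f j) : ℤ))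
          (Submodule.subset_span ⟨i', rfl⟩)
        simpa using this
      | zero => simp
      | add x y _ _ hx hy => rw [smul_add]; exact N.add_mem hx hy
      | smul c x _ hx => rw [smul_comm]; exact N.smul_mem c hx
  -- dim zA = h(Kz) = r h(z) = r dim zB, so r is also rational and nonnegative.
  have h1 := finrank_range_mulLeft hzz
  have h2 := H.finrank_map hz hzz
  rw [H.regTrace_eq, hr, map_smul, ← h2, smul_eq_mul] at h1
  have h3 : (Module.finrank ℂ (B.map (LinearMap.mulLeft ℂ z)) : ℂ) ≠ 0 := by
    rw [h2]; exact (H.faithful.proj_pos hzp hz0).ne'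
  set a := Module.finrank ℂ (LinearMap.range (LinearMap.mulLeft ℂ z))
  set b := Module.finrank ℂ (B.map (LinearMap.mulLeft ℂ z))
  have h4 : r = algebraMap ℚ ℂ (a / b : ℚ) := by
    rw [eq_div_of_mul_eq h3 h1.symm]; simp
  rw [h4, isIntegral_algebraMap_iff (algebraMap ℚ ℂ).injective,
    IsIntegrallyClosed.isIntegral_iff] at hint
  obtain ⟨c, hc⟩ := hint
  have hc0 : 0 ≤ c := by
    have : (0 : ℚ) ≤ (c : ℚ) := by
      rw [show (c : ℚ) = algebraMap ℤ ℚ c from rfl, hc]; positivity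
    exact_mod_cast this
  refine ⟨c.toNat, ?_⟩
  rw [h4, ← hc]
  have : ((c.toNat : ℤ) : ℂ) = (c : ℂ) := by rw [Int.toNat_of_nonneg hc0]
  rw [Int.cast_natCast] at this
  rw [this]; simp

end CStar

/-! ### Markov traces and Perron–Frobenius uniqueness. -/

section CStar

variable {A : Type*} [CStarAlgebra A] [FiniteDimensional ℂ A]
variable {B : Submodule ℂ A} {h : A →ₗ[ℂ] ℂ} {E : A →ₗ[ℂ] A} {K : A}

/-- Radon–Nikodym: a faithful trace is `h(k ·)` for a selfadjoint central element `k`. -/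
lemma IsFaithfulTrace.exists_density (hh : IsFaithfulTrace h) {τ : A →ₗ[ℂ] ℂ}
    (hτ : IsFaithfulTrace τ) :
    ∃ k : A, IsSelfAdjoint k ∧ (∀ x, k * x = x * k) ∧ ∀ x, τ x = h (k * x) := by
  obtain ⟨n, a, b, h1, h2, h3⟩ := exists_dual_bases hh.nondegenerate
  set k := ∑ i, τ (a i) • b i
  have hk (x : A) : τ x = h (k * x) := by
    conv_lhs => rw [← h1 x]
    simp [k, Finset.sum_mul, mul_comm]
  refine ⟨k, ?_, fun x => ?_, hk⟩
  · rw [IsSelfAdjoint, ← sub_eq_zero]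
    refine hh.nondegenerate _ fun y => ?_
    rw [sub_mul, map_sub, sub_eq_zero]
    have : star k * y = star (star y * k) := by rw [star_mul, star_star]
    rw [this, hh.map_star, hh.trace, ← hk, ← hk, hτ.map_star, star_star]
  · rw [← sub_eq_zero]
    refine hh.nondegenerate _ fun y => ?_
    rw [sub_mul, map_sub, sub_eq_zero, mul_assoc, ← hk, hτ.trace, hk, mul_assoc x k, hh.trace x,
      mul_assoc]

/-- A central projection that cuts each member of a sector system of `B` trivially lies in `B`. -/
lemma mem_of_sectorSystem (hB : IsUnitalStarSub B) {m : ℕ} {f : Fin m → A}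
    (hf : IsSectorSystem B f) {q : A} (hqc : ∀ x, q * x = x * q)
    (h : ∀ j, f j * q = 0 ∨ f j * q = f j) : q ∈ B := by
  have key : (1 : A) * q ∈ B := by
    refine proj_induction (B := B) (P := fun g => g * q ∈ B) (by simp) ?_ ?_ hB.one_mem
      (IsStarProjection.one A)
    · intro a _ p _ _ _ ha hp
      rw [add_mul]; exact B.add_mem ha hp
    · intro p hp
      obtain ⟨j, x, hx, hne⟩ := hf.exhaustive p hp
      obtain ⟨v, hvB, c, hc, hvv, -, -, hve, -⟩ := hp.equiv hB (hf.minimal j) hx hne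
      have hpc : c • (p * q) = v * (f j * q) * star v := by
        rw [← smul_mul_assoc, ← hvv, ← mul_assoc v, hve, mul_assoc, mul_assoc, hqc]
      have hpc' : p * q = c⁻¹ • (v * (f j * q) * star v) := by
        rw [← hpc, smul_smul, inv_mul_cancel₀ hc, one_smul]
      rw [hpc']
      refine B.smul_mem _ (hB.mul_mem _ (hB.mul_mem _ hvB _ ?_) _ (hB.star_mem _ hvB))
      rcases h j with h | h <;> rw [h]
      · exact B.zero_mem
      · exact (hf.minimal j).1
  rwa [one_mul] at key

/-- The Perron–Frobenius argument: a Markov trace is a scalar multiple of `h` on every connected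
component of the inclusion. -/
lemma IsRegularExp.density_mul_component (H : IsRegularExp B h E K) {τ : A →ₗ[ℂ] ℂ}
    (hτ : IsMarkovTraceFor B τ) {k : A} (hk : IsSelfAdjoint k) (hkc : ∀ x, k * x = x * k)
    (hτk : ∀ x, τ x = h (k * x)) {z : A}
    (hz : IsMinProj (B ⊓ Subalgebra.toSubmodule (Subalgebra.center ℂ A)) z) :
    ∃ c : ℂ, k * z = c • z := by
  classical
  obtain ⟨n, e, he⟩ := exists_isSectorSystem (A := A) isUnitalStarSub_top
  obtain ⟨m, f, hf⟩ := exists_isSectorSystem H.sub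
  have hzc : ∀ x, z * x = x * z := mem_center_iff.1 hz.1.2
  have hzB : z ∈ B := hz.1.1
  have hzz : z * z = z := hz.2.1.isIdempotentElem
  have hee (i) : e i * e i = e i := (he.minimal i).2.1.isIdempotentElem
  have he0 (i) : e i ≠ 0 := (he.minimal i).2.2.1
  obtain ⟨κ, hκ⟩ := H.exists_index_smul hz
  obtain ⟨r, hr⟩ := hτ.perron_frobenius n m e f he hf z hz
  set M : Fin n → Fin n → ℂ :=
    fun i i' => ∑ j, (inclusionMult (e i) (f j) : ℂ) * (inclusionMult (e i') (f j) : ℂ) with hM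
  have hMsymm (i i') : M i i' = M i' i := by simp only [hM, mul_comm]
  have hze (i) : z * e i = 0 ∨ z * e i = e i := isCompl_mem (he.minimal i) hz.2.1 trivial hzc
  have hzf (j) : z * f j = 0 ∨ z * f j = f j :=
    isCompl_mem (hf.minimal j) hz.2.1 (H.sub.mul_mem _ hzB _ (hf.minimal j).1) hzc
  have hhe (i) : 0 < h (e i) := H.faithful.proj_pos (he.minimal i).2.1 (he0 i)
  have hτe (i) : 0 < τ (e i) := hτ.isFaithfulTrace.proj_pos (he.minimal i).2.1 (he0 i)
  have hke : ∀ i, ∃ c : ℂ, k * e i = c • e i := fun i => by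
    obtain ⟨c, hc⟩ := (he.minimal i).exists_smul isUnitalStarSub_top (b := k) trivial
    exact ⟨c, by rw [← hc, ← hkc, mul_assoc, hee]⟩
  choose d hd using hke
  have hτd (i) : τ (e i) = d i * h (e i) := by rw [hτk, hd, map_smul, smul_eq_mul]
  have hdpos (i) : 0 < d i := by
    have := div_pos (hτe i) (hhe i)
    rwa [hτd, mul_div_cancel_right₀ _ (hhe i).ne'] at this
  obtain ⟨i₁, hi₁⟩ : ∃ i, z * e i = e i := by
    obtain ⟨i, x, hx⟩ := he.exists_mul_ne_zero hz.2.1 hz.2.2.1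
    refine ⟨i, (hze i).resolve_left fun h => hx ?_⟩
    rw [hzc, mul_assoc, h, mul_zero]
  have hb (i) : ∑ i', M i i' * h (z * e i') = κ * h (z * e i) := by
    rw [H.sum_inclusionMult he hf hzB hzc, ← mul_assoc, hκ, smul_mul_assoc, map_smul, smul_eq_mul]
  have hb1 (i) (hi : z * e i = e i) : ∑ i', M i i' * h (e i') = κ * h (e i) := by
    have := H.sum_inclusionMult he hf H.sub.one_mem (by simp) i
    simp only [one_mul] at this
    rw [this, ← hi, ← mul_assoc, hκ, smul_mul_assoc, map_smul, smul_eq_mul]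
  have hz0 (i) : 0 ≤ h (z * e i) := by
    rcases hze i with h0 | h0 <;> rw [h0]
    · simp
    · exact (hhe i).le
  -- M is symmetric, so eigenvectors for different eigenvalues are orthogonal; the nonnegative
  -- vectors of h(z ·) and τ have a positive pairing.
  have hrκ : r = κ := by
    have e1 : ∑ i, h (z * e i) * ∑ i', M i i' * τ (e i') = r * ∑ i, h (z * e i) * τ (e i) := by
      rw [Finset.mul_sum]
      refine Finset.sum_congr rfl fun i _ => ?_
      rcases hze i with h0 | h0
      · simp [h0]
      · rw [hr i h0]; ring
    have e2 : ∑ i, h (z * e i) * ∑ i', M i i' * τ (e i') = κ * ∑ i, h (z * e i) * τ (e i) := by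
      simp only [Finset.mul_sum]
      rw [Finset.sum_comm]
      refine Finset.sum_congr rfl fun i _ => ?_
      have : ∑ x, h (z * e x) * (M x i * τ (e i)) = (∑ x, M i x * h (z * e x)) * τ (e i) := by
        rw [Finset.sum_mul]
        exact Finset.sum_congr rfl fun x _ => by rw [hMsymm i x]; ring
      rw [this, hb]; ring
    refine mul_right_cancel₀ ?_ (e1.symm.trans e2)
    refine (Finset.sum_pos' (fun i _ => mul_nonneg (hz0 i) (hτe i).le)
      ⟨i₁, Finset.mem_univ _, ?_⟩).ne'
    rw [hi₁]; exact mul_pos (hhe i₁) (hτe i₁)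
  -- c is the least ratio τ(e i)/h(e i) on the component; the sectors attaining it will turn out to
  -- fill the component.
  obtain ⟨i₀, hi₀, hmin⟩ := Finset.exists_min_image
    (Finset.univ.filter fun i => z * e i = e i) (fun i => (d i).re)
    ⟨i₁, by simpa using hi₁⟩
  simp only [Finset.mem_filter, Finset.mem_univ, true_and] at hi₀ hmin
  set c := d i₀ with hc
  have hcd (i) (hi : z * e i = e i) : c ≤ d i := by
    rw [Complex.le_def]
    exact ⟨hmin i hi, by rw [← (Complex.lt_def.1 (hdpos i₀)).2, ← (Complex.lt_def.1 (hdpos i)).2]⟩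
  have hΛf (i j) (hi : z * e i = e i) (h0 : inclusionMult (e i) (f j) ≠ 0) : z * f j = f j := by
    refine (hzf j).resolve_left fun h1 => ?_
    rw [inclusionMult_eq, blockMult_top_ne_zero] at h0
    obtain ⟨x, hx⟩ := h0
    refine hx ?_
    rw [← hi, ← mul_assoc, mul_assoc (f j) x z, ← hzc, ← mul_assoc (f j), ← hzc, h1, zero_mul,
      zero_mul]
  have hΛe (i j) (hj : z * f j = f j) (h0 : inclusionMult (e i) (f j) ≠ 0) : z * e i = e i := by
    refine (hze i).resolve_left fun h1 => ?_
    rw [inclusionMult_eq, blockMult_top_ne_zero] at h0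
    obtain ⟨x, hx⟩ := h0
    refine hx ?_
    rw [← hj, mul_assoc, mul_assoc, hzc, mul_assoc, mul_assoc, ← hzc, h1, mul_zero, mul_zero]
  -- At a sector attaining the minimum, ∑ M i i' (d i' − c) h(e i') = 0 has nonnegative terms, so
  -- every sector adjacent through some f j attains it too.
  have hclosed (i i' j) (hi : z * e i = e i) (hic : d i = c)
      (h1 : inclusionMult (e i) (f j) ≠ 0) (h2 : inclusionMult (e i') (f j) ≠ 0) :
      z * e i' = e i' ∧ d i' = c := by
    have hMz (i') (h3 : z * e i' ≠ e i') : M i i' = 0 := by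
      refine Finset.sum_eq_zero fun j _ => ?_
      by_contra hne
      have h4 := mul_ne_zero_iff.1 hne
      exact h3 (hΛe i' j (hΛf i j hi (by exact_mod_cast h4.1)) (by exact_mod_cast h4.2))
    have hM0 (i') : 0 ≤ M i i' := Finset.sum_nonneg fun j _ => by positivity
    have hsum : ∑ i', M i i' * ((d i' - c) * h (e i')) = 0 := by
      have e1 := hr i hi
      have e2 := hb1 i hi
      have e3 : ∑ i', M i i' * ((d i' - c) * h (e i')) =
          ∑ i', M i i' * τ (e i') - c * ∑ i', M i i' * h (e i') := by
        rw [Finset.mul_sum, ← Finset.sum_sub_distrib]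
        exact Finset.sum_congr rfl fun i' _ => by rw [hτd]; ring
      rw [e3, e1, e2, hτd, hic, hrκ]; ring
    have hterm := (Finset.sum_eq_zero_iff_of_nonneg fun i' _ => by
      by_cases h3 : z * e i' = e i'
      · exact mul_nonneg (hM0 i') (mul_nonneg (sub_nonneg.2 (hcd i' h3)) (hhe i').le)
      · rw [hMz i' h3, zero_mul]).1 hsum i' (Finset.mem_univ _)
    have hMne : M i i' ≠ 0 := by
      refine (Finset.sum_pos' (fun j _ => by positivity) ⟨j, Finset.mem_univ _, ?_⟩).ne'
      have h1' : (0 : ℂ) < (inclusionMult (e i) (f j) : ℂ) := by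
        exact_mod_cast Nat.pos_of_ne_zero h1
      have h2' : (0 : ℂ) < (inclusionMult (e i') (f j) : ℂ) := by
        exact_mod_cast Nat.pos_of_ne_zero h2
      exact mul_pos h1' h2'
    have h3 := (mul_eq_zero.1 hterm).resolve_left hMne
    exact ⟨by_contra fun h4 => hMne (hMz i' h4),
      sub_eq_zero.1 ((mul_eq_zero.1 h3).resolve_right (hhe i').ne')⟩
  obtain ⟨q, hqC, hq, hqk⟩ := exists_spectral_projection isUnitalStarSub_center
    (mem_center_iff.2 hkc) hk c
  have hqc : ∀ x, q * x = x * q := mem_center_iff.1 hqC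
  have hkq : k * q = c • q := (hqk q).1 hq.isIdempotentElem
  have hp : IsStarProjection (q * z) := hq.mul_of_comm hz.2.1 (hqc z)
  have hpc (x : A) : q * z * x = x * (q * z) := by
    rw [mul_assoc, hzc, ← mul_assoc, hqc, mul_assoc]
  have hpe (i) : z * e i = e i → d i = c → q * z * e i = e i := fun h1 h2 => by
    rw [mul_assoc, h1]; exact (hqk _).2 (by rw [hd, h2])
  have hpe' (i) (hne : q * z * e i ≠ 0) : z * e i = e i ∧ d i = c := by
    have h1 : z * e i = e i := (hze i).resolve_left fun h => hne (by rw [mul_assoc, h, mul_zero])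
    refine ⟨h1, ?_⟩
    rw [mul_assoc, h1] at hne
    have : c • (q * e i) = d i • (q * e i) := by
      rw [← smul_mul_assoc, ← hkq, mul_assoc, hkc, mul_assoc, ← hkc, hd, mul_smul_comm]
    exact (smul_left_injective ℂ hne this).symm
  -- qz collects the sectors of the component where k = c. By closedness under adjacency each f j
  -- lies under qz or is orthogonal to it, so qz ∈ B, and minimality of z forces qz = z.
  have hpB : q * z ∈ B := by
    refine mem_of_sectorSystem H.sub hf hpc fun j => ?_
    have hfp := (hf.minimal j).2.1
    have hΛ (i) (x y : A) (hx : f j * x * y * e i ≠ 0) : inclusionMult (e i) (f j) ≠ 0 := by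
      rw [inclusionMult_eq, blockMult_top_ne_zero]
      exact ⟨x * y, by rwa [← mul_assoc]⟩
    by_cases hex : ∃ i, z * e i = e i ∧ d i = c ∧ inclusionMult (e i) (f j) ≠ 0
    · right
      obtain ⟨i, h1, h2, h3⟩ := hex
      by_contra hne
      have hsub : IsStarProjection (f j - f j * (q * z)) := by
        refine hfp.sub_of_mul_eq (hfp.mul_of_comm hp (hpc _).symm) ?_
        rw [mul_assoc, hpc, ← mul_assoc, hfp.isIdempotentElem.eq]
      obtain ⟨i', x, hx⟩ := he.exists_mul_ne_zero hsub (sub_ne_zero.2 (Ne.symm hne))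
      have e1 : f j - f j * (q * z) = f j * (1 - q * z) := by rw [mul_sub, mul_one]
      rw [e1] at hx
      obtain ⟨h4, h5⟩ := hclosed i i' j h1 h2 h3 (hΛ i' _ _ hx)
      refine hx ?_
      have e2 : (1 - q * z) * (x * e i') = 0 := by
        rw [sub_mul, one_mul, ← mul_assoc, hpc, mul_assoc, hpe i' h4 h5, sub_self]
      rw [mul_assoc, mul_assoc, e2, mul_zero]
    · left
      by_contra hne
      obtain ⟨i', x, hx⟩ := he.exists_mul_ne_zero (hfp.mul_of_comm hp (hpc _).symm) hne
      have h1 : q * z * e i' ≠ 0 := fun h0 => hx (by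
        rw [mul_assoc (f j), hpc, mul_assoc (f j), mul_assoc x, h0, mul_zero, mul_zero])
      obtain ⟨h2, h3⟩ := hpe' i' h1
      exact hex ⟨i', h2, h3, hΛ i' _ _ hx⟩
  rcases hz.2.2.2 (q * z) ⟨hpB, mem_center_iff.2 hpc⟩ hp (by rw [mul_assoc, hzz]) with h0 | h0
  · exact absurd (hpe i₀ hi₀ rfl) (by rw [h0, zero_mul]; exact (he0 i₀).symm)
  · refine ⟨c, ?_⟩
    rw [← h0, ← mul_assoc, hkq, smul_mul_assoc]

theorem IsRegularExp.density_mem (H : IsRegularExp B h E K) {τ : A →ₗ[ℂ] ℂ}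
    (hτ : IsMarkovTraceFor B τ) {k : A} (hk : IsSelfAdjoint k) (hkc : ∀ x, k * x = x * k)
    (hτk : ∀ x, τ x = h (k * x)) : k ∈ B := by
  have key : k * 1 ∈ B := by
    refine proj_induction (B := B ⊓ Subalgebra.toSubmodule (Subalgebra.center ℂ A))
      (P := fun g => k * g ∈ B) (by simp) ?_ ?_ ⟨H.sub.one_mem, isUnitalStarSub_center.one_mem⟩
      (IsStarProjection.one A)
    · intro a _ p _ _ _ ha hp
      rw [mul_add]; exact B.add_mem ha hp
    · intro z hz
      obtain ⟨c, hc⟩ := H.density_mul_component hτ hk hkc hτk hz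
      rw [hc]; exact B.smul_mem _ hz.1.1
  rwa [mul_one] at key

/-- The unit is an orthogonal sum of minimal projections. -/
lemma exists_minProj_family {B : Submodule ℂ A} (hB : IsUnitalStarSub B) :
    ∃ s : Finset A, (∀ p ∈ s, IsMinProj B p) ∧ (∀ p ∈ s, ∀ q ∈ s, p ≠ q → p * q = 0) ∧
      ∑ p ∈ s, p = 1 := by
  classical
  refine proj_induction (B := B) (P := fun g => ∃ s : Finset A, (∀ p ∈ s, IsMinProj B p) ∧
    (∀ p ∈ s, ∀ q ∈ s, p ≠ q → p * q = 0) ∧ ∑ p ∈ s, p = g) ⟨∅, by simp⟩ ?_ ?_ hB.one_mem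
    (IsStarProjection.one A)
  · rintro a - p ha hp hap ⟨s, hs, ho, rfl⟩ -
    have h1 (q) (hq : q ∈ s) : q * p = 0 := by
      have : q * ((∑ p ∈ s, p) * p) = q * p := by
        rw [← mul_assoc, Finset.mul_sum, Finset.sum_eq_single q (fun r hr hrq => ho q hq r hr hrq.symm)
          (fun h => absurd hq h), (hs q hq).2.1.isIdempotentElem.eq]
      rw [← this, hap, mul_zero]
    have h2 (q) (hq : q ∈ s) : p * q = 0 := by
      have := congrArg star (h1 q hq)
      rwa [star_mul, hp.2.1.isSelfAdjoint.star_eq, (hs q hq).2.1.isSelfAdjoint.star_eq,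
        star_zero] at this
    have hps : p ∉ s := fun h => hp.2.2.1 (by rw [← hp.2.1.isIdempotentElem.eq, h1 p h])
    refine ⟨insert p s, ?_, ?_, by rw [Finset.sum_insert hps, add_comm]⟩
    · intro q hq
      rcases Finset.mem_insert.1 hq with rfl | hq
      · exact hp
      · exact hs q hq
    · intro q hq r hr hqr
      rcases Finset.mem_insert.1 hq with hq' | hq' <;> rcases Finset.mem_insert.1 hr with hr' | hr'
      · exact absurd (hq'.trans hr'.symm) hqr
      · rw [hq']; exact h2 r hr'
      · rw [hr']; exact h1 q hq'
      · exact ho q hq' r hr' hqr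
  · intro p hp
    exact ⟨{p}, by simpa using hp, by simp +contextual, by simp⟩

/-- Positive densities in a central *-subalgebra preserve faithful traces. -/
lemma IsFaithfulTrace.comp_sum (hh : IsFaithfulTrace h) {C : Submodule ℂ A}
    (hCc : ∀ x ∈ C, ∀ y, x * y = y * x) {s : Finset A} (hs : ∀ p ∈ s, IsMinProj C p)
    (h1 : ∑ p ∈ s, p = 1) {c : A → ℂ} (hc : ∀ p ∈ s, 0 < c p) :
    IsFaithfulTrace (h ∘ₗ LinearMap.mulLeft ℂ (∑ p ∈ s, c p • p)) := by
  have hk : ∑ p ∈ s, c p • p ∈ C := C.sum_mem fun p hp => C.smul_mem _ (hs p hp).1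
  refine ⟨fun x y => ?_, fun x hx => ?_⟩
  · simp only [LinearMap.comp_apply, LinearMap.mulLeft_apply]
    rw [← mul_assoc, hCc _ hk x, mul_assoc, hh.trace, mul_assoc]
  · simp only [LinearMap.comp_apply, LinearMap.mulLeft_apply, Finset.sum_mul, map_sum,
      smul_mul_assoc, map_smul, smul_eq_mul]
    have h2 (p) (hp : p ∈ s) : p * (star x * x) = star (p * x) * (p * x) := by
      rw [star_mul, (hs p hp).2.1.isSelfAdjoint.star_eq, hCc p (hs p hp).1, mul_assoc, mul_assoc,
        ← mul_assoc p p, (hs p hp).2.1.isIdempotentElem.eq, hCc p (hs p hp).1 x]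
    have h3 (p) (hp : p ∈ s) : 0 ≤ h (p * (star x * x)) := by
      rw [h2 p hp]
      by_cases h0 : p * x = 0
      · simp [h0]
      · exact (hh.faithful _ h0).le
    obtain ⟨p, hp, hpx⟩ : ∃ p ∈ s, p * x ≠ 0 := by
      by_contra! hcon
      refine hx ?_
      rw [← one_mul x, ← h1, Finset.sum_mul, Finset.sum_eq_zero hcon]
    refine Finset.sum_pos' (fun p hp => mul_nonneg (hc p hp).le (h3 p hp))
      ⟨p, hp, mul_pos (hc p hp) ?_⟩
    rw [h2 p hp]
    exact hh.faithful _ hpx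

/-- A density in a central *-subalgebra that normalizes a trace on every minimal projection. -/
lemma IsFaithfulTrace.exists_normalized (hh : IsFaithfulTrace h) {C : Submodule ℂ A}
    (hC : IsUnitalStarSub C) (hCc : ∀ x ∈ C, ∀ y, x * y = y * x) :
    ∃ k ∈ C, IsFaithfulTrace (h ∘ₗ LinearMap.mulLeft ℂ k) ∧
      ∀ p, IsMinProj C p → h (k * p) = 1 := by
  classical
  obtain ⟨s, hs, ho, h1⟩ := exists_minProj_family hC
  have hpos (p) (hp : p ∈ s) : 0 < h p := hh.proj_pos (hs p hp).2.1 (hs p hp).2.2.1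
  refine ⟨∑ p ∈ s, (h p)⁻¹ • p, C.sum_mem fun p hp => C.smul_mem _ (hs p hp).1,
    hh.comp_sum hCc hs h1 fun p hp => inv_pos.2 (hpos p hp), fun p hp => ?_⟩
  obtain ⟨q, hq, hqp⟩ : ∃ q ∈ s, q * p ≠ 0 := by
    by_contra! hcon
    refine hp.2.2.1 ?_
    rw [← one_mul p, ← h1, Finset.sum_mul, Finset.sum_eq_zero hcon]
  have e1 := (isCompl_mem hp (hs q hq).2.1 (hC.mul_mem _ (hs q hq).1 _ hp.1)
    (hCc q (hs q hq).1)).resolve_left hqp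
  have e2 := (isCompl_mem (hs q hq) hp.2.1 (hC.mul_mem _ hp.1 _ (hs q hq).1)
    (hCc p hp.1)).resolve_left (by rwa [hCc p hp.1])
  have e3 : p = q := by rw [← e1, ← hCc p hp.1, e2]
  subst e3
  have : (∑ p ∈ s, (h p)⁻¹ • p) * p = (h p)⁻¹ • p := by
    rw [Finset.sum_mul, Finset.sum_eq_single p]
    · rw [smul_mul_assoc, hp.2.1.isIdempotentElem.eq]
    · intro r hr hrp; rw [smul_mul_assoc, ho r hr p hq hrp, smul_zero]
    · exact fun h => absurd hq h
  rw [this, map_smul, smul_eq_mul, inv_mul_cancel₀ (hpos p hq).ne']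

end CStar

/-! ### Positivity of expectations and of slices. -/

section Positivity

variable {A : Type*} [CStarAlgebra A] [FiniteDimensional ℂ A]

/-- A conditional expectation preserving a faithful trace is positive. -/
lemma exists_star_mul_self_of_preserving {B : Submodule ℂ A} (hB : IsUnitalStarSub B)
    {h : A →ₗ[ℂ] ℂ} (hh : IsFaithfulTrace h) {E : A →ₗ[ℂ] A} (hE : ∀ x, E x ∈ B)
    (hpres : ∀ b ∈ B, ∀ x, h (b * E x) = h (b * x)) (x : A) :
    ∃ y, E (star x * x) = star y * y := by
  have hsub (b) (hb : b ∈ B) (h0 : ∀ c ∈ B, h (c * b) = 0) : b = 0 := by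
    by_contra hne
    exact (hh.faithful b hne).ne' (h0 _ (hB.star_mem b hb))
  have hstar (y : A) : E (star y) = star (E y) := by
    rw [← sub_eq_zero]
    refine hsub _ (B.sub_mem (hE _) (hB.star_mem _ (hE y))) fun c hc => ?_
    rw [mul_sub, map_sub, hpres c hc, sub_eq_zero]
    have e (z : A) : h (c * star z) = star (h (star c * z)) := by
      rw [← hh.map_star, star_mul, star_star, hh.trace]
    rw [e, e, hpres _ (hB.star_mem c hc)]
  set b := E (star x * x) with hb
  have hsa : IsSelfAdjoint b := by
    rw [IsSelfAdjoint, hb, ← hstar, star_mul, star_star]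
  let _ := CStarAlgebra.spectralOrder A
  have _ := CStarAlgebra.spectralOrderedRing A
  have hnn : 0 ≤ b := by
    rw [StarOrderedRing.nonneg_iff_spectrum_nonneg (R := ℂ) b hsa.isStarNormal]
    intro c hc
    obtain ⟨y, hy, hby⟩ := mem_spectrum_iff_exists.1 hc
    -- The spectral projection lies in B, so preservation gives c h(q) = h(q x*x) ≥ 0, whence c ≥ 0.
    obtain ⟨q, hq, hqp, hqx⟩ := exists_spectral_projection hB (hE _) hsa c
    have hq0 : q ≠ 0 := by
      rintro rfl
      exact hy (by rw [← (hqx y).2 hby, zero_mul])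
    have hbq : b * q = c • q := (hqx q).1 hqp.isIdempotentElem.eq
    have e1 : h (q * (star x * x)) = c * h q := by
      rw [← hpres q hq, hh.trace, ← hb, hbq, map_smul, smul_eq_mul]
    have e2 : h (q * (star x * x)) = h (star (x * q) * (x * q)) := by
      rw [star_mul, hqp.isSelfAdjoint.star_eq]
      conv_lhs => rw [← hqp.isIdempotentElem.eq, mul_assoc, hh.trace]
      simp only [mul_assoc]
    have e3 : 0 ≤ c * h q := by
      rw [← e1, e2]
      by_cases h0 : x * q = 0
      · simp [h0]
      · exact (hh.faithful _ h0).le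
    have e4 := hh.proj_pos hqp hq0
    have e5 := mul_nonneg e3 (inv_pos.2 e4).le
    rwa [mul_assoc, mul_inv_cancel₀ e4.ne', mul_one] at e5
  obtain ⟨y, hy⟩ := CStarAlgebra.nonneg_iff_eq_star_mul_self.1 hnn
  exact ⟨y, hy⟩

omit [FiniteDimensional ℂ A] in
/-- Slices of positive elements by faithful traces are positive. -/
lemma exists_slice_eq_sum {t : A →ₗ[ℂ] ℂ} (ht : IsFaithfulTrace t) (T : A ⊗[ℂ] A) :
    ∃ (n : ℕ) (w : Fin n → A), TensorProduct.rid ℂ A (LinearMap.lTensor A t (star T * T)) =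
      ∑ i, star (w i) * w i := by
  obtain ⟨n, a, b, rfl⟩ : ∃ (n : ℕ) (a b : Fin n → A), T = ∑ i, a i ⊗ₜ[ℂ] b i := by
    obtain ⟨n, a, b, hs⟩ := TensorProduct.exists_sum_tmul_eq T
    exact ⟨n, a, b, hs⟩
  -- The slice is ∑ aᵢ* aⱼ weighted by this Gram matrix; splitting the matrix into rank one terms
  -- exhibits the sum of squares.
  have hG : (Matrix.of fun i j => t (star (b i) * b j)).PosSemidef := by
    refine Matrix.PosSemidef.of_dotProduct_mulVec_nonneg ?_ fun x => ?_
    · ext i j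
      simp only [Matrix.conjTranspose_apply, Matrix.of_apply]
      rw [← ht.map_star, star_mul, star_star]
    · have : star x ⬝ᵥ (Matrix.of fun i j => t (star (b i) * b j)).mulVec x =
          t (star (∑ i, x i • b i) * ∑ i, x i • b i) := by
        simp only [dotProduct, Matrix.mulVec, Matrix.of_apply, star_sum, star_smul,
          Finset.sum_mul, Finset.mul_sum, map_sum, smul_mul_assoc, mul_smul_comm, map_smul,
          smul_eq_mul, Pi.star_apply]
        rw [Finset.sum_comm]
        refine Finset.sum_congr rfl fun i _ => Finset.sum_congr rfl fun j _ => by ring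
      rw [this]
      by_cases h0 : ∑ i, x i • b i = 0
      · simp [h0]
      · exact (ht.faithful _ h0).le
  obtain ⟨m, v, hv⟩ := Matrix.posSemidef_iff_eq_sum_vecMulVec.1 hG
  have hv' (i j) : t (star (b i) * b j) = ∑ k, v k i * star (v k j) := by
    have := congrFun (congrFun hv i) j
    simpa [Matrix.sum_apply, Matrix.vecMulVec_apply] using this
  refine ⟨m, fun k => ∑ j, star (v k j) • a j, ?_⟩
  simp only [star_sum, TensorProduct.star_tmul, star_smul, star_star, Finset.sum_mul,
    Finset.mul_sum, Algebra.TensorProduct.tmul_mul_tmul, map_sum, LinearMap.lTensor_tmul,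
    TensorProduct.rid_tmul, hv', Finset.sum_smul, smul_mul_assoc, mul_smul_comm]
  rw [Finset.sum_comm]
  conv_rhs => rw [Finset.sum_comm]
  rw [Finset.sum_comm]
  refine Finset.sum_congr rfl fun i _ => ?_
  rw [Finset.sum_comm]
  refine Finset.sum_congr rfl fun k _ => ?_
  rw [Finset.smul_sum]
  refine Finset.sum_congr rfl fun j _ => ?_
  rw [smul_smul, mul_comm]

end Positivity

/-! ### Construction of the Haar functional of a weak Kac algebra. -/

section CStar

variable {A : Type*} [CStarAlgebra A] [Coalgebra ℂ A] [WeakKacAlgebra A]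

lemma star_comul_one : star (Δ (1 : A)) = Δ 1 := by
  rw [← WeakKacAlgebra.comul_star, star_one]

lemma isUnitalStarSub_left : IsUnitalStarSub (leftSub A) where
  one_mem := one_mem_left
  mul_mem _ hx _ hy := mul_mem_left hx hy
  star_mem x hx := by
    refine mem_left_of_comul ?_
    rw [WeakKacAlgebra.comul_star, comul_of_mem_left hx, star_mul, star_comul_one,
      TensorProduct.star_tmul, star_one]

lemma isUnitalStarSub_right : IsUnitalStarSub (rightSub A) where
  one_mem := one_mem_right
  mul_mem _ hx _ hy := mul_mem_right hx hy
  star_mem x hx := by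
    refine mem_right_of_comul ?_
    rw [WeakKacAlgebra.comul_star, comul_of_mem_right hx, star_mul, star_comul_one,
      TensorProduct.star_tmul, star_one]

lemma isUnitalStarSub_hypercenter : IsUnitalStarSub (hypercenter A) :=
  (isUnitalStarSub_left.inf isUnitalStarSub_right).inf isUnitalStarSub_center

lemma hypercenter_comm {x : A} (hx : x ∈ hypercenter A) (y : A) : x * y = y * x :=
  mem_center_iff.1 hx.2 y

lemma antip_antip (x : A) : antip (antip x) = x := WeakKacAlgebra.antipode_antipode x

/-- S reverses the coproduct; this transports every statement about E^L to E^R. -/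
lemma haarER_eq (φ : A →ₗ[ℂ] ℂ) (x : A) :
    haarER (φ ∘ₗ antip) x = antip (haarEL φ (antip x)) := by
  simp only [haarEL, haarER, LinearMap.comp_apply, LinearEquiv.coe_coe]
  rw [comul_antip, ← (ℛ ℂ x).eq]
  simp [antip_antip]

variable [FiniteDimensional ℂ A]

/-- Central minimal projections are eigenvectors of central elements. -/
lemma exists_smul_of_isMinProj {B : Submodule ℂ A} (hB : IsUnitalStarSub B) {p k : A}
    (hp : IsMinProj B p) (hk : k ∈ B) (hkc : ∀ x, k * x = x * k) : ∃ c : ℂ, k * p = c • p := by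
  obtain ⟨c, hc⟩ := hp.exists_smul hB hk
  refine ⟨c, ?_⟩
  rw [← hc, ← hkc p, mul_assoc, hp.2.1.isIdempotentElem.eq]

lemma haarEL_regTrace_left {x : A} (hx : x ∈ leftSub A) : haarEL regTrace x = haarIndex * x := by
  rw [haarIndex, ← haarEL_mul_left _ hx, one_mul]

/-- The Haar index is positive on every minimal hypercentral projection. -/
lemma haarIndex_pos {p : A} (hp : IsMinProj (hypercenter A) p) :
    ∃ c : ℂ, 0 < c ∧ haarIndex * p = c • p := by
  obtain ⟨c, hc⟩ := exists_smul_of_isMinProj isUnitalStarSub_hypercenter hp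
    (haarIndex_mem antip_antip) (haarIndex_comm antip_antip)
  refine ⟨c, ?_, hc⟩
  have ht : IsFaithfulTrace (regTrace : A →ₗ[ℂ] ℂ) := isFaithfulTrace_regTrace
  have hpos := ht.proj_pos hp.2.1 hp.2.2.1
  -- The index is the slice of Δ(1) = Δ(1)*Δ(1) by χ, hence a sum of squares and so nonnegative on
  -- p.
  obtain ⟨n, w, hw⟩ := exists_slice_eq_sum ht (Δ (1 : A))
  rw [star_comul_one, comul_one_mul] at hw
  have hK : haarIndex = ∑ i, star (w i) * w i := hw
  have e1 : regTrace (haarIndex * p) = c * regTrace p := by rw [hc, map_smul, smul_eq_mul]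
  have e2 : 0 ≤ c * regTrace p := by
    rw [← e1, hK, Finset.sum_mul, map_sum]
    refine Finset.sum_nonneg fun i _ => ?_
    have : regTrace (star (w i) * w i * p) = regTrace (star (w i * p) * (w i * p)) := by
      rw [star_mul, hp.2.1.isSelfAdjoint.star_eq]
      conv_lhs => rw [← hp.2.1.isIdempotentElem.eq, ← mul_assoc, ht.trace]
      simp only [mul_assoc]
    rw [this]
    by_cases h0 : w i * p = 0
    · simp [h0]
    · exact (ht.faithful _ h0).le
  have e3 : 0 ≤ c := by
    have := mul_nonneg e2 (inv_pos.2 hpos).le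
    rwa [mul_assoc, mul_inv_cancel₀ hpos.ne', mul_one] at this
  -- If c = 0, slicing Δ(p) by χ gives `haarIndex` * p = 0, and the counit of that slice is χ(p) >
  -- 0.
  refine lt_of_le_of_ne e3 fun h0 => hpos.ne' ?_
  rw [← counit_haarEL, haarEL_regTrace_left hp.1.1.1, hc, ← h0, zero_smul, map_zero]

/-- The Haar index has an inverse `k` in the hypercenter, and the regular trace with density `k`
is a faithful trace. -/
lemma exists_haarIndex_inv : ∃ k ∈ hypercenter A, k * haarIndex = 1 ∧
    IsFaithfulTrace (regTrace ∘ₗ LinearMap.mulLeft ℂ k : A →ₗ[ℂ] ℂ) := by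
  classical
  obtain ⟨s, hs, ho, h1⟩ := exists_minProj_family (isUnitalStarSub_hypercenter (A := A))
  have hc (p : A) : ∃ c : ℂ, p ∈ s → 0 < c ∧ haarIndex * p = c • p := by
    by_cases hp : p ∈ s
    · obtain ⟨c, hc⟩ := haarIndex_pos (hs p hp)
      exact ⟨c, fun _ => hc⟩
    · exact ⟨0, fun h => absurd h hp⟩
  choose c hc using hc
  refine ⟨∑ p ∈ s, (c p)⁻¹ • p, Submodule.sum_mem _ fun p hp => Submodule.smul_mem _ _ (hs p hp).1,
    ?_, isFaithfulTrace_regTrace.comp_sum (fun x hx => hypercenter_comm hx) hs h1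
      fun p hp => inv_pos.2 (hc p hp).1⟩
  rw [← h1, Finset.sum_mul]
  refine Finset.sum_congr rfl fun p hp => ?_
  rw [smul_mul_assoc, ← haarIndex_comm antip_antip, (hc p hp).2, smul_smul,
    inv_mul_cancel₀ (hc p hp).1.ne', one_smul]

/-- The Haar functional exists; its conditional expectations are regular, with index the Haar
index. -/
theorem exists_isHaarFunctional : ∃ h : A →ₗ[ℂ] ℂ, IsHaarFunctional h ∧
    IsRegularExp (leftSub A) h (haarEL h) haarIndex ∧
    IsRegularExp (rightSub A) h (haarER h) haarIndex := by
  obtain ⟨k, hk, hkK, hh⟩ := exists_haarIndex_inv (A := A)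
  have hkc := hypercenter_comm hk
  have htr : IsFaithfulTrace (regTrace : A →ₗ[ℂ] ℂ) := isFaithfulTrace_regTrace
  set h : A →ₗ[ℂ] ℂ := regTrace ∘ₗ LinearMap.mulLeft ℂ k with hdef
  have hval (x : A) : h x = regTrace (k * x) := rfl
  -- As k ∈ A^R, Δ(kx) = (1 ⊗ k)Δ(x), so the density can be moved inside.
  have hE (x : A) : haarEL h x = haarEL regTrace (k * x) := by
    simp only [haarEL, LinearMap.comp_apply, LinearEquiv.coe_coe]
    rw [comul_mul, comul_of_mem_right' hk.1.2, mul_assoc, comul_one_mul, ← (ℛ ℂ x).eq]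
    simp [hdef, Finset.mul_sum]
  have hmem (x : A) : haarEL h x ∈ leftSub A := by
    rw [hE]; exact haarEL_regTrace_mem antip_antip _
  have hone : haarEL h 1 = 1 := by
    rw [hE, mul_one, haarEL_regTrace_left hk.1.1, ← hkc, hkK]
  have hid (l : A) (hl : l ∈ leftSub A) : haarEL h l = l := by
    rw [← mul_one l, haarEL_left_mul _ hl, hone, mul_one]
  have hεL (l : A) (hl : l ∈ leftSub A) : h l = ε l := by rw [← counit_haarEL, hid l hl]
  -- S fixes the hypercenter and χ is S-invariant; with this invariance of h, all properties of E^R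
  -- follow from those of E^L.
  have hanti (x : A) : h (antip x) = h x := by
    have : k * antip x = antip (x * k) := by rw [antip_mul, antip_of_mem hk.1.1 hk.1.2]
    rw [hval, this, regTrace_antip antip_antip htr.nondegenerate, htr.trace, hval]
  have hcomp : h ∘ₗ antip = h := LinearMap.ext hanti
  have hR (x : A) : haarER h x = antip (haarEL h (antip x)) := by
    conv_lhs => rw [← hcomp]
    exact haarER_eq h x
  have hmemR (x : A) : haarER h x ∈ rightSub A := by rw [hR]; exact antip_mem_right (hmem _)
  -- Take u = S(1₁) and v = 1₂ from `haarEL_regTrace`; the sums of products are Π^R(1) and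
  -- S(Π^L(1)), both 1.
  have hcas : ∃ (n : ℕ) (u v : Fin n → A), (∀ x, haarEL h x = ∑ i, h (v i * x) • u i) ∧
      ∑ i, v i * u i = 1 ∧ ∑ i, u i * v i = 1 := by
    let e := (ℛ ℂ (1 : A)).index.equivFin
    have hsum (f : A × A → A) : ∑ i, f (e.symm i) = ∑ i ∈ (ℛ ℂ (1 : A)).index, f i := by
      rw [← Finset.sum_coe_sort (ℛ ℂ (1 : A)).index f]
      exact e.symm.sum_comp (fun i => f i)
    refine ⟨_, fun i => antip ((ℛ ℂ (1 : A)).left (e.symm i)),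
      fun i => (ℛ ℂ (1 : A)).right (e.symm i), fun x => ?_, ?_, ?_⟩
    · rw [hE, haarEL_regTrace antip_antip,
        hsum (fun i => h ((ℛ ℂ (1 : A)).right i * x) • antip ((ℛ ℂ (1 : A)).left i))]
      refine Finset.sum_congr rfl fun i _ => ?_
      rw [hval, htr.trace, ← mul_assoc, ← hkc, mul_assoc]
    · exact (hsum fun i => (ℛ ℂ (1 : A)).right i * antip ((ℛ ℂ (1 : A)).left i)).trans
        (sum_mul_antip antip_antip)
    · exact (hsum fun i => antip ((ℛ ℂ (1 : A)).left i) * (ℛ ℂ (1 : A)).right i).trans sum_antip_mul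
  have hmapL (x : A) : h (haarEL h x) = h x := by rw [hεL _ (hmem x), counit_haarEL]
  have hmapR (x : A) : h (haarER h x) = h x := by rw [hR, hanti, hmapL, hanti]
  have hbiR (b) (hb : b ∈ rightSub A) (c) (hc : c ∈ rightSub A) (x : A) :
      haarER h (b * x * c) = b * haarER h x * c := by
    rw [hR, antip_mul, antip_mul, haarEL_left_mul _ (antip_mem_left hc),
      haarEL_mul_left _ (antip_mem_left hb), antip_mul, antip_mul, antip_antip, antip_antip, ← hR]
  have hbiL (b) (hb : b ∈ leftSub A) (c) (hc : c ∈ leftSub A) (x : A) :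
      haarEL h (b * x * c) = b * haarEL h x * c := by
    rw [haarEL_mul_left _ hc, haarEL_left_mul _ hb]
  have hreg (x : A) : regTrace x = h (haarIndex * x) := by
    rw [hval, ← mul_assoc, hkK, one_mul]
  refine ⟨h, ⟨dualMul_eq_of_haarEL_mem hmem, dualMul_eq_of_haarER_mem hmemR, ?_, ?_⟩,
    ⟨isUnitalStarSub_left, hh, ⟨hmem, hid, hbiL, ?_⟩, hmapL, hcas, haarIndex_mem_left antip_antip,
      haarIndex_comm antip_antip, hreg⟩,
    ⟨isUnitalStarSub_right, hh, ⟨hmemR, fun r hr => ?_, hbiR, ?_⟩, hmapR, ?_, haarIndex_mem_right,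
      haarIndex_comm antip_antip, hreg⟩⟩
  · ext y
    rw [LinearMap.comp_apply, hεL _ (piL_mem y), counit_piL]
  · ext y
    rw [LinearMap.comp_apply, ← hanti, hεL _ (antip_mem_left (piR_mem y)),
      antip_of_mem_right (piR_mem y), counit_piL, counit_piR]
  · refine exists_star_mul_self_of_preserving isUnitalStarSub_left hh hmem fun b hb x => ?_
    rw [← haarEL_left_mul h hb, hmapL]
  · rw [hR, hid _ (antip_mem_left hr), antip_antip]
  · refine exists_star_mul_self_of_preserving isUnitalStarSub_right hh hmemR fun b hb x => ?_
    have := hbiR b hb 1 one_mem_right x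
    rw [mul_one, mul_one] at this
    rw [← this, hmapR]
  · obtain ⟨n, u, v, h1, h2, h3⟩ := hcas
    refine ⟨n, fun i => antip (u i), fun i => antip (v i), fun x => ?_, ?_, ?_⟩
    · rw [hR, h1, map_sum]
      refine Finset.sum_congr rfl fun i _ => ?_
      rw [map_smul, ← hanti, antip_mul, antip_antip, hh.trace]
    · simp only [← antip_mul, ← map_sum, h3, antip_one]
    · simp only [← antip_mul, ← map_sum, h2, antip_one]

end CStar

/-! ### Π^L on the centre and the trivial representation. -/

section WeakHopf

variable {A : Type*} [Ring A] [Algebra ℂ A] [Coalgebra ℂ A] [WeakHopfAlgebra A]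

lemma conv_piL_mul_id (z x : A) : conv (LinearMap.mulRight ℂ z ∘ₗ piL A) LinearMap.id x =
    conv (LinearMap.mulRight ℂ z ∘ₗ antip) LinearMap.id (1 : A) * x := by
  have h (f : A →ₗ[ℂ] A) (y : A) : conv (LinearMap.mulRight ℂ z ∘ₗ f) LinearMap.id y =
      LinearMap.mul' ℂ A (LinearMap.rTensor A (LinearMap.mulRight ℂ z)
        (LinearMap.rTensor A f (Δ y))) := by
    rw [← LinearMap.rTensor_comp_apply]; rfl
  rw [h, h, rTensor_piL_comul, ← (ℛ ℂ (1 : A)).eq]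
  simp [Finset.sum_mul, mul_assoc]

lemma conv_piL_id : conv (piL A) LinearMap.id = (LinearMap.id : A →ₗ[ℂ] A) := by
  ext x
  have h := conv_piL_mul_id 1 x
  rwa [LinearMap.mulRight_one, LinearMap.id_comp, LinearMap.id_comp, conv_antip_id, piR_one,
    one_mul] at h

lemma piL_left_mul {l : A} (hl : l ∈ leftSub A) (y : A) : piL A (l * y) = l * piL A y := by
  have h : Δ (l * y) = (l ⊗ₜ 1) * Δ y := by
    rw [comul_mul, comul_of_mem_left hl, mul_assoc, comul_one_mul]
  rw [← conv_id_antip, conv_apply_of_comul h, conv_apply]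
  conv_lhs => rw [← (ℛ ℂ y).eq]
  simp [Finset.mul_sum, mul_assoc]

/-- Π^L(ex) = Π^L(eΠ^L(x)) = Π^L(Π^L(x)e) = Π^L(x)Π^L(e), the last step by left A^L-linearity. -/
lemma piL_mul_of_central {e : A} (he : ∀ x, e * x = x * e) (x : A) :
    piL A (x * e) = piL A x * piL A e := by
  rw [← he, ← piL_mul_piL, he, piL_left_mul (piL_mem x)]

/-- `Π^L` maps central elements to central elements. -/
lemma piL_central {e : A} (he : ∀ x, e * x = x * e) (x : A) : piL A e * x = x * piL A e := by
  set z := piL A e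
  -- x₁zS(x₂) = Π^L(x)z. Convolving with the identity gives xz = Π^L(x₁)zx₂ = wx with w = S(1₁)z1₂
  -- independent of x; x = 1 shows w = z.
  have h1 : conv (LinearMap.mulRight ℂ z) antip = LinearMap.mulRight ℂ z ∘ₗ piL A := by
    ext y
    rw [conv_mul_piL_antip, piL_mul_of_central he]; rfl
  have h2 : conv (LinearMap.mulRight ℂ z) (piR A) =
      (LinearMap.mulRight ℂ z : A →ₗ[ℂ] A) := by
    have h3 : conv (LinearMap.mulRight ℂ z) (piR A) =
        LinearMap.mulRight ℂ z ∘ₗ conv LinearMap.id (piR A) := by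
      rw [← conv_mulRight]
      ext y
      simp only [conv_apply, LinearMap.comp_apply, LinearMap.mulRight_apply, LinearMap.id_apply,
        mul_assoc, z, piL_mul_piR]
    rw [h3, ← conv_antip_id, ← conv_assoc, conv_id_antip, conv_piL_id, LinearMap.comp_id]
  have h4 (y : A) : y * z = conv (LinearMap.mulRight ℂ z ∘ₗ antip) LinearMap.id (1 : A) * y := by
    rw [← conv_piL_mul_id, ← h1, conv_assoc, conv_antip_id, h2]; rfl
  rw [h4 x]
  congr 1
  simpa using h4 1

/-- `A^L` acts faithfully on the trivial representation. -/
lemma eq_zero_of_counit_mul {x : A} (hx : x ∈ leftSub A) (h : ∀ y, ε (y * x) = 0) : x = 0 := by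
  rw [← piL_of_mem hx, piL_apply]
  simp [h]

omit [WeakHopfAlgebra A] in
lemma arrow_arrow (x y : A) (φ : Module.Dual ℂ A) : arrow x (arrow y φ) = arrow (x * y) φ := by
  ext; simp [arrow, mul_assoc]

omit [WeakHopfAlgebra A] in
lemma mem_trivialRep {φ : Module.Dual ℂ A} :
    φ ∈ trivialRep A ↔ ∃ x, arrow x (ε : Module.Dual ℂ A) = φ := Iff.rfl

lemma arrow_piL {e : A} (he : ∀ x, e * x = x * e) {φ : Module.Dual ℂ A} (hφ : φ ∈ trivialRep A) :
    arrow (piL A e) φ = arrow e φ := by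
  obtain ⟨x, rfl⟩ := mem_trivialRep.1 hφ
  rw [arrow_arrow, arrow_arrow, piL_central he, he]
  ext y
  simp only [arrow, LinearMap.comp_apply, LinearMap.mulRight_apply, ← mul_assoc, counit_mul_piL]

end WeakHopf

/-! ### Vacua, hyperselection sectors and divisibility of dimensions. -/

section CStar

variable {A : Type*} [CStarAlgebra A] [Coalgebra ℂ A] [WeakKacAlgebra A]

/-- A central element is normal, and a normal idempotent is selfadjoint. -/
lemma isStarProjection_of_central {z : A} (hz : z * z = z) (hc : ∀ x, z * x = x * z) :
    IsStarProjection z :=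
  ⟨hz, (IsIdempotentElem.isSelfAdjoint_iff_isStarNormal hz).2 ⟨(hc (star z)).symm⟩⟩

/-- For a vacuum with minimal central projection `e`, the projection `z^L` is `Π^L(e)`. -/
lemma IsVacuum.isLeftVacuumProj {e : A} (he : IsVacuum e) : IsLeftVacuumProj e (piL A e) := by
  have hc : ∀ x, e * x = x * e := mem_center_iff.1 he.1.1
  have hzc := piL_central hc
  have hee := he.1.2.1.isIdempotentElem.eq
  have hz : piL A e * piL A e = piL A e := by rw [← piL_mul_of_central hc, hee]
  have hact (φ) (hφ : φ ∈ trivialRep A) : arrow (piL A e) φ = arrow e φ := arrow_piL hc hφ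
  refine ⟨⟨⟨piL_mem e, mem_center_iff.2 hzc⟩, isStarProjection_of_central hz hzc, fun h0 => ?_,
    fun q hq hqp hqz => ?_⟩, hact⟩
  · obtain ⟨φ, hφ, hne⟩ := he.2
    rw [← hact φ hφ, h0] at hne
    exact hne (by ext; simp [arrow])
  · have hqc : ∀ x, q * x = x * q := mem_center_iff.1 hq.2
    -- q is recovered from qe, which is 0 or e by minimality of e; this gives minimality of Π^L(e).
    have hq' : piL A (q * e) = q := by rw [piL_left_mul hq.1, hqz]
    rcases he.1.2.2.2 (q * e) (isUnitalStarSub_center.mul_mem _ hq.2 _ he.1.1)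
      (hqp.mul_of_comm he.1.2.1 (hqc e)) (by rw [mul_assoc, hee]) with h | h
    · left; rw [← hq', h, map_zero]
    · right; rw [← hq', h]

/-- The submodule pV_ε is 0 or V_ε, so p or 1 − p kills V_ε and is 0, since A^L acts faithfully
there. -/
lemma isMinProj_one_of_isPure (hA : IsPure A) {p : A} (hp : IsMinProj (hypercenter A) p) :
    p = 1 := by
  have hpc := hypercenter_comm hp.1
  have hmem (x : A) (φ) (hφ : φ ∈ trivialRep A) : arrow x φ ∈ trivialRep A := by
    obtain ⟨y, rfl⟩ := mem_trivialRep.1 hφ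
    exact mem_trivialRep.2 ⟨x * y, (arrow_arrow x y _).symm⟩
  have h1 : (ε : Module.Dual ℂ A) ∈ trivialRep A := mem_trivialRep.2 ⟨1, by ext; simp [arrow]⟩
  let P : Module.Dual ℂ A →ₗ[ℂ] Module.Dual ℂ A := (LinearMap.mulRight ℂ p).dualMap
  have hP (φ) : P φ = arrow p φ := rfl
  rcases hA.2 ((trivialRep A).map P) (by rintro _ ⟨φ, hφ, rfl⟩; exact hmem p φ hφ) (by
    rintro x _ ⟨φ, hφ, rfl⟩
    refine ⟨arrow x φ, hmem x φ hφ, ?_⟩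
    rw [hP, hP, arrow_arrow, arrow_arrow, hpc]) with h | h
  · refine absurd (eq_zero_of_counit_mul hp.1.1.1 fun y => ?_) hp.2.2.1
    have h2 : P ε ∈ (trivialRep A).map P := ⟨ε, h1, rfl⟩
    rw [h, Submodule.mem_bot] at h2
    exact LinearMap.congr_fun h2 y
  · rw [← h] at h1
    obtain ⟨φ, hφ, hφ'⟩ := h1
    have h3 : 1 - p = 0 := by
      refine eq_zero_of_counit_mul (Submodule.sub_mem _ one_mem_left hp.1.1.1) fun y => ?_
      rw [← hφ', hP]
      simp [arrow, sub_mul, mul_sub, mul_assoc, hp.2.1.isIdempotentElem.eq]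
    exact (sub_eq_zero.1 h3).symm

variable [FiniteDimensional ℂ A]

/-- The index is a natural number on every hypersector. -/
lemma IsHyperSector.exists_nat {H : A} (hH : IsHyperSector H) :
    ∃ k : ℕ, haarIndex * H = (k : ℂ) • H := by
  obtain ⟨h, -, hL, -⟩ := exists_isHaarFunctional (A := A)
  obtain ⟨c, -, hc⟩ := haarIndex_pos hH
  obtain ⟨k, rfl⟩ := hL.exists_nat hH.1.1.1 (hypercenter_comm hH.1) hH.2.1 hH.2.2.1 hc
  exact ⟨k, hc⟩

/-- Dimensions over central projections of `A^L` on which the index is scalar. -/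
lemma finrank_range_eq_mul {z : A} (hz : IsStarProjection z) (hzL : z ∈ leftSub A) {k : ℕ}
    (hk : haarIndex * z = (k : ℂ) • z) :
    Module.finrank ℂ (LinearMap.range (LinearMap.mulLeft ℂ z)) =
      k * Module.finrank ℂ ((leftSub A).map (LinearMap.mulLeft ℂ z)) := by
  obtain ⟨h, -, hL, -⟩ := exists_isHaarFunctional (A := A)
  have hzz := hz.isIdempotentElem.eq
  have h1 := finrank_range_mulLeft hzz
  have h2 := hL.finrank_map hzL hzz
  rw [hL.regTrace_eq, hk, map_smul, smul_eq_mul, ← h2] at h1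
  exact_mod_cast h1

lemma finrank_map_ne_zero {z : A} (hz : IsStarProjection z) (hzL : z ∈ leftSub A) (h0 : z ≠ 0) :
    Module.finrank ℂ ((leftSub A).map (LinearMap.mulLeft ℂ z)) ≠ 0 := by
  obtain ⟨h, -, hL, -⟩ := exists_isHaarFunctional (A := A)
  have h2 := hL.finrank_map hzL hz.isIdempotentElem.eq
  intro h3
  rw [h3, Nat.cast_zero] at h2
  exact (hL.faithful.proj_pos hz h0).ne h2

lemma exists_isMarkovTrace : ∃ τ : A →ₗ[ℂ] ℂ, IsMarkovTrace τ := by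
  obtain ⟨h, -, hL, hR⟩ := exists_isHaarFunctional (A := A)
  obtain ⟨k, hk, hτ, hn⟩ := hL.faithful.exists_normalized (isUnitalStarSub_hypercenter (A := A))
    fun x hx => hypercenter_comm hx
  exact ⟨_, hL.isMarkovTraceFor hk.1.1 (hypercenter_comm hk) hτ fun _ => rfl,
    hR.isMarkovTraceFor hk.1.2 (hypercenter_comm hk) hτ fun _ => rfl, hn⟩

/-- The density of the Markov trace with respect to h lies in B, and E is B-linear and preserves h.
This identifies Haar and Markov expectations. -/
lemma IsRegularExp.preserving_of_isMarkovTraceFor {B : Submodule ℂ A} {h : A →ₗ[ℂ] ℂ}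
    {E : A →ₗ[ℂ] A} {K : A} (H : IsRegularExp B h E K) {τ : A →ₗ[ℂ] ℂ}
    (hτ : IsMarkovTraceFor B τ) : IsPreservingCondExp B τ E := by
  obtain ⟨k, hk, hkc, hτk⟩ := H.faithful.exists_density hτ.isFaithfulTrace
  exact H.preserving (H.density_mem hτ hk hkc hτk) hτk

lemma IsVacuum.exists_isHyperSector {e : A} (he : IsVacuum e) :
    ∃ (z H : A) (k : ℕ), IsLeftVacuumProj e z ∧ IsHyperSector H ∧ H * z = z ∧
      haarIndex * H = (k : ℂ) • H ∧
      Module.finrank ℂ ((leftSub A).map (LinearMap.mulLeft ℂ z)) ≠ 0 ∧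
      Module.finrank ℂ (LinearMap.range (LinearMap.mulLeft ℂ z)) =
        k * Module.finrank ℂ ((leftSub A).map (LinearMap.mulLeft ℂ z)) := by
  have hz := he.isLeftVacuumProj
  set z := piL A e
  obtain ⟨s, hs, -, h1⟩ := exists_minProj_family (isUnitalStarSub_hypercenter (A := A))
  obtain ⟨H, hH, hHz⟩ : ∃ H ∈ s, H * z ≠ 0 := by
    by_contra! hcon
    refine hz.1.2.2.1 ?_
    rw [← one_mul z, ← h1, Finset.sum_mul, Finset.sum_eq_zero hcon]
  have hHc := hypercenter_comm (hs H hH).1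
  have hHz' : H * z = z := (isCompl_mem hz.1 (hs H hH).2.1
    ((isUnitalStarSub_left.inf isUnitalStarSub_center).mul_mem _ ⟨(hs H hH).1.1.1, (hs H hH).1.2⟩ _
      hz.1.1) hHc).resolve_left hHz
  obtain ⟨k, hk⟩ := IsHyperSector.exists_nat (hs H hH)
  refine ⟨z, H, k, hz, hs H hH, hHz', hk, finrank_map_ne_zero hz.1.2.1 hz.1.1.1 hz.1.2.2.1,
    finrank_range_eq_mul hz.1.2.1 hz.1.1.1 ?_⟩
  rw [← hHz', ← mul_assoc, hk, smul_mul_assoc]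

lemma finrank_left_dvd_of_isPure (hA : IsPure A) :
    Module.finrank ℂ (leftSub A) ∣ Module.finrank ℂ A := by
  obtain ⟨s, hs, -, h1⟩ := exists_minProj_family (isUnitalStarSub_hypercenter (A := A))
  rcases s.eq_empty_or_nonempty with rfl | ⟨p, hp⟩
  · have : Subsingleton A := subsingleton_of_zero_eq_one (by simpa using h1)
    rw [Module.finrank_zero_of_subsingleton (M := A)]
    exact dvd_zero _
  · have hp1 := isMinProj_one_of_isPure hA (hs p hp)
    have hmin := hs p hp
    rw [hp1] at hmin
    obtain ⟨k, hk⟩ := IsHyperSector.exists_nat hmin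
    -- With 1 the only minimal hypercentral projection, the dimension formula for z = 1 is the
    -- divisibility.
    have h := finrank_range_eq_mul hmin.2.1 one_mem_left hk
    rw [LinearMap.mulLeft_one, LinearMap.range_id, finrank_top, Submodule.map_id] at h
    exact ⟨k, by rw [h, mul_comm]⟩

end CStar

end WeakKac

end

theorem mainTheorem2 (A : Type*) [CStarAlgebra A] [Coalgebra ℂ A] [WeakKac.WeakKacAlgebra A] :
    (∃ h : A →ₗ[ℂ] ℂ, WeakKac.IsHaarFunctional h) ∧
    (∃ τ : A →ₗ[ℂ] ℂ, WeakKac.IsMarkovTrace τ) ∧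
    (∃ I ∈ WeakKac.hypercenter A,
      (∀ h : A →ₗ[ℂ] ℂ, WeakKac.IsHaarFunctional h →
        WeakKac.HasIndex (WeakKac.leftSub A) (WeakKac.haarEL h) I ∧
        WeakKac.HasIndex (WeakKac.rightSub A) (WeakKac.haarER h) I) ∧
      (∀ τ : A →ₗ[ℂ] ℂ, WeakKac.IsMarkovTrace τ →
        (∃ E, WeakKac.IsPreservingCondExp (WeakKac.leftSub A) τ E ∧
          WeakKac.HasIndex (WeakKac.leftSub A) E I) ∧
        (∃ E, WeakKac.IsPreservingCondExp (WeakKac.rightSub A) τ E ∧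
          WeakKac.HasIndex (WeakKac.rightSub A) E I)) ∧
      (∀ H : A, WeakKac.IsHyperSector H → ∃ k : ℕ, I * H = (k : ℂ) • H) ∧
      (∀ μ : A, WeakKac.IsVacuum μ →
        ∃ (z H : A) (k : ℕ), WeakKac.IsLeftVacuumProj μ z ∧
          WeakKac.IsHyperSector H ∧ H * z = z ∧ I * H = (k : ℂ) • H ∧
          Module.finrank ℂ ((WeakKac.leftSub A).map (LinearMap.mulLeft ℂ z)) ≠ 0 ∧
          Module.finrank ℂ (LinearMap.range (LinearMap.mulLeft ℂ z)) =
            k * Module.finrank ℂ ((WeakKac.leftSub A).map (LinearMap.mulLeft ℂ z)))) ∧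
    (WeakKac.IsPure A →
      Module.finrank ℂ (WeakKac.leftSub A) ∣ Module.finrank ℂ A) := by
  have := WeakKac.WeakKacAlgebra.finiteDimensional (A := A)
  obtain ⟨h, hh, hL, hR⟩ := WeakKac.exists_isHaarFunctional (A := A)
  refine ⟨⟨h, hh⟩, WeakKac.exists_isMarkovTrace, ⟨WeakKac.haarIndex,
    WeakKac.haarIndex_mem WeakKac.antip_antip, fun h' hh' => ?_, fun τ hτ => ?_,
    fun H hH => hH.exists_nat, fun μ hμ => hμ.exists_isHyperSector⟩,
    WeakKac.finrank_left_dvd_of_isPure⟩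
  -- Uniqueness of the Haar functional reduces to the constructed one.
  · rw [hh'.eq hh]
    exact ⟨hL.hasIndex, hR.hasIndex⟩
  · exact ⟨⟨_, hL.preserving_of_isMarkovTraceFor hτ.left, hL.hasIndex⟩,
      ⟨_, hR.preserving_of_isMarkovTraceFor hτ.right, hR.hasIndex⟩⟩
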